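/- Let ${\cal T}=\{1,\dots,T\}$, let $P_t\in\mathbb R$ be prices, and let $(A_t)_{0\le t\le T}$, $(B_t)_{0\le t\le T}$ be integer sequences with $A_0=B_0=0$, $A_{t-1}\le A_t\le A_{t-1}+1$, $B_{t-1}\le B_t\le B_{t-1}+1$ and $A_t\le B_t$ for all $t\in{\cal T}$. Consider the problem of minimizing $\sum_{t\in\cal T}P_tx_t$ over all $x\in\{0,1\}^{\cal T}$ with $A_t\le\sum_{i=1}^tx_i\le B_t$ for all $t\in\cal T$. The greedy algorithm starts with $x=0$ and goes once through the intervals $t^\star\in\cal T$ in an order of non-decreasing price, which is part of the input (ties are broken arbitrarily). If, for the current bounds, $A_{t^\star-1}<B_{t^\star}$ and ($A_{t^\star-1}<A_T$ or $P_{t^\star}<0$), then it sets $x_{t^\star}:=1$, and it decreases $A_t$ by one for all $t\ge t_A:=\max\{t\in\{0,\dots,T\}: A_t=A_{t^\star-1}\}+1$ and $B_t$ by one for all $t\ge t_B:=\min\{t\in{\cal T}: B_t=B_{t^\star}\}$. The B-A-sets are the classes of the equivalence relation on $\cal T$ given by $t\sim u$ iff $A_{t-1}=A_{u-1}$ and $B_t=B_u$;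 they are sets of consecutive intervals. The values $A_{t-1}$, $B_t$ and the difference $D_t=B_t-A_{t-1}$ are constant on a B-A-set $S$ and are denoted by $A_S,B_S,D_S$. The set $S$ is a local minimum if $A_{S^-}<A_S$ and $B_S<B_{S^+}$, where $S^-$ and $S^+$ are the preceding and the succeeding B-A-set (a condition on a set that does not exist counts as true). Theorem. There is an explicit program for a unit-cost random access machine, using three disjoint-set structures with union by rank and path compression, which runs this greedy algorithm, such that for all inputs as above: 1. After the initialization and after every round, for the current sequences $(A_t)$, $(B_t)$ of the greedy algorithm, the first structure holds the partition of ${\cal T}\cup\{T+1\}$ by the values $A_{t-1}$ and gives $t_A$ for every class; the second one holds the partition of $\cal T$ by the values $B_t$ and gives $t_B$ for every class; the third one holds the partition of $\cal T$ into B-A-sets and stores the difference $D_S$ for exactly those B-A-sets $S$ that are local minima. 2. The program terminates, its output is the solution computed by the greedy algorithm, and this is an optimal solution of the problem. 3. It makes ${\cal O}(T\,\alpha(T))$ steps: there is an absolute constant $C$ such that for $T\ge2$ it makes at most $C\,T\,\alpha(T)$ steps, where $\alpha(n)=\min\{k: n\le \mathrm{Ack}(k,k)\}$ is the inverse Ackermann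 function. Sorting the intervals by price is not counted. In particular this solves the local heating problem: given $H>0$, demands $D_t$ and bounds $L_t\le U_t$ with $L_1=U_1$, minimize $\sum_{t\in\cal T} P_tx_t$ over $x\in\{0,1\}^{\cal T}$ for which there are $s_1,\dots,s_{T+1}$ with $s_{t+1}=s_t+Hx_t-D_t$ for $t\in\cal T$ and $L_t\le s_t\le U_t$ for $1\le t\le T+1$. If this problem has a feasible solution, put, for $0\le t\le T$, $A'_t=\max\{0,\lceil (L_{t+1}-L_1+\sum_{i=1}^tD_i)/H\rceil\}$, $B'_t=\min\{t,\lfloor (U_{t+1}-L_1+\sum_{i=1}^tD_i)/H\rfloor\}$, $A_t=\max_{0\le s\le T}(A'_s-\max(s-t,0))$ and $B_t=\min_{0\le s\le T}(B'_s+\max(t-s,0))$. Then $(A_t)$ and $(B_t)$ have steps $0$ and $1$ and start with $0$, the constraints $A_t\le\sum_{i=1}^tx_i\le B_t$ for $t\in\cal T$ describe exactly the feasible solutions $x\in\{0,1\}^{\cal T}$ of the heating problem, and the program, run on $(A_t)$, $(B_t)$, gives an optimal solution of the heating problem within the same number of steps. -/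

import Mathlib

/-!
# Greedy planning of a converter with a buffer, run with three disjoint-set structures

The problem, the greedy algorithm, a unit-cost random access machine with a step count, and the
program for that machine which runs the greedy algorithm with three disjoint-set structures.
-/

/-! ## The problem

Time intervals are the numbers `1, …, T`. Sequences are functions on `ℕ`, of which only the values
at `0, …, T` (for `L`, `U`: at `1, …, T + 1`) matter. -/

/-- `x t ∈ {0, 1}` for every time interval `t`. -/
def IsSwitching (T : ℕ) (x : ℕ → ℤ) : Prop :=
  ∀ t ∈ Finset.Icc 1 T, x t = 0 ∨ x t = 1

/-- The total price of running the converter according to `x`. -/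
def cost (T : ℕ) (P : ℕ → ℝ) (x : ℕ → ℤ) : ℝ :=
  ∑ t ∈ Finset.Icc 1 T, P t * (x t : ℝ)

/-- `x` belongs to the feasible set `F` and has the least cost there. -/
def IsOptimal (T : ℕ) (P : ℕ → ℝ) (F : (ℕ → ℤ) → Prop) (x : ℕ → ℤ) : Prop :=
  F x ∧ ∀ y, F y → cost T P x ≤ cost T P y

/-- The integers `Z 0, …, Z T` start with `0` and every step is `0` or `1`. -/
def IsStepSeq (T : ℕ) (Z : ℕ → ℤ) : Prop :=
  Z 0 = 0 ∧ ∀ t ∈ Finset.Icc 1 T, Z (t - 1) ≤ Z t ∧ Z t ≤ Z (t - 1) + 1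

/-- The 0-1 sequences all of whose partial sums lie between the bounds `A` and `B`. -/
def BoundsFeasible (T : ℕ) (A B : ℕ → ℤ) (x : ℕ → ℤ) : Prop :=
  IsSwitching T x ∧
    ∀ t ∈ Finset.Icc 1 T, A t ≤ ∑ i ∈ Finset.Icc 1 t, x i ∧ ∑ i ∈ Finset.Icc 1 t, x i ≤ B t

/-- The local heating problem: `H` is the heat produced by one interval of running, `D` the demand,
and the states of charge `s 1, …, s (T + 1)` have to stay between `L` and `U`. -/
def HeatingFeasible (T : ℕ) (H : ℝ) (L U D : ℕ → ℝ) (x : ℕ → ℤ) : Prop :=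
  IsSwitching T x ∧ ∃ s : ℕ → ℝ,
    (∀ t ∈ Finset.Icc 1 T, s (t + 1) = s t + H * (x t : ℝ) - D t) ∧
    (∀ t ∈ Finset.Icc 1 (T + 1), L t ≤ s t ∧ s t ≤ U t)

/-- The bound `A'` on the partial sums that the lower bounds on the buffer impose. -/
noncomputable def rawLower (H : ℝ) (L D : ℕ → ℝ) (t : ℕ) : ℤ :=
  max 0 ⌈(L (t + 1) - L 1 + ∑ i ∈ Finset.Icc 1 t, D i) / H⌉

/-- The bound `B'` on the partial sums that the upper bounds on the buffer impose. -/
noncomputable def rawUpper (H : ℝ) (L U D : ℕ → ℝ) (t : ℕ) : ℤ :=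
  min (t : ℤ) ⌊(U (t + 1) - L 1 + ∑ i ∈ Finset.Icc 1 t, D i) / H⌋

/-- The bound `A`: the best lower bound on the `t`-th partial sum that follows from `A'` and from
the fact that partial sums of 0-1 sequences have steps `0` and `1`. -/
noncomputable def heatLower (T : ℕ) (H : ℝ) (L D : ℕ → ℝ) (t : ℕ) : ℤ :=
  (Finset.range (T + 1)).sup' Finset.nonempty_range_add_one
    fun s => rawLower H L D s - ((s - t : ℕ) : ℤ)

/-- The bound `B`: the best upper bound on the `t`-th partial sum that follows from `B'` and from
the fact that partial sums of 0-1 sequences have steps `0` and `1`. -/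
noncomputable def heatUpper (T : ℕ) (H : ℝ) (L U D : ℕ → ℝ) (t : ℕ) : ℤ :=
  (Finset.range (T + 1)).inf' Finset.nonempty_range_add_one
    fun s => rawUpper H L U D s + ((t - s : ℕ) : ℤ)

/-- `ord 1, …, ord T` is an enumeration of the time intervals by non-decreasing price. -/
def IsPriceOrder (T : ℕ) (P : ℕ → ℝ) (ord : ℕ → ℕ) : Prop :=
  Set.BijOn ord (Set.Icc 1 T) (Set.Icc 1 T) ∧
    ∀ i ∈ Set.Icc 1 T, ∀ j ∈ Set.Icc 1 T, i ≤ j → P (ord i) ≤ P (ord j)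

/-! ## The greedy algorithm -/

/-- `t_A = max {s ∈ {0, …, T} | A s = A (t - 1)} + 1`. -/
def lastA (T : ℕ) (A : ℕ → ℤ) (t : ℕ) : ℕ :=
  Nat.findGreatest (fun s => A s = A (t - 1)) T + 1

/-- `t_B = min {s ∈ {1, …, T} | B s = B t}`. -/
noncomputable def firstB (T : ℕ) (B : ℕ → ℤ) (t : ℕ) : ℕ :=
  sInf {s | s ∈ Set.Icc 1 T ∧ B s = B t}

/-- The current bounds and the current (partial) solution. -/
structure GreedyState where
  A : ℕ → ℤ
  B : ℕ → ℤ
  x : ℕ → ℤ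

open Classical in
/-- One round of the greedy algorithm, for the time interval `t`. -/
noncomputable def greedyStep (T : ℕ) (P : ℕ → ℝ) (t : ℕ) (g : GreedyState) : GreedyState :=
  if g.A (t - 1) < g.B t ∧ (g.A (t - 1) < g.A T ∨ P t < 0) then
    { A := fun s => if s < lastA T g.A t then g.A s else g.A s - 1
      B := fun s => if s < firstB T g.B t then g.B s else g.B s - 1
      x := Function.update g.x t 1 }
  else g

/-- The greedy algorithm after `k` rounds. -/
noncomputable def greedy (T : ℕ) (P : ℕ → ℝ) (A B : ℕ → ℤ) (ord : ℕ → ℕ) : ℕ → GreedyState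
  | 0 => ⟨A, B, fun _ => 0⟩
  | k + 1 => greedyStep T P (ord (k + 1)) (greedy T P A B ord k)

/-! ## B-A-sets -/

/-- The equivalence relation whose classes are the B-A-sets. -/
def SameBA (A B : ℕ → ℤ) (t u : ℕ) : Prop :=
  A (t - 1) = A (u - 1) ∧ B t = B u

/-- The B-A-set `S` of `t` is a local minimum: `A` is smaller on the preceding B-A-set (if there is
one), and `B` is larger on the succeeding B-A-set (if there is one). The preceding B-A-set is the
one of the time interval just before the first one of `S`, and similarly for the succeeding one. -/
def IsMinBA (T : ℕ) (A B : ℕ → ℤ) (t : ℕ) : Prop :=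
  (∀ s, 1 ≤ s → s + 1 ≤ T → SameBA A B (s + 1) t → ¬ SameBA A B s (s + 1) →
      A (s - 1) < A (s + 1 - 1)) ∧
  (∀ s, 1 ≤ s → s + 1 ≤ T → SameBA A B s t → ¬ SameBA A B s (s + 1) → B s < B (s + 1))

/-! ## The machine

A unit-cost random access machine: finitely many registers and finitely many arrays hold integers.
Every constant, every access to a register or to a cell of an array, every addition, subtraction,
comparison and logical connective, every assignment and every branching takes one step. The only
access to the prices is the test whether the price of a given time interval is negative. -/

/-- The three disjoint-set structures: for the partition by `t_A`, for the partition by `t_B`, and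
for the B-A-sets. -/
inductive Dsu
  | byA | byB | byBA
  deriving DecidableEq

/-- The arrays. `inA`, `inB`, `order` hold the input, `out` the output. Every disjoint-set
structure has the parent pointers, the ranks, and the smallest and the largest element of the set,
stored at its root. `diff` holds the differences, stored at roots of the third structure. -/
inductive Arr
  | inA | inB | order | out
  | par (s : Dsu) | rank (s : Dsu) | lo (s : Dsu) | hi (s : Dsu)
  | diff
  deriving DecidableEq

/-- The registers. `T` holds the number of time intervals. -/
inductive Reg
  | T | i | k | t | tA | tB
  | cur | nxt | r₁ | r₂ | root | mn | mx
  | p | q | flag | set | d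
  deriving DecidableEq

/-- The memory of the machine. -/
structure Mem where
  reg : Reg → ℤ
  arr : Arr → ℤ → ℤ

def Mem.setReg (m : Mem) (v : Reg) (z : ℤ) : Mem :=
  { m with reg := Function.update m.reg v z }

def Mem.setArr (m : Mem) (a : Arr) (i z : ℤ) : Mem :=
  { m with arr := Function.update m.arr a (Function.update (m.arr a) i z) }

inductive Expr
  | lit (z : ℤ)
  | reg (v : Reg)
  | get (a : Arr) (e : Expr)
  | plus (e f : Expr)
  | minus (e f : Expr)

def Expr.eval (m : Mem) : Expr → ℤ
  | lit z => z
  | reg v => m.reg v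
  | get a e => m.arr a (e.eval m)
  | plus e f => e.eval m + f.eval m
  | minus e f => e.eval m - f.eval m

/-- The number of steps that the evaluation takes. -/
def Expr.steps : Expr → ℕ
  | lit _ => 1
  | reg _ => 1
  | get _ e => e.steps + 1
  | plus e f => e.steps + f.steps + 1
  | minus e f => e.steps + f.steps + 1

inductive Test
  | eq (e f : Expr)
  | le (e f : Expr)
  | negPrice (e : Expr)
  | not (c : Test)
  | or (c d : Test)
  | and (c d : Test)

def Test.Holds (P : ℕ → ℝ) (m : Mem) : Test → Prop
  | eq e f => e.eval m = f.eval m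
  | le e f => e.eval m ≤ f.eval m
  | negPrice e => P (e.eval m).toNat < 0
  | not c => ¬ c.Holds P m
  | or c d => c.Holds P m ∨ d.Holds P m
  | and c d => c.Holds P m ∧ d.Holds P m

/-- The number of steps that the evaluation takes. -/
def Test.steps : Test → ℕ
  | eq e f => e.steps + f.steps + 1
  | le e f => e.steps + f.steps + 1
  | negPrice e => e.steps + 1
  | not c => c.steps + 1
  | or c d => c.steps + d.steps + 1
  | and c d => c.steps + d.steps + 1

inductive Cmd
  | skip
  | assign (v : Reg) (e : Expr)
  | put (a : Arr) (i e : Expr)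
  | seq (c d : Cmd)
  | ite (b : Test) (c d : Cmd)
  | while (b : Test) (c : Cmd)

/-- `Exec P c m m' n`: started with the memory `m`, the command `c` terminates after exactly `n`
steps with the memory `m'`. -/
inductive Exec (P : ℕ → ℝ) : Cmd → Mem → Mem → ℕ → Prop
  | skip (m : Mem) : Exec P .skip m m 1
  | assign (m : Mem) (v : Reg) (e : Expr) :
      Exec P (.assign v e) m (m.setReg v (e.eval m)) (e.steps + 1)
  | put (m : Mem) (a : Arr) (i e : Expr) :
      Exec P (.put a i e) m (m.setArr a (i.eval m) (e.eval m)) (i.steps + e.steps + 1)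
  | seq {c d : Cmd} {m m' m'' : Mem} {n n' : ℕ} :
      Exec P c m m' n → Exec P d m' m'' n' → Exec P (.seq c d) m m'' (n + n')
  | ite_true {b : Test} {c d : Cmd} {m m' : Mem} {n : ℕ} :
      b.Holds P m → Exec P c m m' n → Exec P (.ite b c d) m m' (b.steps + 1 + n)
  | ite_false {b : Test} {c d : Cmd} {m m' : Mem} {n : ℕ} :
      ¬ b.Holds P m → Exec P d m m' n → Exec P (.ite b c d) m m' (b.steps + 1 + n)
  | while_true {b : Test} {c : Cmd} {m m' m'' : Mem} {n n' : ℕ} :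
      b.Holds P m → Exec P c m m' n → Exec P (.while b c) m' m'' n' →
        Exec P (.while b c) m m'' (b.steps + 1 + n + n')
  | while_false {b : Test} {c : Cmd} {m : Mem} :
      ¬ b.Holds P m → Exec P (.while b c) m m (b.steps + 1)

/-- The machine is deterministic. -/
theorem Exec.deterministic {P : ℕ → ℝ} {c : Cmd} {m m₁ m₂ : Mem} {n₁ n₂ : ℕ}
    (h₁ : Exec P c m m₁ n₁) (h₂ : Exec P c m m₂ n₂) : m₁ = m₂ ∧ n₁ = n₂ := by
  induction h₁ generalizing m₂ n₂ with
  | skip | assign | put => cases h₂; exact ⟨rfl, rfl⟩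
  | seq _ _ ih ih' =>
    cases h₂ with
    | seq a b =>
      obtain ⟨rfl, rfl⟩ := ih a
      obtain ⟨rfl, rfl⟩ := ih' b
      exact ⟨rfl, rfl⟩
  | ite_true hb _ ih =>
    cases h₂ with
    | ite_true _ a => obtain ⟨rfl, rfl⟩ := ih a; exact ⟨rfl, rfl⟩
    | ite_false hb' _ => exact absurd hb hb'
  | ite_false hb _ ih =>
    cases h₂ with
    | ite_true hb' _ => exact absurd hb' hb
    | ite_false _ a => obtain ⟨rfl, rfl⟩ := ih a; exact ⟨rfl, rfl⟩
  | while_true hb _ _ ih ih' =>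
    cases h₂ with
    | while_true _ a b =>
      obtain ⟨rfl, rfl⟩ := ih a
      obtain ⟨rfl, rfl⟩ := ih' b
      exact ⟨rfl, rfl⟩
    | while_false hb' => exact absurd hb hb'
  | while_false hb =>
    cases h₂ with
    | while_true hb' _ _ => exact absurd hb' hb
    | while_false _ => exact ⟨rfl, rfl⟩

/-! ## The program -/

namespace Prog

open Expr Test Cmd

def block : List Cmd → Cmd
  | [] => skip
  | c :: cs => seq c (block cs)

def ifThen (b : Test) (c : Cmd) : Cmd := ite b c skip

def ne (e f : Expr) : Test := Test.not (eq e f)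

def one : Expr := lit 1

/-- `for v = a, …, b do c`. -/
def forTo (v : Reg) (a b : Expr) (c : Cmd) : Cmd :=
  block [assign v a, Cmd.while (le (reg v) b) (block [c, assign v (plus (reg v) one)])]

/-- Create the set `{e}`. -/
def makeSet (s : Dsu) (e : Expr) : Cmd :=
  block [put (.par s) e e, put (.rank s) e (lit 0), put (.lo s) e e, put (.hi s) e e]

/-- Find the root of the set of `e`, with path compression, and put it into the register `v`. -/
def find (s : Dsu) (e : Expr) (v : Reg) : Cmd :=
  block [
    assign .cur e,
    assign v (reg .cur),
    Cmd.while (ne (get (.par s) (reg v)) (reg v)) (assign v (get (.par s) (reg v))),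
    Cmd.while (ne (reg .cur) (reg v)) (block [
      assign .nxt (get (.par s) (reg .cur)),
      put (.par s) (reg .cur) (reg v),
      assign .cur (reg .nxt)])]

/-- Unite the set of `e` with the set of `f`, by rank, where the elements of the first set are
smaller than those of the second one. The root of the union is put into the register `root`. -/
def unite (s : Dsu) (e f : Expr) : Cmd :=
  block [
    find s e .r₁,
    find s f .r₂,
    assign .root (reg .r₁),
    ifThen (ne (reg .r₁) (reg .r₂)) (block [
      assign .mn (get (.lo s) (reg .r₁)),
      assign .mx (get (.hi s) (reg .r₂)),
      ite (le (get (.rank s) (reg .r₂)) (get (.rank s) (reg .r₁)))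
        (block [
          ifThen (eq (get (.rank s) (reg .r₁)) (get (.rank s) (reg .r₂)))
            (put (.rank s) (reg .r₁) (plus (get (.rank s) (reg .r₁)) one)),
          put (.par s) (reg .r₂) (reg .r₁)])
        (block [
          put (.par s) (reg .r₁) (reg .r₂),
          assign .root (reg .r₂)]),
      put (.lo s) (reg .root) (reg .mn),
      put (.hi s) (reg .root) (reg .mx)])]

/-- Set the register `flag` to `1` if the B-A-set with root `v` is a local minimum, and to `0`
otherwise. Only the first two structures are used to compare values of the bounds. -/
def testLocalMin (v : Reg) : Cmd :=
  block [
    assign .mn (get (.lo .byBA) (reg v)),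
    assign .mx (get (.hi .byBA) (reg v)),
    assign .flag one,
    ifThen (le (lit 2) (reg .mn)) (block [
      find .byA (minus (reg .mn) one) .p,
      find .byA (reg .mn) .q,
      ifThen (eq (reg .p) (reg .q)) (assign .flag (lit 0))]),
    ifThen (le (plus (reg .mx) one) (reg .T)) (block [
      find .byB (reg .mx) .p,
      find .byB (plus (reg .mx) one) .q,
      ifThen (eq (reg .p) (reg .q)) (assign .flag (lit 0))])]

/-- Store the value of the register `d` as the difference of the B-A-set with root `v` if that set
is a local minimum, and otherwise `-1`, which means that no difference is stored. -/
def storeDiff (v : Reg) : Cmd :=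
  block [
    testLocalMin v,
    ite (eq (reg .flag) one)
      (put .diff (reg v) (reg .d))
      (put .diff (reg v) (lit (-1)))]

/-- Set up the three structures and the output. -/
def init : Cmd :=
  block [
    forTo .i one (plus (reg .T) one) (makeSet .byA (reg .i)),
    forTo .i one (reg .T) (block [
      makeSet .byB (reg .i),
      makeSet .byBA (reg .i),
      put .out (reg .i) (lit 0)]),
    forTo .i (lit 2) (plus (reg .T) one)
      (ifThen (eq (get .inA (minus (reg .i) (lit 2))) (get .inA (minus (reg .i) one)))
        (unite .byA (minus (reg .i) one) (reg .i))),
    forTo .i (lit 2) (reg .T) (block [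
      ifThen (eq (get .inB (minus (reg .i) one)) (get .inB (reg .i)))
        (unite .byB (minus (reg .i) one) (reg .i)),
      ifThen (Test.and
          (eq (get .inA (minus (reg .i) (lit 2))) (get .inA (minus (reg .i) one)))
          (eq (get .inB (minus (reg .i) one)) (get .inB (reg .i))))
        (unite .byBA (minus (reg .i) one) (reg .i))]),
    forTo .i one (reg .T) (block [
      find .byBA (reg .i) .set,
      assign .d (minus (get .inB (reg .i)) (get .inA (minus (reg .i) one))),
      storeDiff .set]),
    assign .k one]

/-- The update of the three structures after the converter has been turned on in the time interval
in the register `t`. -/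
def update : Cmd :=
  block [
    -- find `t_A` and `t_B`
    find .byA (reg .t) .p,
    assign .tA (get (.hi .byA) (reg .p)),
    find .byB (reg .t) .q,
    assign .tB (get (.lo .byB) (reg .q)),
    -- the difference of the B-A-set of `t`, if it is stored, decreases
    find .byBA (reg .t) .set,
    ifThen (le (lit 0) (get .diff (reg .set)))
      (put .diff (reg .set) (minus (get .diff (reg .set)) one)),
    -- update of the partitions by `t_A` and `t_B`
    ifThen (le (reg .tA) (reg .T)) (unite .byA (reg .tA) (plus (reg .tA) one)),
    ifThen (le (lit 2) (reg .tB)) (unite .byB (minus (reg .tB) one) (reg .tB)),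
    -- the B-A-sets of `t_B - 1` and `t_B`
    ifThen (le (lit 2) (reg .tB)) (block [
      find .byA (minus (reg .tB) one) .p,
      find .byA (reg .tB) .q,
      find .byBA (minus (reg .tB) one) .set,
      ite (eq (reg .p) (reg .q))
        (block [
          assign .d (get .diff (reg .set)),
          unite .byBA (minus (reg .tB) one) (reg .tB),
          storeDiff .root])
        (put .diff (reg .set) (lit (-1)))]),
    -- the B-A-sets of `t_A` and `t_A + 1`
    ifThen (le (plus (reg .tA) one) (reg .T)) (block [
      find .byB (reg .tA) .p,
      find .byB (plus (reg .tA) one) .q,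
      find .byBA (plus (reg .tA) one) .set,
      ite (eq (reg .p) (reg .q))
        (block [
          assign .d (get .diff (reg .set)),
          unite .byBA (reg .tA) (plus (reg .tA) one),
          storeDiff .root])
        (put .diff (reg .set) (lit (-1)))])]

/-- One round of the greedy algorithm, for the `k`-th time interval in the order by prices. The
bounds satisfy `A (t - 1) = B t` if and only if the difference `0` is stored for the B-A-set of
`t`, and `A (t - 1) = A T` if and only if `t` and `T + 1` are in the same set of the partition by
`t_A`. -/
def round : Cmd :=
  block [
    assign .t (get .order (reg .k)),
    find .byBA (reg .t) .set,
    ifThen (ne (get .diff (reg .set)) (lit 0)) (block [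
      find .byA (reg .t) .p,
      find .byA (plus (reg .T) one) .q,
      ifThen (Test.or (ne (reg .p) (reg .q)) (negPrice (reg .t))) (block [
        put .out (reg .t) one,
        update])]),
    assign .k (plus (reg .k) one)]

/-- The first `j` rounds, after the initialization. -/
def rounds : ℕ → Cmd
  | 0 => init
  | j + 1 => seq (rounds j) round

/-- The whole program. -/
def main : Cmd :=
  seq init (Cmd.while (le (reg .k) (reg .T)) round)

end Prog

/-! ## What the machine is given and what the structures hold -/

/-- The input `T`, `A`, `B`, `ord` is in the memory; the rest of the memory is arbitrary. -/
def Loaded (T : ℕ) (A B : ℕ → ℤ) (ord : ℕ → ℕ) (m : Mem) : Prop :=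
  m.reg .T = T ∧ (∀ t ≤ T, m.arr .inA t = A t) ∧ (∀ t ≤ T, m.arr .inB t = B t) ∧
    ∀ k ∈ Finset.Icc 1 T, m.arr .order k = ord k

/-- The sequence in the output array. -/
def output (m : Mem) (t : ℕ) : ℤ := m.arr .out t

/-- `r` is the root that is reached from `t` along the parent pointers of the structure `s`. -/
def IsRootOf (m : Mem) (s : Dsu) (t r : ℤ) : Prop :=
  m.arr (.par s) r = r ∧ ∃ j : ℕ, (m.arr (.par s))^[j] t = r

/-- `t` and `u` are in the same set of the structure `s`. -/
def SameSet (m : Mem) (s : Dsu) (t u : ℤ) : Prop :=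
  ∃ r, IsRootOf m s t r ∧ IsRootOf m s u r

/-- The three structures represent the bounds `A` and `B`. The first one holds the partition by
`t_A` of the time intervals and of `T + 1` (which stands for `A T`), and gives `t_A`; the second one
holds the partition by `t_B`, and gives `t_B`; the third one holds the partition into B-A-sets,
and for every B-A-set it stores the difference at the root if and only if the set is a local
minimum (the entry `-1` means that nothing is stored). -/
structure Tracks (T : ℕ) (A B : ℕ → ℤ) (m : Mem) : Prop where
  partA : ∀ t ∈ Finset.Icc 1 (T + 1), ∀ u ∈ Finset.Icc 1 (T + 1),
    SameSet m .byA t u ↔ A (t - 1) = A (u - 1)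
  valueA : ∀ t ∈ Finset.Icc 1 (T + 1), ∃ r, IsRootOf m .byA t r ∧ m.arr (.hi .byA) r = lastA T A t
  partB : ∀ t ∈ Finset.Icc 1 T, ∀ u ∈ Finset.Icc 1 T, SameSet m .byB t u ↔ B t = B u
  valueB : ∀ t ∈ Finset.Icc 1 T, ∃ r, IsRootOf m .byB t r ∧ m.arr (.lo .byB) r = firstB T B t
  partBA : ∀ t ∈ Finset.Icc 1 T, ∀ u ∈ Finset.Icc 1 T, SameSet m .byBA t u ↔ SameBA A B t u
  valueBA : ∀ t ∈ Finset.Icc 1 T, ∃ r, IsRootOf m .byBA t r ∧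
    (IsMinBA T A B t → m.arr .diff r = B t - A (t - 1)) ∧
    (¬ IsMinBA T A B t → m.arr .diff r = -1)

/-! ## The inverse of the Ackermann function -/

/-- `α n` is the least `k` with `n ≤ ack k k`. -/
noncomputable def invAck (n : ℕ) : ℕ := sInf {k | n ≤ ack k k}

/-! ## Partial sums and step sequences -/

/-! Optimality of the greedy solution rests on the invariant `GreedyInv`. Adding a sequence that
respects the current bounds to the current `x` gives partial sums within the original bounds, and
every feasible `z` is matched by a residual 0-1 sequence `y`, zero on the processed intervals and
within the current bounds, with `cost x + cost y ≤ cost z`. The passage to the new bounds loses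
nothing: since partial sums are monotone, a 0-1 sequence that is on at `t` satisfies the old bounds
exactly when the sequence with `t` removed satisfies the lowered ones (`between_of_drop`,
`drop_of_between`). If the algorithm accepts `t`, the residual sequence can be made to contain `t`
without raising its cost (`exchange`); if it refuses `t`, then `t` can be deleted from it. After the
last round the residual sequence is zero.

For the structures, a partition into intervals is determined by its borders, that is, by the pairs
`i`, `i + 1` in different classes. Accepting `t` removes one border from the partition by `A` (at
`t_A`) and one from that by `B` (just before `t_B`), if these borders exist, because `A` and `B`
rise there by exactly one. The B-A-sets are the common refinement. The difference falls by one on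
`t_B, …, t_A` and nowhere else. A B-A-set other than that of `t` which meets this range is not a
local minimum, since its border facing `t` lies inside the class of `t` by `B` or by `A`. Hence a
single stored value changes (`StoresMin.decrement`), and removing a border afterwards affects only
the B-A-sets next to it (`StoresMin.joinRight_merge`, `StoresMin.joinRight` and their mirror
images). Storing differences only at local minima is enough for the test `A (t - 1) < B t`, because
a B-A-set with difference `0` is always a local minimum (`Represents.diff_eq_zero_iff`).

The running time follows from the potential method for union by rank with path compression. A
nonroot has a level and an iteration count, which measure how far the rank of its parent exceeds its
own in terms of `fastGrow`. With `κ` levels available, all but at most `κ + 1` of the edges on a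
compressed path are paid for by a drop of the potential (`childPot_lt`, `runs_compressLoop`), and a
link raises the potential by at most `κ` (`Forest.link_pot`). All that is required of `κ` is `T + 1
≤ fastGrow κ 1`, and `κ = α(T) + 1` satisfies this (`lt_fastGrow_invAck`). Costs are stated as `n +
23 * memPot after ≤ 23 * memPot before + const`, so they add up along a program; 23 is the number of
machine steps per edge of a path in `find`.

In the heating problem the state of charge is an affine function of the partial sums of `x`, so the
buffer limits are integer bounds on these sums; the maxima and minima that define `A` and `B` only
make explicit what 0-1 steps force anyway. -/

theorem IsStepSeq.le_of_le {T : ℕ} {Z : ℕ → ℤ} (hZ : IsStepSeq T Z) {s t : ℕ} (hst : s ≤ t)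
    (ht : t ≤ T) : Z s ≤ Z t := by
  induction t, hst using Nat.le_induction with
  | base => exact le_rfl
  | succ t hst ih =>
    have := (hZ.2 (t + 1) (Finset.mem_Icc.2 ⟨by omega, ht⟩)).1
    simp only [Nat.add_sub_cancel] at this
    exact (ih (by omega)).trans this

theorem IsStepSeq.nonneg {T : ℕ} {Z : ℕ → ℤ} (hZ : IsStepSeq T Z) {t : ℕ} (ht : t ≤ T) :
    0 ≤ Z t := hZ.1 ▸ hZ.le_of_le (Nat.zero_le t) ht

/-- The sequence `Z`, decreased by one from the index `c` on. -/
def dropFrom (c : ℕ) (Z : ℕ → ℤ) (s : ℕ) : ℤ := if s < c then Z s else Z s - 1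

/-- Only the step into `c` changes, and it falls from `1` to `0`; if `c` is beyond `T` nothing
changes. -/
theorem IsStepSeq.dropFrom {T c : ℕ} {Z : ℕ → ℤ} (hZ : IsStepSeq T Z) (hc : 1 ≤ c)
    (h : c ≤ T → Z (c - 1) < Z c) : IsStepSeq T (dropFrom c Z) := by
  refine ⟨by rw [_root_.dropFrom, if_pos (by omega), hZ.1], fun t ht => ?_⟩
  have h2 := hZ.2 t ht
  obtain ⟨ht1, htT⟩ := Finset.mem_Icc.1 ht
  unfold _root_.dropFrom
  rcases lt_trichotomy t c with h' | h' | h'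
  · rw [if_pos h', if_pos (by omega)]; exact h2
  · subst h'
    rw [if_pos (by omega), if_neg (by omega)]
    have := h htT
    omega
  · rw [if_neg (by omega), if_neg (by omega)]; omega

/-! ### Partial sums and costs after changing one entry. -/

theorem sum_update_Icc {y : ℕ → ℤ} {t : ℕ} (ht : 1 ≤ t) (v : ℤ) (s : ℕ) :
    ∑ i ∈ Finset.Icc 1 s, Function.update y t v i =
      ∑ i ∈ Finset.Icc 1 s, y i + if t ≤ s then v - y t else 0 := by
  split_ifs with h
  · rw [Finset.sum_update_of_mem (Finset.mem_Icc.2 ⟨ht, h⟩), Finset.sum_eq_add_sum_sdiff_singleton_of_mem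
      (Finset.mem_Icc.2 ⟨ht, h⟩) y]
    ring
  · rw [Finset.sum_update_of_notMem (by simp; omega)]; simp

theorem sum_Icc_mono {T : ℕ} {y : ℕ → ℤ} (hy : IsSwitching T y) {s t : ℕ} (hst : s ≤ t)
    (ht : t ≤ T) : ∑ i ∈ Finset.Icc 1 s, y i ≤ ∑ i ∈ Finset.Icc 1 t, y i := by
  refine Finset.sum_le_sum_of_subset_of_nonneg (Finset.Icc_subset_Icc_right hst) fun i hi _ => ?_
  rw [Finset.mem_Icc] at hi
  rcases hy i (Finset.mem_Icc.2 ⟨hi.1, by omega⟩) with h | h <;> omega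

theorem sum_Icc_eq_of_zero {y : ℕ → ℤ} {s t : ℕ} (hst : s ≤ t)
    (h : ∀ i, s < i → i ≤ t → y i = 0) :
    ∑ i ∈ Finset.Icc 1 t, y i = ∑ i ∈ Finset.Icc 1 s, y i := by
  symm
  refine Finset.sum_subset (Finset.Icc_subset_Icc_right hst) fun i hi hi' => ?_
  simp only [Finset.mem_Icc] at hi hi'
  exact h i (by omega) hi.2

theorem sum_Icc_pred {y : ℕ → ℤ} {t : ℕ} (ht : 1 ≤ t) :
    ∑ i ∈ Finset.Icc 1 t, y i = ∑ i ∈ Finset.Icc 1 (t - 1), y i + y t := by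
  obtain ⟨t, rfl⟩ := Nat.exists_eq_add_of_le' ht
  rw [Finset.sum_Icc_succ_top (by omega)]; simp

theorem cost_update {T : ℕ} {P : ℕ → ℝ} {y : ℕ → ℤ} {t : ℕ} (ht : t ∈ Finset.Icc 1 T) (v : ℤ) :
    cost T P (Function.update y t v) = cost T P y + P t * ((v : ℝ) - y t) := by
  unfold cost
  rw [← Finset.add_sum_erase _ _ ht, ← Finset.add_sum_erase _ (fun i => P i * (y i : ℝ)) ht,
    Finset.sum_congr rfl (g := fun i => P i * (y i : ℝ))]
  · simp; ring
  · intro i hi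
    rw [Function.update_of_ne (Finset.ne_of_mem_erase hi)]

/-! ## The thresholds of the greedy algorithm -/

theorem lastA_spec {T : ℕ} {A : ℕ → ℤ} {t : ℕ} (h1 : 1 ≤ t) (ht : t ≤ T + 1) :
    t ≤ lastA T A t ∧ lastA T A t ≤ T + 1 ∧ A (lastA T A t - 1) = A (t - 1) ∧
      ∀ s, lastA T A t ≤ s → s ≤ T → A s ≠ A (t - 1) := by
  unfold lastA
  -- The index `t - 1` itself qualifies, so the search does not fall back on its default value.
  have h := Nat.findGreatest_spec (P := fun s => A s = A (t - 1)) (n := T) (m := t - 1) (by omega) rfl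
  have h' := Nat.le_findGreatest (P := fun s => A s = A (t - 1)) (n := T) (m := t - 1) (by omega) rfl
  have h'' := Nat.findGreatest_le (P := fun s => A s = A (t - 1)) T
  refine ⟨by omega, by omega, by simpa using h, fun s hs hsT => ?_⟩
  exact Nat.findGreatest_is_greatest (P := fun s => A s = A (t - 1)) (by omega) hsT

theorem firstB_spec {T : ℕ} {B : ℕ → ℤ} {t : ℕ} (h1 : 1 ≤ t) (ht : t ≤ T) :
    1 ≤ firstB T B t ∧ firstB T B t ≤ t ∧ B (firstB T B t) = B t ∧
      ∀ s, 1 ≤ s → s < firstB T B t → B s ≠ B t := by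
  have hm : t ∈ {s | s ∈ Set.Icc 1 T ∧ B s = B t} := ⟨⟨h1, ht⟩, rfl⟩
  have h := Nat.sInf_mem ⟨t, hm⟩
  refine ⟨h.1.1, Nat.sInf_le hm, h.2, fun s hs hs' he => ?_⟩
  exact absurd (Nat.sInf_le (s := {s | s ∈ Set.Icc 1 T ∧ B s = B t})
    ⟨⟨hs, by have := h.1.2; unfold firstB at hs'; omega⟩, he⟩) (by unfold firstB at hs'; omega)

theorem lastA_unique {T : ℕ} {A : ℕ → ℤ} {t c : ℕ} (h1 : 1 ≤ t) (ht : t ≤ T + 1) (hc : 1 ≤ c)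
    (hcT : c ≤ T + 1) (h : A (c - 1) = A (t - 1)) (h' : ∀ s, c ≤ s → s ≤ T → A s ≠ A (t - 1)) :
    lastA T A t = c := by
  obtain ⟨_, h2, h3, h4⟩ := lastA_spec (A := A) h1 ht
  rcases lt_trichotomy (lastA T A t) c with hlt | hlt | hlt
  · exact absurd h (h4 (c - 1) (by omega) (by omega))
  · exact hlt
  · exact absurd h3 (h' _ (by omega) (by omega))

theorem firstB_unique {T : ℕ} {B : ℕ → ℤ} {t c : ℕ} (h1 : 1 ≤ t) (ht : t ≤ T) (hc : 1 ≤ c)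
    (h : B c = B t) (h' : ∀ s, 1 ≤ s → s < c → B s ≠ B t) :
    firstB T B t = c := by
  obtain ⟨h2, _, h3, h4⟩ := firstB_spec (B := B) h1 ht
  rcases lt_trichotomy (firstB T B t) c with hlt | hlt | hlt
  · exact absurd h3 (h' _ h2 hlt)
  · exact hlt
  · exact absurd h (h4 _ hc hlt)

/-- The properties of the bounds that the greedy algorithm preserves. -/
structure GoodBounds (T : ℕ) (A B : ℕ → ℤ) : Prop where
  stepA : IsStepSeq T A
  stepB : IsStepSeq T B
  le : ∀ t, 1 ≤ t → t ≤ T → A (t - 1) ≤ B t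

namespace GoodBounds

variable {T : ℕ} {A B : ℕ → ℤ} (h : GoodBounds T A B) {t : ℕ} (h1 : 1 ≤ t) (ht : t ≤ T)
include h h1 ht

theorem A_eq_of_lt_lastA {s : ℕ} (hs : t - 1 ≤ s) (hs' : s < lastA T A t) : A s = A (t - 1) := by
  obtain ⟨_, h2, h3, _⟩ := lastA_spec (A := A) h1 (by omega : t ≤ T + 1)
  exact le_antisymm (h3 ▸ h.stepA.le_of_le (by omega) (by omega)) (h.stepA.le_of_le hs (by omega))

theorem A_lastA (hl : lastA T A t ≤ T) : A (lastA T A t) = A (lastA T A t - 1) + 1 := by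
  obtain ⟨h0, h2, h3, h4⟩ := lastA_spec (A := A) h1 (by omega : t ≤ T + 1)
  have := h4 _ le_rfl hl
  have := h.stepA.2 (lastA T A t) (Finset.mem_Icc.2 ⟨by omega, hl⟩)
  omega

theorem B_eq_of_firstB_le {s : ℕ} (hs : firstB T B t ≤ s) (hs' : s ≤ t) : B s = B t := by
  obtain ⟨_, h2, h3, _⟩ := firstB_spec (B := B) h1 ht
  exact le_antisymm (h.stepB.le_of_le hs' ht) (h3 ▸ h.stepB.le_of_le hs (by omega))

/-- Minimality of `t_B` gives the jump unless `t_B = 1`. In that case the comparison is with `B 0 =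
0`, and `B t > A (t - 1) ≥ 0` is needed. -/
theorem B_firstB (hlt : A (t - 1) < B t) : B (firstB T B t - 1) + 1 = B (firstB T B t) := by
  obtain ⟨h0, h2, h3, h4⟩ := firstB_spec (B := B) h1 ht
  have h5 := h.stepB.2 (firstB T B t) (Finset.mem_Icc.2 ⟨by omega, by omega⟩)
  have : B (firstB T B t - 1) ≠ B (firstB T B t) := by
    rcases Nat.lt_or_ge (firstB T B t) 2 with hc | hc
    · have : firstB T B t - 1 = 0 := by omega
      rw [this, h.stepB.1, h3]
      have := h.stepA.nonneg (t := t - 1) (by omega)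
      omega
    · rw [h3]; exact h4 _ (by omega) (by omega)
  omega

/-- The only danger is an index `s` with `t_B ≤ s ≤ t_A`, where `B s` falls and `A (s - 1)` does
not. There the strict inequality at `t` carries over: to the left of `t` the value of `B` is
constant and `A` is no larger, to the right `A` is constant and `B` is no smaller. -/
theorem drop (hlt : A (t - 1) < B t) :
    GoodBounds T (dropFrom (lastA T A t) A) (dropFrom (firstB T B t) B) := by
  obtain ⟨a0, a2, a3, a4⟩ := lastA_spec (A := A) h1 (by omega : t ≤ T + 1)
  obtain ⟨b0, b2, b3, b4⟩ := firstB_spec (B := B) h1 ht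
  refine ⟨h.stepA.dropFrom (by omega) fun hl => ?_, h.stepB.dropFrom b0 fun hl => ?_, fun s hs hsT => ?_⟩
  · have := h.A_lastA h1 ht hl; omega
  · have := h.B_firstB h1 ht hlt; omega
  · have := h.le s hs hsT
    unfold dropFrom
    split_ifs with c1 c2 c2 <;> try omega
    rcases le_total s t with hst | hst
    · have e1 := h.B_eq_of_firstB_le h1 ht (s := s) (by omega) hst
      have e2 := h.stepA.le_of_le (s := s - 1) (t := t - 1) (by omega) (by omega)
      omega
    · have e1 := h.A_eq_of_lt_lastA h1 ht (s := s - 1) (by omega) c1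
      have e2 := h.stepB.le_of_le hst hsT
      omega

end GoodBounds

/-! ## The exchange argument -/

/-- All partial sums of `y` are between the bounds. -/
def Between (T : ℕ) (A B : ℕ → ℤ) (y : ℕ → ℤ) : Prop :=
  ∀ t ∈ Finset.Icc 1 T, A t ≤ ∑ i ∈ Finset.Icc 1 t, y i ∧ ∑ i ∈ Finset.Icc 1 t, y i ≤ B t

theorem Between.zero {T : ℕ} {A B y : ℕ → ℤ} (h : GoodBounds T A B) (hy : Between T A B y) {s : ℕ}
    (hs : s ≤ T) : A s ≤ ∑ i ∈ Finset.Icc 1 s, y i ∧ ∑ i ∈ Finset.Icc 1 s, y i ≤ B s := by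
  rcases Nat.eq_zero_or_pos s with rfl | h0
  · simp [h.stepA.1, h.stepB.1]
  · exact hy s (Finset.mem_Icc.2 ⟨h0, hs⟩)

theorem IsSwitching.update {T : ℕ} {y : ℕ → ℤ} (hy : IsSwitching T y) (t : ℕ) {v : ℤ}
    (hv : v = 0 ∨ v = 1) : IsSwitching T (Function.update y t v) := by
  intro s hs
  rcases eq_or_ne s t with rfl | hne
  · simpa using hv
  · rw [Function.update_of_ne hne]; exact hy s hs

/-- Exchanging a switched-on interval `u` for a cheaper interval `t`. -/
theorem exchange_pair {T : ℕ} {A B : ℕ → ℤ} {P : ℕ → ℝ} {y : ℕ → ℤ} {t u : ℕ}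
    (hy : IsSwitching T y) (hb : Between T A B y)
    (h1 : 1 ≤ t) (ht : t ≤ T) (h0 : y t = 0) (hu1 : 1 ≤ u) (hu : u ≤ T) (hyu : y u = 1)
    (hP : P t ≤ P u)
    (hB : ∀ s, t ≤ s → s < u → ∑ i ∈ Finset.Icc 1 s, y i < B s)
    (hA : ∀ s, u ≤ s → s < t → A s < ∑ i ∈ Finset.Icc 1 s, y i) :
    ∃ y', IsSwitching T y' ∧ Between T A B y' ∧ y' t = 1 ∧
      (∀ s ∈ Finset.Icc 1 T, s ≠ t → y s = 0 → y' s = 0) ∧ cost T P y' ≤ cost T P y := by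
  have hne : u ≠ t := by rintro rfl; omega
  have hut : Function.update y t 1 u = 1 := by rw [Function.update_of_ne hne, hyu]
  refine ⟨Function.update (Function.update y t 1) u 0,
    (hy.update t (Or.inr rfl)).update u (Or.inl rfl), fun s hs => ?_, ?_, fun s _ hst h => ?_, ?_⟩
  · have h := hb s hs
    rw [sum_update_Icc hu1, sum_update_Icc h1, hut, h0]
    -- The partial sums change only between the two intervals: by `+1` on `[t, u)` or by `-1` on
    -- `[u, t)`.
    have h2 := hB s
    have h3 := hA s
    split_ifs <;> omega
  · rw [Function.update_of_ne hne.symm]; simp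
  · rcases eq_or_ne s u with rfl | h'
    · simp
    · rwa [Function.update_of_ne h', Function.update_of_ne hst]
  · rw [cost_update (Finset.mem_Icc.2 ⟨hu1, hu⟩), cost_update (Finset.mem_Icc.2 ⟨h1, ht⟩), hut, h0]
    push_cast
    linarith

/-- Let `S` denote partial sums of `y`. If `S t < B t` and some later interval is on, the first such
interval can be exchanged for `t`, because `S` stays constant in between while `B` does not fall. If
`A (t - 1) < S t`, the last earlier interval that is on can be exchanged, because `S` is constant
from there to `t` and `A` is no larger before. The second inequality holds if `S t = B t`, and also
if nothing later is on and `A (t - 1) < A T`, as then `S t = S T`. In the remaining case `P t < 0`,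
and `t` is simply switched on. -/
theorem exchange {T : ℕ} {A B : ℕ → ℤ} (h : GoodBounds T A B) {P : ℕ → ℝ} {y : ℕ → ℤ}
    {t : ℕ} (hy : IsSwitching T y) (hb : Between T A B y)
    (h1 : 1 ≤ t) (ht : t ≤ T) (h0 : y t = 0) (hlt : A (t - 1) < B t)
    (hor : A (t - 1) < A T ∨ P t < 0) (hP : ∀ u ∈ Finset.Icc 1 T, y u = 1 → P t ≤ P u) :
    ∃ y', IsSwitching T y' ∧ Between T A B y' ∧ y' t = 1 ∧
      (∀ s ∈ Finset.Icc 1 T, s ≠ t → y s = 0 → y' s = 0) ∧ cost T P y' ≤ cost T P y := by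
  classical
  have zero_or : ∀ i, 1 ≤ i → i ≤ T → y i ≠ 1 → y i = 0 := fun i hi hi' hne =>
    (hy i (Finset.mem_Icc.2 ⟨hi, hi'⟩)).resolve_right hne
  have hpred := sum_Icc_pred (y := y) h1
  -- exchange with an earlier interval
  have early : A (t - 1) < ∑ i ∈ Finset.Icc 1 t, y i → ∃ y', IsSwitching T y' ∧ Between T A B y' ∧
      y' t = 1 ∧ (∀ s ∈ Finset.Icc 1 T, s ≠ t → y s = 0 → y' s = 0) ∧ cost T P y' ≤ cost T P y := by
    intro hpos
    -- Otherwise the partial sum would be `0`, which is not above `A (t - 1) ≥ 0`.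
    have hex : ∃ u, 1 ≤ u ∧ u ≤ t ∧ y u = 1 := by
      by_contra hno
      push Not at hno
      have := sum_Icc_eq_of_zero (y := y) (Nat.zero_le t) fun i hi hi' =>
        zero_or i hi (by omega) (hno i hi hi')
      have := h.stepA.nonneg (t := t - 1) (by omega)
      simp_all
      omega
    obtain ⟨u0, hu0⟩ := hex
    have hsp := Nat.findGreatest_spec (P := fun u => 1 ≤ u ∧ u ≤ t ∧ y u = 1) (n := t) hu0.2.1 hu0
    set u := Nat.findGreatest (fun u => 1 ≤ u ∧ u ≤ t ∧ y u = 1) t with hudef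
    refine exchange_pair hy hb h1 ht h0 hsp.1 (by omega) hsp.2.2
      (hP u (Finset.mem_Icc.2 ⟨hsp.1, by omega⟩) hsp.2.2) (fun s hs hs' => by omega) fun s hs hs' => ?_
    have : ∑ i ∈ Finset.Icc 1 t, y i = ∑ i ∈ Finset.Icc 1 s, y i :=
      sum_Icc_eq_of_zero (by omega) fun i hi hi' => zero_or i (by omega) (by omega) fun hyi =>
        Nat.findGreatest_is_greatest (P := fun u => 1 ≤ u ∧ u ≤ t ∧ y u = 1)
          (lt_of_le_of_lt hs hi) hi' ⟨by omega, hi', hyi⟩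
    have := h.stepA.le_of_le (s := s) (t := t - 1) (by omega) (by omega)
    omega
  -- exchange with a later interval
  by_cases hex : ∃ u, t ≤ u ∧ u ≤ T ∧ y u = 1
  · have hsp := Nat.find_spec hex
    have hmin := fun i => Nat.find_min hex (m := i)
    set u := Nat.find hex
    have heq : ∀ s, t ≤ s → s < u → ∑ i ∈ Finset.Icc 1 s, y i = ∑ i ∈ Finset.Icc 1 t, y i :=
      fun s hs hs' => sum_Icc_eq_of_zero hs fun i hi hi' => zero_or i (by omega) (by omega)
        fun hyi => hmin i (by omega) ⟨by omega, by omega, hyi⟩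
    by_cases htight : ∑ i ∈ Finset.Icc 1 t, y i < B t
    · refine exchange_pair hy hb h1 ht h0 (by omega) hsp.2.1 hsp.2.2
        (hP u (Finset.mem_Icc.2 ⟨by omega, hsp.2.1⟩) hsp.2.2) (fun s hs hs' => ?_)
        fun s hs hs' => by omega
      rw [heq s hs hs']
      have := h.stepB.le_of_le hs (by omega)
      omega
    · exact early (by omega)
  · push Not at hex
    have heq : ∀ s, t ≤ s → s ≤ T → ∑ i ∈ Finset.Icc 1 s, y i = ∑ i ∈ Finset.Icc 1 t, y i :=
      fun s hs hs' => sum_Icc_eq_of_zero hs fun i hi hi' => zero_or i (by omega) (by omega)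
        (hex i (by omega) (by omega))
    by_cases htight : ∑ i ∈ Finset.Icc 1 t, y i < B t
    · rcases hor with hor | hor
      · refine early (hor.trans_le ?_)
        rw [← heq T ht le_rfl]
        exact (hb T (Finset.mem_Icc.2 ⟨by omega, le_rfl⟩)).1
      · refine ⟨Function.update y t 1, hy.update t (Or.inr rfl), fun s hs => ?_, by simp,
          fun s _ hs hs' => by rwa [Function.update_of_ne hs], ?_⟩
        · have hbs := hb s hs
          rw [sum_update_Icc h1, h0]
          split_ifs with hc
          · rw [Finset.mem_Icc] at hs
            have := heq s hc hs.2
            have := h.stepB.le_of_le hc hs.2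
            omega
          · omega
        · rw [cost_update (Finset.mem_Icc.2 ⟨h1, ht⟩), h0]
          push_cast
          linarith
    · exact early (by omega)

/-! ## Optimality of the greedy algorithm -/

/-- The invariant of the greedy algorithm after the intervals in `S` have been processed. -/
structure GreedyInv (T : ℕ) (P : ℕ → ℝ) (A B : ℕ → ℤ) (S : Set ℕ) (g : GreedyState) : Prop where
  good : GoodBounds T g.A g.B
  switching : IsSwitching T g.x
  zero : ∀ t ∉ S, g.x t = 0
  sound : ∀ y, Between T g.A g.B y → Between T A B fun t => g.x t + y t
  complete : ∀ z, BoundsFeasible T A B z → ∃ y, IsSwitching T y ∧ (∀ t ∈ S, y t = 0) ∧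
    Between T g.A g.B y ∧ cost T P g.x + cost T P y ≤ cost T P z

/-- As `t_B ≤ t ≤ t_A`, the upper bound has been lowered wherever the sum grows by one, and the
lower bound has not been lowered before `t`. This does not need `y` to be 0-1. -/
theorem between_of_drop {T : ℕ} {A B y : ℕ → ℤ} {t : ℕ} (h1 : 1 ≤ t) (ht : t ≤ T)
    (hb : Between T (dropFrom (lastA T A t) A) (dropFrom (firstB T B t) B) y) :
    Between T A B (Function.update y t (y t + 1)) := by
  obtain ⟨a0, a2, a3, a4⟩ := lastA_spec (A := A) h1 (by omega : t ≤ T + 1)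
  obtain ⟨b0, b2, b3, b4⟩ := firstB_spec (B := B) h1 ht
  intro s hs
  have := hb s hs
  rw [sum_update_Icc h1]
  unfold dropFrom at this
  split_ifs at this ⊢ <;> omega

/-- The critical indices are those from `t` on where `A` is not lowered and those before `t` where
`B` is. There `A` and `B` equal `A (t - 1)` and `B t`, and monotone partial sums together with the
unit step of `y` at `t` leave the required slack. -/
theorem drop_of_between {T : ℕ} {A B y : ℕ → ℤ} (h : GoodBounds T A B) {t : ℕ} (h1 : 1 ≤ t)
    (ht : t ≤ T) (hy : IsSwitching T y) (hb : Between T A B y) (hyt : y t = 1) :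
    Between T (dropFrom (lastA T A t) A) (dropFrom (firstB T B t) B) (Function.update y t 0) := by
  obtain ⟨a0, a2, a3, a4⟩ := lastA_spec (A := A) h1 (by omega : t ≤ T + 1)
  obtain ⟨b0, b2, b3, b4⟩ := firstB_spec (B := B) h1 ht
  intro s hs
  have hs' := Finset.mem_Icc.1 hs
  have hbs := hb s hs
  rw [sum_update_Icc h1, hyt]
  have hpred := sum_Icc_pred (y := y) h1
  unfold dropFrom
  by_cases hts : t ≤ s
  · have e1 := sum_Icc_mono hy hts hs'.2
    have e2 := Between.zero h hb (s := t - 1) (by omega)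
    have e3 : s < lastA T A t → A s = A (t - 1) := h.A_eq_of_lt_lastA h1 ht (by omega)
    split_ifs <;> omega
  · have e1 := sum_Icc_mono hy (by omega : s ≤ t - 1) (by omega)
    have e2 := Between.zero h hb ht
    have e3 : firstB T B t ≤ s → B s = B t := fun hc => h.B_eq_of_firstB_le h1 ht hc (by omega)
    split_ifs <;> omega

/-- If `t` is accepted, the residual sequence is exchanged into one that is on at `t`, and this unit
moves from `y` to `g.x`. If `t` is refused but the residual sequence is on at `t`, then `t` can be
removed from it, since no later lower bound needs it and its price is not negative. -/
theorem GreedyInv.step {T : ℕ} {P : ℕ → ℝ} {A B : ℕ → ℤ} {S : Set ℕ} {g : GreedyState}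
    (h : GreedyInv T P A B S g) {t : ℕ} (h1 : 1 ≤ t) (ht : t ≤ T) (htS : t ∉ S)
    (hP : ∀ u ∈ Finset.Icc 1 T, u ∉ S → P t ≤ P u) :
    GreedyInv T P A B (insert t S) (greedyStep T P t g) := by
  have hmem : t ∈ Finset.Icc 1 T := Finset.mem_Icc.2 ⟨h1, ht⟩
  have hxt := h.zero t htS
  unfold greedyStep
  split_ifs with hc
  · refine ⟨h.good.drop h1 ht hc.1, h.switching.update t (Or.inr rfl), fun s hs => ?_,
      fun y hy => ?_, fun z hz => ?_⟩
    · rw [Set.mem_insert_iff, not_or] at hs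
      exact (Function.update_of_ne hs.1 _ _).trans (h.zero s hs.2)
    · have := h.sound _ (between_of_drop h1 ht hy)
      convert this using 2 with s
      rcases eq_or_ne s t with rfl | hne
      · simp [hxt]; ring
      · simp [Function.update_of_ne hne]
    · obtain ⟨y, hy, hyS, hyb, hyc⟩ := h.complete z hz
      obtain ⟨y', hy', hyb', hyt', hyz', hyc'⟩ : ∃ y', IsSwitching T y' ∧ Between T g.A g.B y' ∧
          y' t = 1 ∧ (∀ s ∈ Finset.Icc 1 T, s ≠ t → y s = 0 → y' s = 0) ∧
            cost T P y' ≤ cost T P y := by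
        rcases hy t hmem with h0 | h0
        · exact exchange h.good hy hyb h1 ht h0 hc.1 hc.2 fun u hu hyu =>
            hP u hu fun huS => by rw [hyS u huS] at hyu; omega
        · exact ⟨y, hy, hyb, h0, fun _ _ _ h => h, le_rfl⟩
      have hS' : ∀ s ∈ Finset.Icc 1 T, s ∈ insert t S → Function.update y' t 0 s = 0 := by
        intro s hs hsS
        rcases eq_or_ne s t with rfl | hne
        · simp
        · rw [Function.update_of_ne hne]
          exact hyz' s hs hne (hyS s (hsS.resolve_left hne))
      have hIcc : ∀ s ∈ Finset.Icc 1 T, (if s ∈ Finset.Icc 1 T then Function.update y' t 0 s else 0)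
          = Function.update y' t 0 s := fun s hs => if_pos hs
      -- `S` may contain numbers outside `1, …, T`, on which `y'` is not controlled; the sequence is
      -- cut off there.
      refine ⟨fun s => if s ∈ Finset.Icc 1 T then Function.update y' t 0 s else 0, ?_, ?_, ?_, ?_⟩
      · intro s hs
        simp only [if_pos hs]
        exact hy'.update t (Or.inl rfl) s hs
      · intro s hs
        by_cases hsT : s ∈ Finset.Icc 1 T
        · simp only [if_pos hsT]; exact hS' s hsT hs
        · simp only [if_neg hsT]
      · have := drop_of_between h.good h1 ht hy' hyb' hyt'
        intro s hs
        rw [Finset.sum_congr rfl fun i hi => hIcc i ?_]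
        · exact this s hs
        · rw [Finset.mem_Icc] at hi hs ⊢; omega
      · have e : cost T P (fun s => if s ∈ Finset.Icc 1 T then Function.update y' t 0 s else 0) =
            cost T P (Function.update y' t 0) :=
          Finset.sum_congr rfl fun i hi => by simp only [if_pos hi]
        rw [e]
        simp only
        rw [cost_update hmem, cost_update hmem, hxt, hyt']
        push_cast
        linarith
  · refine ⟨h.good, h.switching, fun s hs => h.zero s fun h' => hs (Or.inr h'), h.sound, fun z hz => ?_⟩
    obtain ⟨y, hy, hyS, hyb, hyc⟩ := h.complete z hz
    rcases hy t hmem with h0 | h0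
    · refine ⟨y, hy, fun s hs => ?_, hyb, hyc⟩
      rcases hs with rfl | hs
      exacts [h0, hyS s hs]
    have hpred := sum_Icc_pred (y := y) h1
    have hzero := Between.zero h.good hyb (s := t - 1) (by omega)
    -- A residual sequence that is on at `t` shows that the first condition holds, so the refusal
    -- means `A T ≤ A (t - 1)` and `0 ≤ P t`.
    have hlt : g.A (t - 1) < g.B t := by have := hyb t hmem; omega
    rw [not_and_or, not_or] at hc
    have hc := hc.resolve_left (not_not_intro hlt)
    push Not at hc
    refine ⟨Function.update y t 0, hy.update t (Or.inl rfl), fun s hs => ?_, fun s hs => ?_, ?_⟩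
    · rcases eq_or_ne s t with rfl | hne
      · simp
      · rw [Function.update_of_ne hne]; exact hyS s (hs.resolve_left hne)
    · have hs' := Finset.mem_Icc.1 hs
      have := hyb s hs
      rw [sum_update_Icc h1, h0]
      split_ifs with hts
      · have e1 := h.good.stepA.le_of_le hs'.2 le_rfl
        have e2 := sum_Icc_mono hy hts hs'.2
        omega
      · omega
    · rw [cost_update hmem, h0]
      push_cast
      linarith

theorem greedyInv_greedy {T : ℕ} {P : ℕ → ℝ} {A B : ℕ → ℤ} {ord : ℕ → ℕ} (hA : IsStepSeq T A)
    (hB : IsStepSeq T B) (hAB : ∀ t ∈ Finset.Icc 1 T, A t ≤ B t) (ho : IsPriceOrder T P ord)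
    {k : ℕ} (hk : k ≤ T) :
    GreedyInv T P A B (ord '' Set.Icc 1 k) (greedy T P A B ord k) := by
  induction k with
  | zero =>
    refine ⟨⟨hA, hB, fun t h1 ht => ?_⟩, fun t _ => Or.inl rfl, fun t _ => rfl, fun y hy => ?_,
      fun z hz => ⟨z, hz.1, by simp, hz.2, by simp [greedy, cost]⟩⟩
    · exact (hA.le_of_le (Nat.sub_le t 1) ht).trans (hAB t (Finset.mem_Icc.2 ⟨h1, ht⟩))
    · simpa [greedy] using hy
  | succ k ih =>
    have hmem : ∀ i, 1 ≤ i → i ≤ T → 1 ≤ ord i ∧ ord i ≤ T := fun i h1 h2 => ho.1.mapsTo ⟨h1, h2⟩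
    have hk1 := hmem (k + 1) (by omega) hk
    have := (ih (by omega)).step hk1.1 hk1.2 ?_ ?_
    · refine (congrArg (fun S => GreedyInv T P A B S _) ?_).mp this
      symm
      ext s
      simp only [Set.mem_image, Set.mem_Icc, Set.mem_insert_iff]
      constructor
      · rintro ⟨i, hi, rfl⟩
        rcases Nat.lt_or_ge k i with h | h
        · exact Or.inl (by rw [show i = k + 1 by omega])
        · exact Or.inr ⟨i, ⟨hi.1, h⟩, rfl⟩
      · rintro (rfl | ⟨i, hi, rfl⟩)
        · exact ⟨k + 1, ⟨by omega, le_rfl⟩, rfl⟩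
        · exact ⟨i, ⟨hi.1, by omega⟩, rfl⟩
    · rintro ⟨i, hi, he⟩
      have := ho.1.injOn (Set.mem_Icc.2 ⟨hi.1, by have := hi.2; omega⟩)
        (Set.mem_Icc.2 ⟨by omega, hk⟩) he
      have := hi.2
      omega
    · intro u hu huS
      obtain ⟨i, hi, rfl⟩ := ho.1.surjOn (Finset.mem_Icc.1 hu)
      refine ho.2 _ ⟨by omega, hk⟩ i hi ?_
      by_contra hlt
      exact huS ⟨i, ⟨hi.1, by omega⟩, rfl⟩

/-- The increments of `A` are a 0-1 sequence with partial sums `A`. -/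
theorem IsStepSeq.exists_feasible {T : ℕ} {A B : ℕ → ℤ} (hA : IsStepSeq T A)
    (hAB : ∀ t ∈ Finset.Icc 1 T, A t ≤ B t) : BoundsFeasible T A B fun t => A t - A (t - 1) := by
  have hsum : ∀ t, ∑ i ∈ Finset.Icc 1 t, (A i - A (i - 1)) = A t := by
    intro t
    induction t with
    | zero => simp [hA.1]
    | succ t ih => rw [Finset.sum_Icc_succ_top (by omega), ih]; simp
  refine ⟨fun t ht => ?_, fun t ht => ?_⟩
  · have := hA.2 t ht
    beta_reduce
    omega
  · rw [hsum]; exact ⟨le_rfl, hAB t ht⟩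

/-- At the end every interval is processed, so each residual sequence vanishes. Applied to one
feasible sequence this shows that zero respects the final bounds, hence that the output is feasible;
applied to an arbitrary one it compares the costs. -/
theorem greedy_isOptimal {T : ℕ} {P : ℕ → ℝ} {A B : ℕ → ℤ} {ord : ℕ → ℕ} (hA : IsStepSeq T A)
    (hB : IsStepSeq T B) (hAB : ∀ t ∈ Finset.Icc 1 T, A t ≤ B t) (ho : IsPriceOrder T P ord) :
    IsOptimal T P (BoundsFeasible T A B) (greedy T P A B ord T).x := by
  have h := greedyInv_greedy hA hB hAB ho le_rfl
  have hz : ∀ z, BoundsFeasible T A B z → Between T A B (greedy T P A B ord T).x ∧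
      cost T P (greedy T P A B ord T).x ≤ cost T P z := by
    intro z hz
    obtain ⟨y, hy, hyS, hyb, hyc⟩ := h.complete z hz
    have hy0 : ∀ t ∈ Finset.Icc 1 T, y t = 0 := fun t ht =>
      hyS t (ho.1.image_eq.symm ▸ Finset.mem_Icc.1 ht)
    constructor
    · intro s hs
      have := h.sound y hyb s hs
      rwa [Finset.sum_congr rfl fun i hi => ?_] at this
      beta_reduce
      rw [hy0 i (Finset.mem_Icc.2 ⟨(Finset.mem_Icc.1 hi).1,
        (Finset.mem_Icc.1 hi).2.trans (Finset.mem_Icc.1 hs).2⟩), add_zero]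
    · have : cost T P y = 0 := Finset.sum_eq_zero fun i hi => by rw [hy0 i hi]; simp
      linarith
  exact ⟨⟨h.switching, (hz _ (hA.exists_feasible hAB)).1⟩, fun z hf => (hz z hf).2⟩

/-! ## The local heating problem as a problem with bounds -/

/-- As `L 1 = U 1`, the initial state is known, and the recursion gives `s (t + 1) = L 1 + H * S t -
∑ D` with `S t` the partial sum of `x`. Integrality of `S t` permits rounding, and the terms `0` and
`t` in the raw bounds cost nothing because `0 ≤ S t ≤ t`. -/
theorem heatingFeasible_iff {T : ℕ} {H : ℝ} {L U D : ℕ → ℝ} {x : ℕ → ℤ} (hH : 0 < H)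
    (hLU : L 1 = U 1) :
    HeatingFeasible T H L U D x ↔ IsSwitching T x ∧ ∀ t ≤ T,
      rawLower H L D t ≤ ∑ i ∈ Finset.Icc 1 t, x i ∧
        ∑ i ∈ Finset.Icc 1 t, x i ≤ rawUpper H L U D t := by
  refine and_congr_right fun hx => ?_
  have h0 : ∀ t ≤ T, 0 ≤ ∑ i ∈ Finset.Icc 1 t, x i ∧ ∑ i ∈ Finset.Icc 1 t, x i ≤ t := by
    intro t ht
    have hmem : ∀ i ∈ Finset.Icc 1 t, 0 ≤ x i ∧ x i ≤ 1 := by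
      intro i hi
      rw [Finset.mem_Icc] at hi
      rcases hx i (Finset.mem_Icc.2 ⟨hi.1, by omega⟩) with h | h <;> omega
    refine ⟨Finset.sum_nonneg fun i hi => (hmem i hi).1, ?_⟩
    simpa using Finset.sum_le_sum fun i hi => (hmem i hi).2
  have key : ∀ t ≤ T, (rawLower H L D t ≤ ∑ i ∈ Finset.Icc 1 t, x i ∧
        ∑ i ∈ Finset.Icc 1 t, x i ≤ rawUpper H L U D t) ↔
      L (t + 1) ≤ L 1 + H * ((∑ i ∈ Finset.Icc 1 t, x i : ℤ) : ℝ) - ∑ i ∈ Finset.Icc 1 t, D i ∧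
      L 1 + H * ((∑ i ∈ Finset.Icc 1 t, x i : ℤ) : ℝ) - ∑ i ∈ Finset.Icc 1 t, D i ≤ U (t + 1) := by
    intro t ht
    unfold rawLower rawUpper
    rw [max_le_iff, le_min_iff, Int.ceil_le, Int.le_floor, div_le_iff₀ hH, le_div_iff₀ hH]
    have := h0 t ht
    constructor
    · rintro ⟨⟨_, h1⟩, _, h2⟩; constructor <;> linarith
    · rintro ⟨h1, h2⟩; exact ⟨⟨this.1, by linarith⟩, this.2, by linarith⟩
  constructor
  · rintro ⟨s, hs, hb⟩ t ht
    have hst : ∀ t ≤ T, s (t + 1) =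
        L 1 + H * ((∑ i ∈ Finset.Icc 1 t, x i : ℤ) : ℝ) - ∑ i ∈ Finset.Icc 1 t, D i := by
      intro t
      induction t with
      | zero =>
        have := hb 1 (by simp)
        simp
        linarith
      | succ t ih =>
        intro ht
        rw [hs (t + 1) (by simp; omega), ih (by omega), Finset.sum_Icc_succ_top (by omega),
          Finset.sum_Icc_succ_top (by omega)]
        push_cast
        ring
    rw [key t ht, ← hst t ht]
    exact hb (t + 1) (by simp; omega)
  · intro h
    refine ⟨fun t => L 1 + H * ((∑ i ∈ Finset.Icc 1 (t - 1), x i : ℤ) : ℝ) -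
      ∑ i ∈ Finset.Icc 1 (t - 1), D i, fun t ht => ?_, fun t ht => ?_⟩
    · obtain ⟨t, rfl⟩ := Nat.exists_eq_add_of_le' (Finset.mem_Icc.1 ht).1
      simp only [Nat.add_sub_cancel]
      rw [Finset.sum_Icc_succ_top (by omega), Finset.sum_Icc_succ_top (by omega)]
      push_cast
      ring
    · obtain ⟨t, rfl⟩ := Nat.exists_eq_add_of_le' (Finset.mem_Icc.1 ht).1
      have ht' : t ≤ T := by have := (Finset.mem_Icc.1 ht).2; omega
      simpa only [Nat.add_sub_cancel] using (key t ht').1 (h t ht')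

theorem sum_Icc_le_add {T : ℕ} {x : ℕ → ℤ} (hx : IsSwitching T x) {s t : ℕ} (hs : s ≤ T)
    (ht : t ≤ T) :
    ∑ i ∈ Finset.Icc 1 s, x i ≤ ∑ i ∈ Finset.Icc 1 t, x i + ((s - t : ℕ) : ℤ) := by
  rcases le_total s t with hst | hst
  · rw [Nat.sub_eq_zero_of_le hst]
    simpa using sum_Icc_mono hx hst ht
  · induction s, hst using Nat.le_induction with
    | base => simp
    | succ s hst ih =>
      have := ih (by omega)
      rw [Finset.sum_Icc_succ_top (by omega)]
      rcases hx (s + 1) (Finset.mem_Icc.2 ⟨by omega, hs⟩) with h | h <;> omega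

theorem rawLower_le_heatLower {T : ℕ} {H : ℝ} {L D : ℕ → ℝ} {t : ℕ} (ht : t ≤ T) :
    rawLower H L D t ≤ heatLower T H L D t := by
  unfold heatLower
  refine le_trans ?_ (Finset.le_sup' _ (Finset.mem_range_succ_iff.2 ht))
  simp

theorem heatUpper_le_rawUpper {T : ℕ} {H : ℝ} {L U D : ℕ → ℝ} {t : ℕ} (ht : t ≤ T) :
    heatUpper T H L U D t ≤ rawUpper H L U D t := by
  unfold heatUpper
  refine le_trans (Finset.inf'_le _ (Finset.mem_range_succ_iff.2 ht)) ?_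
  simp

/-- Each term of the maximum already has steps `0` and `1`: the truncated difference `s - t` falls
by at most one when `t` grows by one. -/
theorem heatLower_succ {T : ℕ} {H : ℝ} {L D : ℕ → ℝ} (t : ℕ) :
    heatLower T H L D t ≤ heatLower T H L D (t + 1) ∧
      heatLower T H L D (t + 1) ≤ heatLower T H L D t + 1 := by
  unfold heatLower
  constructor
  · refine Finset.sup'_le _ _ fun s hs => le_trans ?_ (Finset.le_sup' _ hs)
    omega
  · refine Finset.sup'_le _ _ fun s hs => ?_
    have := Finset.le_sup' (fun s => rawLower H L D s - ((s - t : ℕ) : ℤ)) hs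
    omega

theorem heatUpper_succ {T : ℕ} {H : ℝ} {L U D : ℕ → ℝ} (t : ℕ) :
    heatUpper T H L U D t ≤ heatUpper T H L U D (t + 1) ∧
      heatUpper T H L U D (t + 1) ≤ heatUpper T H L U D t + 1 := by
  unfold heatUpper
  constructor
  · refine Finset.le_inf' _ _ fun s hs => (Finset.inf'_le _ hs).trans ?_
    omega
  · rw [← sub_le_iff_le_add]
    refine Finset.le_inf' _ _ fun s hs => ?_
    have := Finset.inf'_le (fun s => rawUpper H L U D s + ((t + 1 - s : ℕ) : ℤ)) hs
    omega

/-- The term `s = t` recovers the raw bound at `t`; the other terms follow from the raw bounds at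
`s`, as partial sums cannot grow by more than the number of steps taken. -/
theorem between_heat_iff {T : ℕ} {H : ℝ} {L U D : ℕ → ℝ} {x : ℕ → ℤ} (hH : 0 < H)
    (hLU : L 1 = U 1) :
    HeatingFeasible T H L U D x ↔ IsSwitching T x ∧ ∀ t ≤ T,
      heatLower T H L D t ≤ ∑ i ∈ Finset.Icc 1 t, x i ∧
        ∑ i ∈ Finset.Icc 1 t, x i ≤ heatUpper T H L U D t := by
  rw [heatingFeasible_iff hH hLU]
  refine and_congr_right fun hx => ⟨fun h t ht => ?_, fun h t ht =>
    ⟨(rawLower_le_heatLower ht).trans (h t ht).1, (h t ht).2.trans (heatUpper_le_rawUpper ht)⟩⟩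
  constructor
  · refine Finset.sup'_le _ _ fun s hs => ?_
    have hs := Finset.mem_range_succ_iff.1 hs
    have := sum_Icc_le_add hx hs ht
    have := (h s hs).1
    omega
  · refine Finset.le_inf' _ _ fun s hs => ?_
    have hs := Finset.mem_range_succ_iff.1 hs
    have := sum_Icc_le_add hx ht hs
    have := (h s hs).2
    omega

/-- A feasible solution is needed because its partial sums separate the two bounds. At index `0` its
empty sum gives `A 0 ≤ 0 ≤ B 0`, and the raw bounds give the reverse inequalities. -/
theorem heat_bounds {T : ℕ} {H : ℝ} {L U D : ℕ → ℝ} (hH : 0 < H) (hLU : L 1 = U 1)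
    (hx : ∃ x, HeatingFeasible T H L U D x) :
    IsStepSeq T (heatLower T H L D) ∧ IsStepSeq T (heatUpper T H L U D) ∧
      (∀ t ∈ Finset.Icc 1 T, heatLower T H L D t ≤ heatUpper T H L U D t) ∧
      ∀ x, HeatingFeasible T H L U D x ↔
        BoundsFeasible T (heatLower T H L D) (heatUpper T H L U D) x := by
  obtain ⟨x, hx⟩ := hx
  have hb := ((between_heat_iff hH hLU).1 hx).2
  have hl0 : heatLower T H L D 0 = 0 := by
    have h1 := (hb 0 (Nat.zero_le T)).1
    have h2 := rawLower_le_heatLower (H := H) (L := L) (D := D) (Nat.zero_le T)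
    simp [rawLower] at h1 h2
    omega
  have hu0 : heatUpper T H L U D 0 = 0 := by
    have h1 := (hb 0 (Nat.zero_le T)).2
    have h2 := heatUpper_le_rawUpper (H := H) (L := L) (U := U) (D := D) (Nat.zero_le T)
    simp [rawUpper, hLU] at h1 h2
    omega
  refine ⟨⟨hl0, fun t ht => ?_⟩, ⟨hu0, fun t ht => ?_⟩, fun t ht => ?_, fun y => ?_⟩
  · obtain ⟨t, rfl⟩ := Nat.exists_eq_add_of_le' (Finset.mem_Icc.1 ht).1
    exact heatLower_succ t
  · obtain ⟨t, rfl⟩ := Nat.exists_eq_add_of_le' (Finset.mem_Icc.1 ht).1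
    exact heatUpper_succ t
  · have := hb t (Finset.mem_Icc.1 ht).2
    omega
  · rw [between_heat_iff hH hLU]
    refine and_congr_right fun _ => ⟨fun h t ht => h t (Finset.mem_Icc.1 ht).2, fun h t ht => ?_⟩
    rcases Nat.eq_zero_or_pos t with rfl | h0
    · simp [hl0, hu0]
    · exact h t (Finset.mem_Icc.2 ⟨h0, ht⟩)

/-! ## A variant of the Ackermann function -/

/-- `fastGrow 0 j = j + 1`, and `fastGrow (k + 1)` iterates `fastGrow k`. -/
def fastGrow : ℕ → ℕ → ℕ
  | 0, j => j + 1
  | k + 1, j => (fastGrow k)^[j + 1] j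

theorem lt_fastGrow (k j : ℕ) : j < fastGrow k j := by
  induction k generalizing j with
  | zero => exact Nat.lt_succ_self j
  | succ k ih =>
    have : ∀ i, j + i ≤ (fastGrow k)^[i] j := by
      intro i
      induction i with
      | zero => simp
      | succ i ihi =>
        rw [Function.iterate_succ_apply']
        have := ih ((fastGrow k)^[i] j)
        omega
    have := this (j + 1)
    simp only [fastGrow]
    omega

theorem fastGrow_strictMono (k : ℕ) : StrictMono (fastGrow k) := by
  induction k with
  | zero => exact fun a b h => Nat.succ_lt_succ h
  | succ k ih =>
    refine strictMono_nat_of_lt_succ fun j => ?_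
    simp only [fastGrow]
    rw [Function.iterate_succ_apply' (fastGrow k) (j + 1)]
    exact ((ih.iterate (j + 1)) (Nat.lt_succ_self j)).trans (lt_fastGrow k _)

theorem ack_succ_eq_iterate (k j : ℕ) : ack (k + 1) j = (ack k)^[j + 1] 1 := by
  induction j with
  | zero => simp
  | succ j ih => rw [ack_succ_succ, ih, ← Function.iterate_succ_apply' (ack k)]

/-- Both functions at `k + 1` iterate their predecessors `j + 1` times, but `ack` starts at `1` and
`fastGrow` at `j`. -/
theorem ack_le_fastGrow (k : ℕ) {j : ℕ} (hj : 1 ≤ j) : ack k j ≤ fastGrow k j := by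
  induction k generalizing j with
  | zero => simp [fastGrow]
  | succ k ih =>
    rw [ack_succ_eq_iterate]
    simp only [fastGrow]
    have : ∀ i, 1 ≤ (fastGrow k)^[i] j ∧ (ack k)^[i] 1 ≤ (fastGrow k)^[i] j := by
      intro i
      induction i with
      | zero => simpa using hj
      | succ i ihi =>
        rw [Function.iterate_succ_apply', Function.iterate_succ_apply']
        exact ⟨ihi.1.trans (lt_fastGrow k _).le, (ack_mono_right k ihi.2).trans (ih ihi.1)⟩
    exact (this _).2

theorem add_two_le_fastGrow_one (k : ℕ) : k + 2 ≤ fastGrow k 1 := by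
  induction k with
  | zero => simp [fastGrow]
  | succ k ih =>
    have : fastGrow (k + 1) 1 = fastGrow k (fastGrow k 1) := rfl
    have := lt_fastGrow k (fastGrow k 1)
    omega

/-- By definition `fastGrow (k + 1) 1` is `fastGrow k` applied twice to `1`, and the inner
application already exceeds `k`. -/
theorem ack_lt_fastGrow_one (k : ℕ) : ack k k < fastGrow (k + 1) 1 :=
  calc ack k k < ack k (k + 2) := ack_strictMono_right k (by omega)
    _ ≤ fastGrow k (k + 2) := ack_le_fastGrow k (by omega)
    _ ≤ fastGrow k (fastGrow k 1) := (fastGrow_strictMono k).monotone (add_two_le_fastGrow_one k)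

theorem le_ack_invAck (n : ℕ) : n ≤ ack (invAck n) (invAck n) :=
  Nat.sInf_mem (s := {k | n ≤ ack k k}) ⟨n, (lt_ack_right n n).le⟩

/-- This justifies the choice `κ = invAck T + 1` in the analysis. -/
theorem lt_fastGrow_invAck (n : ℕ) : n < fastGrow (invAck n + 1) 1 :=
  (le_ack_invAck n).trans_lt (ack_lt_fastGrow_one _)

theorem one_le_invAck {n : ℕ} (hn : 2 ≤ n) : 1 ≤ invAck n := by
  by_contra h
  have := le_ack_invAck n
  rw [show invAck n = 0 by omega, ack_zero] at this
  omega

/-! ## The potential of an element of a disjoint-set structure -/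

/-- The level of a nonroot of rank `a` whose parent has rank `b`. -/
def level (κ a b : ℕ) : ℕ := Nat.findGreatest (fun k => fastGrow k a ≤ b) κ

/-- The iteration count of a nonroot of rank `a` whose parent has rank `b`. -/
def iter (κ a b : ℕ) : ℕ := Nat.findGreatest (fun i => (fastGrow (level κ a b))^[i] a ≤ b) a

/-- The potential of a nonroot of rank `a` whose parent has rank `b`. -/
def childPot (κ a b : ℕ) : ℕ := (κ - level κ a b) * a - iter κ a b

section

variable {κ a b : ℕ}

/-- Since `fastGrow 0 a = a + 1`, level `0` is always admissible for `a < b`, so `findGreatest`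
returns an actual witness. -/
theorem fastGrow_level (hab : a < b) : fastGrow (level κ a b) a ≤ b :=
  Nat.findGreatest_spec (P := fun k => fastGrow k a ≤ b) (Nat.zero_le κ) hab

theorem level_mono {b' : ℕ} (h : b ≤ b') : level κ a b ≤ level κ a b' :=
  Nat.findGreatest_mono_left (fun _ h' => h'.trans h) κ

/-- Level `κ` would force `fastGrow κ 1 ≤ fastGrow κ a ≤ b`. So only `κ` levels occur at elements of
positive rank. -/
theorem level_lt (hab : a < b) (ha : 1 ≤ a) (hκ : b < fastGrow κ 1) : level κ a b < κ := by
  refine lt_of_le_of_ne (Nat.findGreatest_le κ) fun h => ?_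
  have h1 := fastGrow_level (κ := κ) hab
  rw [h] at h1
  have := (fastGrow_strictMono κ).monotone ha
  omega

theorem lt_of_level_lt {k : ℕ} (hk : level κ a b < k) (hkκ : k ≤ κ) : b < fastGrow k a :=
  not_le.1 (Nat.findGreatest_is_greatest (P := fun k => fastGrow k a ≤ b) hk hkκ)

theorem iterate_iter (hab : a < b) : (fastGrow (level κ a b))^[iter κ a b] a ≤ b :=
  Nat.findGreatest_spec (P := fun i => (fastGrow (level κ a b))^[i] a ≤ b) (Nat.zero_le a) hab.le

theorem iter_le : iter κ a b ≤ a := Nat.findGreatest_le a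

theorem one_le_iter (hab : a < b) (ha : 1 ≤ a) : 1 ≤ iter κ a b :=
  Nat.le_findGreatest (P := fun i => (fastGrow (level κ a b))^[i] a ≤ b) ha (fastGrow_level hab)

theorem childPot_le : childPot κ a b ≤ κ * a :=
  (Nat.sub_le _ _).trans (Nat.mul_le_mul_right a (Nat.sub_le κ _))

/-- The truncated subtraction in the potential loses nothing: the level is below `κ` and the
iteration count is at most `a`. Later comparisons use this additive form. -/
theorem childPot_add_iter (hab : a < b) (ha : 1 ≤ a) (hκ : b < fastGrow κ 1) :
    childPot κ a b + iter κ a b = (κ - level κ a b) * a := by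
  have h1 := level_lt hab ha hκ
  have h2 : 1 * a ≤ (κ - level κ a b) * a := Nat.mul_le_mul_right a (by omega)
  have := iter_le (κ := κ) (a := a) (b := b)
  unfold childPot
  omega

/-- If the level of the element increases, then its potential decreases. -/
theorem childPot_lt_of_level_lt {b' : ℕ} (ha : 1 ≤ a) (hab : a < b) (hb' : b ≤ b')
    (hκ : b' < fastGrow κ 1) (hl : level κ a b < level κ a b') :
    childPot κ a b' < childPot κ a b := by
  have h1 := childPot_add_iter hab ha (hb'.trans_lt hκ)
  have h2 := childPot_add_iter (hab.trans_le hb') ha hκ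
  have h3 := level_lt (hab.trans_le hb') ha hκ
  -- A higher level lowers the product by at least `a`, while the iteration count, which lies
  -- between `1` and `a`, can fall by at most `a - 1`.
  have h4 : (κ - level κ a b' + 1) * a ≤ (κ - level κ a b) * a := Nat.mul_le_mul_right a (by omega)
  rw [Nat.succ_mul] at h4
  have := one_le_iter (κ := κ) (hab.trans_le hb') ha
  have := iter_le (κ := κ) (a := a) (b := b)
  omega

/-- For `a = 0` the potential is `0`. Otherwise either the level rises, or it stays and the
iteration count can only grow. -/
theorem childPot_anti {b' : ℕ} (hab : a < b) (hb' : b ≤ b') (hκ : b' < fastGrow κ 1) :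
    childPot κ a b' ≤ childPot κ a b := by
  rcases Nat.eq_zero_or_pos a with rfl | ha
  · simp [childPot]
  rcases (level_mono (κ := κ) (a := a) hb').lt_or_eq with h | h
  · exact (childPot_lt_of_level_lt ha hab hb' hκ h).le
  · have h1 := childPot_add_iter hab ha (hb'.trans_lt hκ)
    have h2 := childPot_add_iter (hab.trans_le hb') ha hκ
    have h3 : iter κ a b ≤ iter κ a b' := by
      refine Nat.le_findGreatest iter_le ?_
      rw [← h]
      exact (iterate_iter hab).trans hb'
    rw [h] at h1
    omega

/-- If an element is linked past another element of the same level, then its potential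
decreases. -/
theorem childPot_lt {c d r : ℕ} (ha : 1 ≤ a) (hab : a < b) (hbc : b ≤ c) (hcd : c < d) (hdr : d ≤ r)
    (hκ : r < fastGrow κ 1) (hl : level κ a b = level κ c d) :
    childPot κ a r < childPot κ a b := by
  rcases (level_mono (κ := κ) (a := a) (b := b) (b' := r) (by omega)).lt_or_eq with h | h
  · exact childPot_lt_of_level_lt ha hab (by omega) hκ h
  have h1 := childPot_add_iter (κ := κ) hab ha (by omega)
  have h2 := childPot_add_iter (by omega : a < r) ha hκ
  -- The second element, of rank `c ≥ b`, contributes one more application of the function belonging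
  -- to the common level.
  have hit : (fastGrow (level κ a b))^[iter κ a b + 1] a ≤ r := by
    rw [Function.iterate_succ_apply']
    calc fastGrow (level κ a b) ((fastGrow (level κ a b))^[iter κ a b] a)
        ≤ fastGrow (level κ a b) c :=
          (fastGrow_strictMono _).monotone ((iterate_iter hab).trans hbc)
      _ ≤ d := by rw [hl]; exact fastGrow_level hcd
      _ ≤ r := hdr
  -- Otherwise `a + 1` iterations stay below `r`, which means `fastGrow (level + 1) a ≤ r` and so a
  -- higher level.
  have hlt : iter κ a b < a := by
    refine lt_of_le_of_ne iter_le fun he => ?_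
    rw [he] at hit
    have h3 := level_lt (by omega : a < r) ha hκ
    have : r < fastGrow (level κ a b + 1) a := lt_of_level_lt (κ := κ) (by omega) (by omega)
    simp only [fastGrow] at this
    omega
  have h3 : iter κ a b + 1 ≤ iter κ a r := by
    refine Nat.le_findGreatest hlt ?_
    rw [← h]
    exact hit
  rw [h] at h1
  omega

end

/-! ## Disjoint-set forests whose sets are intervals -/

/-- A disjoint-set forest on `1, …, n` with union by rank. Every set is an interval, whose ends are
stored at its root, and `ρ` maps every element to the root of its set. -/
structure Forest (n : ℤ) (par rank lo hi ρ : ℤ → ℤ) : Prop where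
  root_mem : ∀ x, 1 ≤ x → x ≤ n → 1 ≤ ρ x ∧ ρ x ≤ n
  par_mem : ∀ x, 1 ≤ x → x ≤ n → 1 ≤ par x ∧ par x ≤ n
  rank_nonneg : ∀ x, 1 ≤ x → x ≤ n → 0 ≤ rank x
  rank_lt : ∀ x, 1 ≤ x → x ≤ n → par x ≠ x → rank x < rank (par x)
  rank_le_root : ∀ x, 1 ≤ x → x ≤ n → rank x ≤ rank (ρ x)
  root_par : ∀ x, 1 ≤ x → x ≤ n → ρ (par x) = ρ x
  root_of_fixed : ∀ x, 1 ≤ x → x ≤ n → par x = x → ρ x = x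
  par_root : ∀ x, 1 ≤ x → x ≤ n → par (ρ x) = ρ x
  rank_root_le : ∀ x, 1 ≤ x → x ≤ n → rank (ρ x) ≤ hi (ρ x) - lo (ρ x)
  interval : ∀ x, 1 ≤ x → x ≤ n → ∀ y, 1 ≤ y → y ≤ n → (ρ y = ρ x ↔ lo (ρ x) ≤ y ∧ y ≤ hi (ρ x))
  ends_mem : ∀ x, 1 ≤ x → x ≤ n → 1 ≤ lo (ρ x) ∧ hi (ρ x) ≤ n

/-- The number of edges on the way from an element to its root. -/
inductive PathLen (par : ℤ → ℤ) : ℤ → ℕ → Prop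
  | root {x : ℤ} : par x = x → PathLen par x 0
  | step {x : ℤ} {k : ℕ} : par x ≠ x → PathLen par (par x) k → PathLen par x (k + 1)

/-- The potential of an element. -/
def nodePot (κ : ℕ) (par rank : ℤ → ℤ) (x : ℤ) : ℕ :=
  if par x = x then κ * (rank x).toNat else childPot κ (rank x).toNat (rank (par x)).toNat

/-- The potential of a disjoint-set forest. -/
noncomputable def forestPot (κ : ℕ) (n : ℤ) (par rank : ℤ → ℤ) : ℕ :=
  ∑ x ∈ Finset.Icc 1 n, nodePot κ par rank x

namespace Forest

variable {n : ℤ} {par rank lo hi ρ : ℤ → ℤ} (h : Forest n par rank lo hi ρ)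
include h

theorem root_root {x : ℤ} (h1 : 1 ≤ x) (hn : x ≤ n) : ρ (ρ x) = ρ x :=
  h.root_of_fixed _ (h.root_mem x h1 hn).1 (h.root_mem x h1 hn).2 (h.par_root x h1 hn)

theorem par_eq_iff {x : ℤ} (h1 : 1 ≤ x) (hn : x ≤ n) : par x = x ↔ ρ x = x :=
  ⟨h.root_of_fixed x h1 hn, fun he => by have := h.par_root x h1 hn; rwa [he] at this⟩

theorem mem_interval {x : ℤ} (h1 : 1 ≤ x) (hn : x ≤ n) : lo (ρ x) ≤ x ∧ x ≤ hi (ρ x) :=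
  (h.interval x h1 hn x h1 hn).1 rfl

/-- A crude bound on ranks suffices here: the rank of a root is less than the number of elements of
its set. -/
theorem rank_lt_size {x : ℤ} (h1 : 1 ≤ x) (hn : x ≤ n) : rank x < n := by
  have := h.rank_le_root x h1 hn
  have := h.rank_root_le x h1 hn
  have := h.ends_mem x h1 hn
  omega

theorem rank_lt_root {x : ℤ} (h1 : 1 ≤ x) (hn : x ≤ n) (hx : par x ≠ x) : rank x < rank (ρ x) := by
  have hp := h.par_mem x h1 hn
  rw [← h.root_par x h1 hn]
  exact (h.rank_lt x h1 hn hx).trans_le (h.rank_le_root _ hp.1 hp.2)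

/-- Ranks increase strictly along parent pointers and stay below `n`. -/
theorem exists_pathLen {x : ℤ} (h1 : 1 ≤ x) (hn : x ≤ n) : ∃ k, PathLen par x k := by
  induction hk : (n - rank x).toNat using Nat.strong_induction_on generalizing x with
  | _ k ih =>
    by_cases hx : par x = x
    · exact ⟨0, .root hx⟩
    · have hp := h.par_mem x h1 hn
      have := h.rank_lt x h1 hn hx
      have := h.rank_lt_size hp.1 hp.2
      obtain ⟨j, hj⟩ := ih _ (by omega) hp.1 hp.2 rfl
      exact ⟨j + 1, .step hx hj⟩

theorem iterate_mem {x : ℤ} (h1 : 1 ≤ x) (hn : x ≤ n) (j : ℕ) :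
    1 ≤ par^[j] x ∧ par^[j] x ≤ n ∧ ρ (par^[j] x) = ρ x := by
  induction j with
  | zero => exact ⟨h1, hn, rfl⟩
  | succ j ih =>
    rw [Function.iterate_succ_apply']
    have := h.par_mem _ ih.1 ih.2.1
    exact ⟨this.1, this.2, (h.root_par _ ih.1 ih.2.1).trans ih.2.2⟩

theorem exists_iterate_eq {x : ℤ} (h1 : 1 ≤ x) (hn : x ≤ n) : ∃ j : ℕ, par^[j] x = ρ x := by
  obtain ⟨k, hk⟩ := h.exists_pathLen h1 hn
  induction hk with
  | root hx => exact ⟨0, (h.root_of_fixed _ h1 hn hx).symm⟩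
  | step hx _ ih =>
    have hp := h.par_mem _ h1 hn
    obtain ⟨j, hj⟩ := ih hp.1 hp.2
    exact ⟨j + 1, by rw [Function.iterate_succ_apply, hj, h.root_par _ h1 hn]⟩

/-- Linking an element directly to its root. -/
theorem compress {x : ℤ} (h1 : 1 ≤ x) (hn : x ≤ n) (hx : par x ≠ x) :
    Forest n (Function.update par x (ρ x)) rank lo hi ρ := by
  have hr := h.root_mem x h1 hn
  refine { h with par_mem := ?_, rank_lt := ?_, root_par := ?_, root_of_fixed := ?_, par_root := ?_ }
  all_goals intro y hy1 hyn
  · rcases eq_or_ne y x with rfl | hne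
    · simpa using hr
    · simpa [hne] using h.par_mem y hy1 hyn
  · rcases eq_or_ne y x with rfl | hne
    · simpa using fun _ => h.rank_lt_root h1 hn hx
    · simpa [hne] using h.rank_lt y hy1 hyn
  · rcases eq_or_ne y x with rfl | hne
    · simpa using h.root_root h1 hn
    · simpa [hne] using h.root_par y hy1 hyn
  · rcases eq_or_ne y x with rfl | hne
    · simp
    · simpa [hne] using h.root_of_fixed y hy1 hyn
  · have hne : ρ y ≠ x := fun he => hx (he ▸ h.par_root y hy1 hyn)
    simpa [hne] using h.par_root y hy1 hyn

omit h in
-- The path from `y` only visits ranks at least that of `y`, so it never meets `x`.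
theorem _root_.PathLen.update_of_rank_lt (h : Forest n par rank lo hi ρ) {x y r : ℤ} {k : ℕ}
    (hy1 : 1 ≤ y) (hyn : y ≤ n) (hlt : rank x < rank y) (hk : PathLen par y k) :
    PathLen (Function.update par x r) y k := by
  induction hk with
  | @root y hy =>
    have hne : y ≠ x := by rintro rfl; omega
    exact .root (by simpa [hne] using hy)
  | @step y k hy _ ih =>
    have hne : y ≠ x := by rintro rfl; omega
    have hp := h.par_mem _ hy1 hyn
    refine .step (by simpa [hne] using hy) ?_
    rw [Function.update_of_ne hne]
    exact ih hp.1 hp.2 (hlt.trans (h.rank_lt y hy1 hyn hy))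

omit h in
-- The potential of an element depends on its own parent pointer and on ranks only, so all summands
-- but that of `x` stay the same. The equation avoids subtraction of natural numbers.
theorem _root_.forestPot_update {κ : ℕ} {x r : ℤ} (h1 : 1 ≤ x) (hn : x ≤ n) :
    forestPot κ n (Function.update par x r) rank + nodePot κ par rank x =
      forestPot κ n par rank + nodePot κ (Function.update par x r) rank x := by
  have hx : x ∈ Finset.Icc 1 n := Finset.mem_Icc.2 ⟨h1, hn⟩
  unfold forestPot
  rw [← Finset.add_sum_erase _ _ hx, ← Finset.add_sum_erase _ (nodePot κ par rank) hx,
    Finset.sum_congr rfl (g := nodePot κ par rank)]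
  · ring
  · intro y hy
    simp [nodePot, Finset.ne_of_mem_erase hy]

/-- The potential of an element which is linked directly to its root. -/
theorem compress_nodePot {κ : ℕ} (hκ : n ≤ fastGrow κ 1) {x : ℤ} (h1 : 1 ≤ x) (hn : x ≤ n)
    (hx : par x ≠ x) :
    nodePot κ (Function.update par x (ρ x)) rank x =
      childPot κ (rank x).toNat (rank (ρ x)).toNat ∧
    nodePot κ par rank x = childPot κ (rank x).toNat (rank (par x)).toNat ∧
    (rank x).toNat < (rank (par x)).toNat ∧ (rank (par x)).toNat ≤ (rank (ρ x)).toNat ∧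
    (rank (ρ x)).toNat < fastGrow κ 1 := by
  have hr := h.root_mem x h1 hn
  have hp := h.par_mem x h1 hn
  have hne : ρ x ≠ x := fun he => hx ((h.par_eq_iff h1 hn).2 he)
  have e1 := h.rank_lt x h1 hn hx
  have e2 := h.rank_le_root _ hp.1 hp.2
  rw [h.root_par x h1 hn] at e2
  have e3 := h.rank_lt_size hr.1 hr.2
  have e4 := h.rank_nonneg x h1 hn
  refine ⟨by simp [nodePot, hne], by simp [nodePot, hx], by omega, by omega, by omega⟩

variable {x : ℤ} (h1 : 1 ≤ x) (hn : x + 1 ≤ n) (hne : ρ x ≠ ρ (x + 1))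
include h1 hn hne

/-- The set of `x` is an interval that does not contain `x + 1`, so `x` is its last element. -/
theorem hi_root_eq : hi (ρ x) = x := by
  have e1 := h.mem_interval h1 (by omega)
  have e2 := h.interval x h1 (by omega) (x + 1) (by omega) hn
  have := mt e2.2 hne.symm
  omega

theorem lo_root_eq : lo (ρ (x + 1)) = x + 1 := by
  have e1 := h.mem_interval (x := x + 1) (by omega) hn
  have e2 := h.interval (x + 1) (by omega) hn x h1 (by omega)
  have := mt e2.2 hne
  omega

omit h h1 hn hne

/-- The root of `y` after the sets with the roots `r₁` and `r₂` have been united to a set with the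
root `c`. -/
def _root_.mergeRoot (ρ : ℤ → ℤ) (r₁ r₂ c y : ℤ) : ℤ := if ρ y = r₁ ∨ ρ y = r₂ then c else ρ y

include h h1 hn hne

/-- Linking the root `o` to the root `c`. -/
theorem link {c o v : ℤ} (hco : c = ρ x ∧ o = ρ (x + 1) ∨ c = ρ (x + 1) ∧ o = ρ x)
    (hvc : rank c ≤ v) (hvo : rank o < v) (hvn : v ≤ hi (ρ (x + 1)) - lo (ρ x)) :
    Forest n (Function.update par o c) (Function.update rank c v)
      (Function.update lo c (lo (ρ x))) (Function.update hi c (hi (ρ (x + 1))))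
      (mergeRoot ρ (ρ x) (ρ (x + 1)) c) := by
  have hx1 := h.root_mem x h1 (by omega)
  have hx2 := h.root_mem (x + 1) (by omega) hn
  have hc : 1 ≤ c ∧ c ≤ n := by rcases hco with ⟨rfl, _⟩ | ⟨rfl, _⟩ <;> assumption
  have ho : 1 ≤ o ∧ o ≤ n := by rcases hco with ⟨_, rfl⟩ | ⟨_, rfl⟩ <;> assumption
  have hoc : o ≠ c := by
    rcases hco with ⟨rfl, rfl⟩ | ⟨rfl, rfl⟩
    exacts [hne.symm, hne]
  have hρc : ρ c = c := by
    rcases hco with ⟨rfl, _⟩ | ⟨rfl, _⟩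
    exacts [h.root_root h1 (by omega), h.root_root (by omega) hn]
  have hρo : ρ o = o := by
    rcases hco with ⟨_, rfl⟩ | ⟨_, rfl⟩
    exacts [h.root_root (by omega) hn, h.root_root h1 (by omega)]
  have hpc : par c = c := (h.par_eq_iff hc.1 hc.2).2 hρc
  -- Either root may survive the link; from here on the argument is symmetric in the two cases,
  -- except for the ends of the new interval.
  have hmem : ∀ y, (ρ y = ρ x ∨ ρ y = ρ (x + 1)) ↔ (ρ y = c ∨ ρ y = o) := by
    intro y
    rcases hco with ⟨rfl, rfl⟩ | ⟨rfl, rfl⟩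
    exacts [Iff.rfl, or_comm]
  have hM : ∀ y, mergeRoot ρ (ρ x) (ρ (x + 1)) c y = if ρ y = c ∨ ρ y = o then c else ρ y := by
    intro y
    unfold mergeRoot
    simp only [hmem]
  have hM1 : ∀ y, (ρ y = c ∨ ρ y = o) → mergeRoot ρ (ρ x) (ρ (x + 1)) c y = c := fun y hy => by
    rw [hM, if_pos hy]
  have hM2 : ∀ y, ¬ (ρ y = c ∨ ρ y = o) → mergeRoot ρ (ρ x) (ρ (x + 1)) c y = ρ y := fun y hy => by
    rw [hM, if_neg hy]
  have hhi := h.hi_root_eq h1 hn hne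
  have hlo := h.lo_root_eq h1 hn hne
  have hm1 := h.mem_interval h1 (by omega)
  have hm2 := h.mem_interval (x := x + 1) (by omega) hn
  have hrank : ∀ y, rank y ≤ Function.update rank c v y := by
    intro y
    rcases eq_or_ne y c with rfl | hyc
    · simpa using hvc
    · simp [hyc]
  refine ⟨?_, ?_, ?_, ?_, ?_, ?_, ?_, ?_, ?_, ?_, ?_⟩
  all_goals intro y hy1 hyn
  · by_cases hy : ρ y = c ∨ ρ y = o
    · rwa [hM1 y hy]
    · rw [hM2 y hy]; exact h.root_mem y hy1 hyn
  · rcases eq_or_ne y o with rfl | hyo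
    · simpa using hc
    · simpa [hyo] using h.par_mem y hy1 hyn
  · exact (h.rank_nonneg y hy1 hyn).trans (hrank y)
  · intro hp
    rcases eq_or_ne y o with rfl | hyo
    · simpa [hoc] using hvo
    · have hyc : y ≠ c := by rintro rfl; simp [hyo, hpc] at hp
      rw [Function.update_of_ne hyo] at hp ⊢
      rw [Function.update_of_ne hyc]
      exact (h.rank_lt y hy1 hyn hp).trans_le (hrank _)
  · by_cases hy : ρ y = c ∨ ρ y = o
    · rw [hM1 y hy, Function.update_self]
      have := h.rank_le_root y hy1 hyn
      rcases eq_or_ne y c with rfl | hyc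
      · simp
      · rw [Function.update_of_ne hyc]
        rcases hy with hy | hy <;> rw [hy] at this <;> omega
    · rw [hM2 y hy]
      have hyc : y ≠ c := by rintro rfl; exact hy (Or.inl hρc)
      rw [Function.update_of_ne hyc]
      exact (h.rank_le_root y hy1 hyn).trans (hrank _)
  · rcases eq_or_ne y o with rfl | hyo
    · rw [Function.update_self, hM1 c (Or.inl hρc), hM1 y (Or.inr hρo)]
    · rw [Function.update_of_ne hyo]
      simp only [hM, h.root_par y hy1 hyn]
  · intro hp
    rcases eq_or_ne y o with rfl | hyo
    · simp [hoc.symm] at hp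
    · rw [Function.update_of_ne hyo] at hp
      have := h.root_of_fixed y hy1 hyn hp
      rw [hM, this]
      split_ifs with hy
      · rcases hy with hy | hy
        exacts [hy.symm, absurd hy hyo]
      · rfl
  · by_cases hy : ρ y = c ∨ ρ y = o
    · rw [hM1 y hy, Function.update_of_ne hoc.symm, hpc]
    · rw [hM2 y hy, Function.update_of_ne (fun he => hy (Or.inr he)), h.par_root y hy1 hyn]
  · by_cases hy : ρ y = c ∨ ρ y = o
    · rw [hM1 y hy]; simpa using hvn
    · rw [hM2 y hy]
      have hyc : ρ y ≠ c := fun he => hy (Or.inl he)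
      simpa [hyc] using h.rank_root_le y hy1 hyn
  · intro z hz1 hzn
    have i1 := h.interval x h1 (by omega) z hz1 hzn
    have i2 := h.interval (x + 1) (by omega) hn z hz1 hzn
    by_cases hy : ρ y = c ∨ ρ y = o
    · rw [hM1 y hy, Function.update_self, Function.update_self]
      by_cases hz : ρ z = c ∨ ρ z = o
      · rw [hM1 z hz]
        rw [← hmem] at hz
        simp only [true_iff]
        rcases hz with hz | hz
        · have := i1.1 hz; omega
        · have := i2.1 hz; omega
      · rw [hM2 z hz]
        have hzc : ρ z ≠ c := fun he => hz (Or.inl he)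
        simp only [hzc, false_iff]
        rw [← hmem, not_or] at hz
        have := mt i1.2 hz.1
        have := mt i2.2 hz.2
        omega
    · rw [hM2 y hy]
      have hyc : ρ y ≠ c := fun he => hy (Or.inl he)
      rw [Function.update_of_ne hyc, Function.update_of_ne hyc, ← h.interval y hy1 hyn z hz1 hzn]
      by_cases hz : ρ z = c ∨ ρ z = o
      · rw [hM1 z hz]
        constructor
        · exact fun he => absurd he.symm hyc
        · exact fun he => absurd (he ▸ hz) hy
      · rw [hM2 z hz]
  · by_cases hy : ρ y = c ∨ ρ y = o
    · rw [hM1 y hy]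
      simpa using ⟨(h.ends_mem x h1 (by omega)).1, (h.ends_mem (x + 1) (by omega) hn).2⟩
    · rw [hM2 y hy]
      have hyc : ρ y ≠ c := fun he => hy (Or.inl he)
      simpa [hyc] using h.ends_mem y hy1 hyn

/-- The two united sets are neighbouring intervals, so exactly the border between `x` and `x + 1`
disappears. -/
theorem mergeRoot_succ_eq_iff {c : ℤ} (hc : c = ρ x ∨ c = ρ (x + 1)) {i : ℤ} (hi1 : 1 ≤ i)
    (hin : i + 1 ≤ n) : mergeRoot ρ (ρ x) (ρ (x + 1)) c i = mergeRoot ρ (ρ x) (ρ (x + 1)) c (i + 1) ↔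
      ρ i = ρ (i + 1) ∨ i = x := by
  have hhi := h.hi_root_eq h1 hn hne
  have hlo := h.lo_root_eq h1 hn hne
  have i1 := h.interval x h1 (by omega) i hi1 (by omega)
  have i2 := h.interval (x + 1) (by omega) hn i hi1 (by omega)
  have i3 := h.interval x h1 (by omega) (i + 1) (by omega) hin
  have i4 := h.interval (x + 1) (by omega) hn (i + 1) (by omega) hin
  unfold mergeRoot
  constructor
  · intro he
    by_cases hI : ρ i = ρ x ∨ ρ i = ρ (x + 1) <;> by_cases hJ : ρ (i + 1) = ρ x ∨ ρ (i + 1) = ρ (x + 1)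
    · rcases hI with hI | hI <;> rcases hJ with hJ | hJ
      · exact Or.inl (hI.trans hJ.symm)
      · have := i1.1 hI
        have := i4.1 hJ
        omega
      · have := i2.1 hI
        have := i3.1 hJ
        omega
      · exact Or.inl (hI.trans hJ.symm)
    · rw [if_pos hI, if_neg hJ] at he
      exact absurd (he ▸ hc) hJ
    · rw [if_neg hI, if_pos hJ] at he
      exact absurd (he ▸ hc) hI
    · rw [if_neg hI, if_neg hJ] at he
      exact Or.inl he
  · rintro (he | rfl)
    · rw [he]
    · simp

/-- Only `c` can gain potential: its rank grows by at most one, which costs `κ`. The former root `o`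
keeps its rank and becomes a nonroot, with potential at most `κ` times its rank. A child of `c` may
see its parent's rank grow, which cannot raise its potential. -/
theorem link_pot {κ : ℕ} (hκ : n ≤ fastGrow κ 1) {c o v : ℤ}
    (hco : c = ρ x ∧ o = ρ (x + 1) ∨ c = ρ (x + 1) ∧ o = ρ x)
    (hvc : rank c ≤ v) (hvo : rank o < v) (hvn : v ≤ hi (ρ (x + 1)) - lo (ρ x))
    (hv1 : v ≤ rank c + 1) :
    forestPot κ n (Function.update par o c) (Function.update rank c v) ≤
      forestPot κ n par rank + κ := by
  have hx1 := h.root_mem x h1 (by omega)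
  have hx2 := h.root_mem (x + 1) (by omega) hn
  have hc : 1 ≤ c ∧ c ≤ n := by rcases hco with ⟨rfl, _⟩ | ⟨rfl, _⟩ <;> assumption
  have hoc : o ≠ c := by
    rcases hco with ⟨rfl, rfl⟩ | ⟨rfl, rfl⟩
    exacts [hne.symm, hne]
  have hpc : par c = c := by
    rcases hco with ⟨rfl, _⟩ | ⟨rfl, _⟩
    exacts [h.par_root x h1 (by omega), h.par_root (x + 1) (by omega) hn]
  have hpo : par o = o := by
    rcases hco with ⟨_, rfl⟩ | ⟨_, rfl⟩
    exacts [h.par_root (x + 1) (by omega) hn, h.par_root x h1 (by omega)]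
  have hvlt : v.toNat < fastGrow κ 1 := by
    have := (h.ends_mem x h1 (by omega)).1
    have := (h.ends_mem (x + 1) (by omega) hn).2
    omega
  have key : ∀ y ∈ Finset.Icc 1 n,
      nodePot κ (Function.update par o c) (Function.update rank c v) y ≤
        nodePot κ par rank y + if y = c then κ else 0 := by
    intro y hy
    rw [Finset.mem_Icc] at hy
    unfold nodePot
    rcases eq_or_ne y c with rfl | hyc
    · rw [Function.update_of_ne hoc.symm, if_pos hpc, if_pos hpc, if_pos rfl, Function.update_self]
      calc κ * v.toNat ≤ κ * ((rank y).toNat + 1) := Nat.mul_le_mul_left κ (by omega)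
        _ = _ := by ring
    rcases eq_or_ne y o with rfl | hyo
    · rw [Function.update_self, if_neg hoc.symm, if_pos hpo, Function.update_of_ne hoc]
      exact childPot_le.trans (Nat.le_add_right _ _)
    rw [Function.update_of_ne hyo, Function.update_of_ne hyc, if_neg hyc, add_zero]
    by_cases hp : par y = y
    · rw [if_pos hp, if_pos hp]
    · rw [if_neg hp, if_neg hp]
      rcases eq_or_ne (par y) c with he | he
      · rw [he, Function.update_self]
        have hlt := h.rank_lt y hy.1 hy.2 hp
        have := h.rank_nonneg y hy.1 hy.2
        rw [he] at hlt
        exact childPot_anti (by omega) (by omega) hvlt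
      · rw [Function.update_of_ne he]
  refine (Finset.sum_le_sum key).trans ?_
  rw [Finset.sum_add_distrib, Finset.sum_ite_eq' _ _ _, if_pos (Finset.mem_Icc.2 hc)]
  exact le_rfl

end Forest

/-! ## Reasoning about programs -/

/-- The command terminates, and its final memory and number of steps satisfy `Q`. -/
def Runs (P : ℕ → ℝ) (c : Cmd) (m : Mem) (Q : Mem → ℕ → Prop) : Prop :=
  ∃ m' n, Exec P c m m' n ∧ Q m' n

section

variable {P : ℕ → ℝ} {c d : Cmd} {b : Test} {m : Mem} {Q Q' : Mem → ℕ → Prop}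

theorem Runs.mono (h : Runs P c m Q') (hQ : ∀ m' n, Q' m' n → Q m' n) : Runs P c m Q := by
  obtain ⟨m', n, he, hq⟩ := h
  exact ⟨m', n, he, hQ _ _ hq⟩

theorem runs_skip : Runs P .skip m Q ↔ Q m 1 := by
  constructor
  · rintro ⟨m', n, h, hq⟩
    cases h
    exact hq
  · exact fun h => ⟨_, _, .skip m, h⟩

theorem runs_assign {v : Reg} {e : Expr} :
    Runs P (.assign v e) m Q ↔ Q (m.setReg v (e.eval m)) (e.steps + 1) := by
  constructor
  · rintro ⟨m', n, h, hq⟩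
    cases h
    exact hq
  · exact fun h => ⟨_, _, .assign m v e, h⟩

theorem runs_put {a : Arr} {i e : Expr} :
    Runs P (.put a i e) m Q ↔ Q (m.setArr a (i.eval m) (e.eval m)) (i.steps + e.steps + 1) := by
  constructor
  · rintro ⟨m', n, h, hq⟩
    cases h
    exact hq
  · exact fun h => ⟨_, _, .put m a i e, h⟩

theorem runs_seq : Runs P (.seq c d) m Q ↔
    Runs P c m fun m' n => Runs P d m' fun m'' n' => Q m'' (n + n') := by
  constructor
  · rintro ⟨m', n, h, hq⟩
    cases h with
    | seq h1 h2 => exact ⟨_, _, h1, _, _, h2, hq⟩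
  · rintro ⟨m', n, h1, m'', n', h2, hq⟩
    exact ⟨_, _, .seq h1 h2, hq⟩

theorem Runs.seq (h : Runs P c m Q')
    (h' : ∀ m' n, Q' m' n → Runs P d m' fun m'' n' => Q m'' (n + n')) :
    Runs P (.seq c d) m Q :=
  runs_seq.2 (h.mono h')

theorem runs_ite_true (hb : b.Holds P m) : Runs P (.ite b c d) m Q ↔
    Runs P c m fun m' n => Q m' (b.steps + 1 + n) := by
  constructor
  · rintro ⟨m', n, h, hq⟩
    cases h with
    | ite_true _ h => exact ⟨_, _, h, hq⟩
    | ite_false h _ => exact absurd hb h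
  · rintro ⟨m', n, h, hq⟩
    exact ⟨_, _, .ite_true hb h, hq⟩

theorem runs_ite_false (hb : ¬ b.Holds P m) : Runs P (.ite b c d) m Q ↔
    Runs P d m fun m' n => Q m' (b.steps + 1 + n) := by
  constructor
  · rintro ⟨m', n, h, hq⟩
    cases h with
    | ite_true h _ => exact absurd h hb
    | ite_false _ h => exact ⟨_, _, h, hq⟩
  · rintro ⟨m', n, h, hq⟩
    exact ⟨_, _, .ite_false hb h, hq⟩

theorem runs_ifThen_true (hb : b.Holds P m) : Runs P (Prog.ifThen b c) m Q ↔
    Runs P c m fun m' n => Q m' (b.steps + 1 + n) := runs_ite_true hb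

theorem runs_ifThen_false (hb : ¬ b.Holds P m) : Runs P (Prog.ifThen b c) m Q ↔
    Q m (b.steps + 1 + 1) := (runs_ite_false hb).trans runs_skip

theorem runs_while_true (hb : b.Holds P m)
    (h : Runs P c m fun m' n => Runs P (.while b c) m' fun m'' n' => Q m'' (b.steps + 1 + n + n')) :
    Runs P (.while b c) m Q := by
  obtain ⟨m', n, h1, m'', n', h2, hq⟩ := h
  exact ⟨_, _, .while_true hb h1 h2, hq⟩

theorem runs_while_false (hb : ¬ b.Holds P m) (h : Q m (b.steps + 1)) : Runs P (.while b c) m Q :=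
  ⟨_, _, .while_false hb, h⟩

end

/-! ### Effect of assignments on the memory. -/

@[simp] theorem Mem.setReg_reg (m : Mem) (v : Reg) (z : ℤ) :
    (m.setReg v z).reg = Function.update m.reg v z := rfl

@[simp] theorem Mem.setReg_arr (m : Mem) (v : Reg) (z : ℤ) : (m.setReg v z).arr = m.arr := rfl

@[simp] theorem Mem.setArr_reg (m : Mem) (a : Arr) (i z : ℤ) : (m.setArr a i z).reg = m.reg := rfl

@[simp] theorem Mem.setArr_arr (m : Mem) (a : Arr) (i z : ℤ) :
    (m.setArr a i z).arr = Function.update m.arr a (Function.update (m.arr a) i z) := rfl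

theorem Mem.setReg_self (m : Mem) (v : Reg) : m.setReg v (m.reg v) = m := by
  simp [Mem.setReg]

theorem Mem.setReg_setReg (m : Mem) (v : Reg) (y z : ℤ) :
    (m.setReg v y).setReg v z = m.setReg v z := by
  simp [Mem.setReg]

/-! ## The three disjoint-set structures -/

/-- The number of elements of a structure if there are `N` time intervals. -/
def Dsu.size (N : ℤ) : Dsu → ℤ
  | .byA => N + 1
  | .byB => N
  | .byBA => N

/-- The memory holds disjoint-set forests with the roots `ρ`. -/
def Holds (N : ℤ) (ρ : Dsu → ℤ → ℤ) (m : Mem) : Prop :=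
  ∀ s : Dsu, Forest (s.size N) (m.arr (.par s)) (m.arr (.rank s)) (m.arr (.lo s)) (m.arr (.hi s)) (ρ s)

/-- The potential of one of the structures. -/
noncomputable def dsuPot (κ : ℕ) (N : ℤ) (m : Mem) (s : Dsu) : ℕ :=
  forestPot κ (s.size N) (m.arr (.par s)) (m.arr (.rank s))

/-- The potential of the memory. -/
noncomputable def memPot (κ : ℕ) (N : ℤ) (m : Mem) : ℕ :=
  dsuPot κ N m .byA + dsuPot κ N m .byB + dsuPot κ N m .byBA

theorem memPot_add_dsuPot {κ : ℕ} {N : ℤ} {m m' : Mem} {s : Dsu}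
    (h : ∀ s', s' ≠ s → dsuPot κ N m' s' = dsuPot κ N m s') :
    memPot κ N m' + dsuPot κ N m s = memPot κ N m + dsuPot κ N m' s := by
  unfold memPot
  have h1 := h .byA
  have h2 := h .byB
  have h3 := h .byBA
  cases s <;> simp at h1 h2 h3 <;> omega

theorem Holds.of_arr_eq {N : ℤ} {ρ : Dsu → ℤ → ℤ} {m m' : Mem} (h : Holds N ρ m)
    (he : ∀ s, m'.arr (.par s) = m.arr (.par s) ∧ m'.arr (.rank s) = m.arr (.rank s) ∧
      m'.arr (.lo s) = m.arr (.lo s) ∧ m'.arr (.hi s) = m.arr (.hi s)) : Holds N ρ m' := by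
  intro s
  obtain ⟨h1, h2, h3, h4⟩ := he s
  rw [h1, h2, h3, h4]
  exact h s

theorem memPot_of_arr_eq {κ : ℕ} {N : ℤ} {m m' : Mem}
    (he : ∀ s, m'.arr (.par s) = m.arr (.par s) ∧ m'.arr (.rank s) = m.arr (.rank s)) :
    memPot κ N m' = memPot κ N m := by
  unfold memPot dsuPot
  rw [(he .byA).1, (he .byA).2, (he .byB).1, (he .byB).2, (he .byBA).1, (he .byBA).2]

/-- `m'` arises from `m` by changing parent pointers without changing the roots `ρ`, and by
changing registers in `R`. -/
structure Compressed (N : ℤ) (ρ : Dsu → ℤ → ℤ) (R : List Reg) (m m' : Mem) : Prop where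
  holds : Holds N ρ m'
  reg : ∀ w, w ∉ R → m'.reg w = m.reg w
  arr : ∀ a, (∀ s, a ≠ .par s) → m'.arr a = m.arr a

theorem Compressed.trans {N : ℤ} {ρ : Dsu → ℤ → ℤ} {R R' : List Reg} {m m' m'' : Mem}
    (h : Compressed N ρ R m m') (h' : Compressed N ρ R' m' m'') :
    Compressed N ρ (R ++ R') m m'' where
  holds := h'.holds
  reg w hw := by
    rw [List.mem_append, not_or] at hw
    rw [h'.reg w hw.2, h.reg w hw.1]
  arr a ha := by rw [h'.arr a ha, h.arr a ha]

theorem Compressed.subset {N : ℤ} {ρ : Dsu → ℤ → ℤ} {R R' : List Reg} {m m' : Mem}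
    (h : Compressed N ρ R m m') (hR : R ⊆ R') : Compressed N ρ R' m m' :=
  ⟨h.holds, fun w hw => h.reg w fun hR' => hw (hR hR'), h.arr⟩

theorem Compressed.setReg {N : ℤ} {ρ : Dsu → ℤ → ℤ} {m : Mem} (h : Holds N ρ m) (v : Reg) (z : ℤ) :
    Compressed N ρ [v] m (m.setReg v z) where
  holds := h.of_arr_eq fun s => by simp
  reg w hw := by
    have : w ≠ v := by simpa using hw
    simp [this]
  arr a _ := rfl

theorem memPot_setReg (κ : ℕ) (N : ℤ) (m : Mem) (v : Reg) (z : ℤ) :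
    memPot κ N (m.setReg v z) = memPot κ N m := rfl

section

variable {P : ℕ → ℝ} {κ : ℕ} {N : ℤ} {ρ : Dsu → ℤ → ℤ}

/-- One pass takes 9 steps (5 for the test, 1 for the branching, 3 for the assignment), and the
failing last test takes 6. -/
theorem runs_findLoop {s : Dsu} {v : Reg} {par rank lo hi : ℤ → ℤ} {n : ℤ} {ρ : ℤ → ℤ}
    (h : Forest n par rank lo hi ρ) {x : ℤ} {k : ℕ} (hk : PathLen par x k) (h1 : 1 ≤ x) (hn : x ≤ n)
    (m : Mem) (hp : m.arr (.par s) = par) (hx : m.reg v = x) :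
    Exec P (.while (Prog.ne (.get (.par s) (.reg v)) (.reg v)) (.assign v (.get (.par s) (.reg v))))
      m (m.setReg v (ρ x)) (9 * k + 6) := by
  induction hk generalizing m with
  | @root x hr =>
    rw [h.root_of_fixed x h1 hn hr, ← hx, Mem.setReg_self]
    refine Exec.while_false ?_
    simp [Prog.ne, Test.Holds, Expr.eval, hx, hp, hr]
  | @step x k hr _ ih =>
    have hm := h.par_mem x h1 hn
    have := ih hm.1 hm.2 (m.setReg v (par x)) (by simpa using hp) (by simp)
    rw [h.root_par x h1 hn, Mem.setReg_setReg] at this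
    have h2 := Exec.assign (P := P) m v (.get (.par s) (.reg v))
    rw [show Expr.eval m (.get (.par s) (.reg v)) = par x by simp [Expr.eval, hx, hp]] at h2
    have h3 := Exec.while_true (b := Prog.ne (.get (.par s) (.reg v)) (.reg v))
      (by simp [Prog.ne, Test.Holds, Expr.eval, hx, hp, hr]) h2 this
    convert h3 using 1
    simp [Prog.ne, Test.steps, Expr.steps]
    ring

/-- The loop for path compression. The set `K` consists of the levels of the elements on the path. -/
theorem runs_compressLoop (hκ : N + 1 ≤ fastGrow κ 1) {s : Dsu} {v : Reg} (hv1 : v ≠ .cur)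
    (hv2 : v ≠ .nxt) {k : ℕ} (m : Mem) (h : Holds N ρ m)
    (hk : PathLen (m.arr (.par s)) (m.reg .cur) k) (h1 : 1 ≤ m.reg .cur)
    (hn : m.reg .cur ≤ s.size N) (hv : m.reg v = ρ s (m.reg .cur)) :
    Runs P (.while (Prog.ne (.reg .cur) (.reg v)) (Prog.block [
      .assign .nxt (.get (.par s) (.reg .cur)),
      .put (.par s) (.reg .cur) (.reg v),
      .assign .cur (.reg .nxt)])) m fun m' n =>
      Compressed N ρ [.cur, .nxt] m m' ∧ n = 14 * k + 5 ∧
      ∃ K : Finset ℕ, K ⊆ Finset.range κ ∧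
        (∀ l ∈ K, ∃ a b, (m.arr (.rank s) (m.reg .cur)).toNat ≤ a ∧ a < b ∧
          b ≤ (m.arr (.rank s) (m.reg v)).toNat ∧ level κ a b = l) ∧
        k + memPot κ N m' ≤ memPot κ N m + K.card +
          if m.arr (.rank s) (m.reg .cur) = 0 then 1 else 0 := by
  induction k generalizing m with
  | zero =>
    cases hk with
    | root hr =>
      have := (h s).root_of_fixed _ h1 hn hr
      refine runs_while_false (by simp [Prog.ne, Test.Holds, Expr.eval, hv, this])
        ⟨⟨h, fun _ _ => rfl, fun _ _ => rfl⟩, rfl, ∅, by simp, by simp, by simp⟩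
  | succ k ih =>
    cases hk with
    | step hr hk =>
      set x := m.reg .cur with hxdef
      have hf := h s
      have hne : ρ s x ≠ x := fun he => hr ((hf.par_eq_iff h1 hn).2 he)
      have hp := hf.par_mem x h1 hn
      have hlt := hf.rank_lt x h1 hn hr
      have h0 := hf.rank_nonneg x h1 hn
      have hκ' : s.size N ≤ fastGrow κ 1 := by cases s <;> simp only [Dsu.size] <;> omega
      refine runs_while_true (by
        simp only [Prog.ne, Test.Holds, Expr.eval, hv]; exact fun he => hne he.symm) ?_
      simp only [Prog.block, runs_seq, runs_assign, runs_put, runs_skip]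
      set m1 : Mem := (((m.setReg .nxt (m.arr (.par s) x)).setArr (.par s) x (ρ s x)).setReg .cur
        (m.arr (.par s) x)) with hm1
      have e1 : ((m.setReg .nxt (Expr.eval m (.get (.par s) (.reg .cur)))).setArr (.par s)
          (Expr.eval (m.setReg .nxt (Expr.eval m (.get (.par s) (.reg .cur)))) (.reg .cur))
          (Expr.eval (m.setReg .nxt (Expr.eval m (.get (.par s) (.reg .cur)))) (.reg v))) =
          (m.setReg .nxt (m.arr (.par s) x)).setArr (.par s) x (ρ s x) := by
        simp [Expr.eval, hv2, hv, ← hxdef]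
      rw [e1]
      have e2 : Expr.eval ((m.setReg .nxt (m.arr (.par s) x)).setArr (.par s) x (ρ s x))
          (.reg .nxt) = m.arr (.par s) x := by simp [Expr.eval]
      rw [e2, ← hm1]
      have hcur : m1.reg .cur = m.arr (.par s) x := by simp [hm1]
      have hv' : m1.reg v = ρ s x := by simp [hm1, hv1, hv2, hv]
      have hpar : m1.arr (.par s) = Function.update (m.arr (.par s)) x (ρ s x) := by simp [hm1]
      have harr : ∀ a, a ≠ .par s → m1.arr a = m.arr a := fun a ha => by simp [hm1, ha]
      have hrank : m1.arr (.rank s) = m.arr (.rank s) := harr _ (by simp)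
      have hholds : Holds N ρ m1 := by
        intro s'
        rcases eq_or_ne s' s with rfl | hs'
        · rw [hpar, harr _ (by simp), harr _ (by simp), harr _ (by simp)]
          exact hf.compress h1 hn hr
        · rw [harr _ (by simpa using hs'), harr _ (by simp), harr _ (by simp), harr _ (by simp)]
          exact h s'
      have hk' : PathLen (m1.arr (.par s)) (m1.reg .cur) k := by
        rw [hpar, hcur]
        exact PathLen.update_of_rank_lt hf hp.1 hp.2 hlt hk
      have key := ih m1 hholds hk' (by rw [hcur]; exact hp.1) (by rw [hcur]; exact hp.2)
        (by rw [hv', hcur, hf.root_par x h1 hn])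
      refine key.mono ?_
      rintro m' n ⟨hc, hn', K, hK, hKl, hpot⟩
      rw [hcur, hrank, hv'] at hKl
      rw [hcur, hrank] at hpot
      -- Only the first element of a path can have rank `0`; it has no potential to pay with, which
      -- accounts for the extra summand `1`.
      have hposp : m.arr (.rank s) (m.arr (.par s) x) ≠ 0 := by omega
      rw [if_neg hposp] at hpot
      refine ⟨⟨hc.holds, fun w hw => ?_, fun a ha => ?_⟩, ?_, ?_⟩
      · rw [hc.reg w hw]
        simp only [List.mem_cons, List.not_mem_nil, or_false, not_or] at hw
        simp [hm1, hw.1, hw.2]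
      · rw [hc.arr a ha, harr a (ha s)]
      · rw [hn']
        simp [Prog.ne, Test.steps, Expr.steps]
        ring
      · obtain ⟨f1, f2, f3, f4, f5⟩ := hf.compress_nodePot hκ' h1 hn hr
        have hmp := memPot_add_dsuPot (κ := κ) (N := N) (m := m) (m' := m1) (s := s) fun s' hs' => by
          unfold dsuPot
          rw [harr _ (by simpa using hs'), harr _ (by simp)]
        have hdp : dsuPot κ N m1 s + nodePot κ (m.arr (.par s)) (m.arr (.rank s)) x = dsuPot κ N m s +
            nodePot κ (Function.update (m.arr (.par s)) x (ρ s x)) (m.arr (.rank s)) x := by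
          unfold dsuPot
          rw [hpar, hrank]
          exact forestPot_update h1 hn
        rw [f1, f2] at hdp
        have hanti := childPot_anti (κ := κ) f3 f4 f5
        rw [hv]
        by_cases hr0 : m.arr (.rank s) x = 0
        · refine ⟨K, hK, fun l hl => ?_, ?_⟩
          · obtain ⟨a, b, g1, g2, g3, g4⟩ := hKl l hl
            exact ⟨a, b, by omega, g2, g3, g4⟩
          · rw [if_pos hr0]; omega
        · rw [if_neg hr0]
          have hpos : 1 ≤ (m.arr (.rank s) x).toNat := by omega
          -- If a later element of the path has the same level, then linking `x` to the root lowers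
          -- its potential and this pays for the edge. Otherwise `x` is the last of its level on the
          -- path, and the level is recorded in `K`.
          by_cases hl : level κ (m.arr (.rank s) x).toNat
              (m.arr (.rank s) (m.arr (.par s) x)).toNat ∈ K
          · refine ⟨K, hK, fun l hl => ?_, ?_⟩
            · obtain ⟨a, b, g1, g2, g3, g4⟩ := hKl l hl
              exact ⟨a, b, by omega, g2, g3, g4⟩
            · obtain ⟨a, b, g1, g2, g3, g4⟩ := hKl _ hl
              have := childPot_lt hpos f3 g1 g2 g3 f5 g4.symm
              omega
          · refine ⟨insert (level κ (m.arr (.rank s) x).toNat (m.arr (.rank s) (m.arr (.par s) x)).toNat) K,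
              Finset.insert_subset ?_ hK, fun l hl' => ?_, ?_⟩
            · exact Finset.mem_range.2 (level_lt f3 hpos (f4.trans_lt f5))
            · rcases Finset.mem_insert.1 hl' with rfl | hl'
              · exact ⟨_, _, le_rfl, f3, f4, rfl⟩
              · obtain ⟨a, b, g1, g2, g3, g4⟩ := hKl l hl'
                exact ⟨a, b, by omega, g2, g3, g4⟩
            · rw [Finset.card_insert_of_notMem hl]; omega

/-- With at most `κ` levels in `K`, at most `κ + 1` edges remain unpaid. An edge costs 9 steps in
the search and 14 in the compression, which is the factor 23 in front of the potential. -/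
theorem runs_find (hκ : N + 1 ≤ fastGrow κ 1) {s : Dsu} {e : Expr} {v : Reg} (hv1 : v ≠ .cur)
    (hv2 : v ≠ .nxt) {m : Mem} (h : Holds N ρ m) {x : ℤ} (hx : e.eval m = x) (h1 : 1 ≤ x)
    (hn : x ≤ s.size N) :
    Runs P (Prog.find s e v) m fun m' n => Compressed N ρ [.cur, .nxt, v] m m' ∧
      m'.reg v = ρ s x ∧
      n + 23 * memPot κ N m' ≤ 23 * memPot κ N m + (23 * κ + 38 + e.steps) := by
  unfold Prog.find
  simp only [Prog.block, runs_seq, runs_assign]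
  obtain ⟨k, hk⟩ := (h s).exists_pathLen h1 hn
  rw [hx]
  set m1 := (m.setReg .cur x).setReg v x with hm1
  have e1 : (m.setReg .cur x).setReg v (Expr.eval (m.setReg .cur x) (.reg .cur)) = m1 := by
    simp [Expr.eval, hm1]
  rw [e1]
  have hloop := runs_findLoop (P := P) (s := s) (v := v) (h s) hk h1 hn m1 rfl (by simp [hm1])
  refine ⟨_, _, hloop, ?_⟩
  set m2 := m1.setReg v (ρ s x) with hm2
  have hcur : m2.reg .cur = x := by simp [hm2, hm1, hv1.symm]
  have hv' : m2.reg v = ρ s x := by simp [hm2]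
  have harr : m2.arr = m.arr := rfl
  have hpot : memPot κ N m2 = memPot κ N m := rfl
  have h2 : Holds N ρ m2 := h
  refine (runs_compressLoop hκ hv1 hv2 m2 h2 (k := k) (by rw [hcur, harr]; exact hk)
    (by rw [hcur]; exact h1) (by rw [hcur]; exact hn) (by rw [hv', hcur])).mono ?_
  rintro m' n ⟨hc, hn', K, hK, -, hp⟩
  rw [runs_skip]
  refine ⟨⟨hc.holds, fun w hw => ?_, fun a ha => hc.arr a ha⟩, ?_, ?_⟩
  · simp only [List.mem_cons, List.not_mem_nil, or_false, not_or] at hw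
    rw [hc.reg w (by simp [hw.1, hw.2.1])]
    simp [hm2, hm1, hw.1, hw.2.2]
  · rw [hc.reg v (by simp [hv1, hv2]), hv']
  · have hcard := Finset.card_le_card hK
    rw [Finset.card_range] at hcard
    rw [hpot] at hp
    have : k + memPot κ N m' ≤ memPot κ N m + κ + 1 := by
      refine hp.trans ?_
      split_ifs <;> omega
    simp only [Expr.steps]
    omega

end

/-- `m'` arises from `m` by uniting the sets of `x` and `x + 1` in the structure `s` to a set with
the root `c`, and possibly by compressing paths. -/
structure United (N : ℤ) (ρ : Dsu → ℤ → ℤ) (s : Dsu) (x c : ℤ) (m m' : Mem) : Prop where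
  root_or : c = ρ s x ∨ c = ρ s (x + 1)
  holds : Holds N (Function.update ρ s (mergeRoot (ρ s) (ρ s x) (ρ s (x + 1)) c)) m'
  root : m'.reg .root = c
  reg : ∀ w, w ∉ [Reg.cur, .nxt, .r₁, .r₂, .root, .mn, .mx] → m'.reg w = m.reg w
  arr : ∀ a, (∀ s', a ≠ .par s') → a ≠ .rank s → a ≠ .lo s → a ≠ .hi s → m'.arr a = m.arr a

section

variable {P : ℕ → ℝ} {κ : ℕ} {N : ℤ} {ρ : Dsu → ℤ → ℤ}

theorem united_of_link (hκ : N + 1 ≤ fastGrow κ 1) {s : Dsu} {x c o v : ℤ} {m m' : Mem}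
    (h : Holds N ρ m) (h1 : 1 ≤ x) (hn : x + 1 ≤ s.size N) (hne : ρ s x ≠ ρ s (x + 1))
    (hco : c = ρ s x ∧ o = ρ s (x + 1) ∨ c = ρ s (x + 1) ∧ o = ρ s x)
    (hvc : m.arr (.rank s) c ≤ v) (hvo : m.arr (.rank s) o < v) (hv1 : v ≤ m.arr (.rank s) c + 1)
    (hv : v = m.arr (.rank s) c ∨ m.arr (.rank s) c = m.arr (.rank s) o)
    (hroot : m'.reg .root = c)
    (hpar : m'.arr (.par s) = Function.update (m.arr (.par s)) o c)
    (hrank : m'.arr (.rank s) = Function.update (m.arr (.rank s)) c v)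
    (hlo : m'.arr (.lo s) = Function.update (m.arr (.lo s)) c (m.arr (.lo s) (ρ s x)))
    (hhi : m'.arr (.hi s) = Function.update (m.arr (.hi s)) c (m.arr (.hi s) (ρ s (x + 1))))
    (hreg : ∀ w, w ∉ [Reg.cur, .nxt, .r₁, .r₂, .root, .mn, .mx] → m'.reg w = m.reg w)
    (harr : ∀ a, a ≠ .par s → a ≠ .rank s → a ≠ .lo s → a ≠ .hi s → m'.arr a = m.arr a) :
    United N ρ s x c m m' ∧ memPot κ N m' ≤ memPot κ N m + κ := by
  have hκ' : s.size N ≤ fastGrow κ 1 := by cases s <;> simp only [Dsu.size] <;> omega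
  -- The union has at least one element more than the set of `c`, which makes room for the rank to
  -- grow by one.
  have hvn : v ≤ m.arr (.hi s) (ρ s (x + 1)) - m.arr (.lo s) (ρ s x) := by
    have e1 := (h s).rank_root_le x h1 (by omega)
    have e2 := (h s).rank_root_le (x + 1) (by omega) hn
    have e3 := (h s).hi_root_eq h1 hn hne
    have e4 := (h s).lo_root_eq h1 hn hne
    have e5 := (h s).mem_interval h1 (by omega)
    have e6 := (h s).mem_interval (x := x + 1) (by omega) hn
    rcases hco with ⟨rfl, rfl⟩ | ⟨rfl, rfl⟩ <;> omega
  have hlink := (h s).link h1 hn hne hco hvc hvo hvn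
  have hpot := (h s).link_pot h1 hn hne hκ' hco hvc hvo hvn hv1
  refine ⟨⟨?_, fun s' => ?_, hroot, hreg, fun a ha => harr a (ha s)⟩, ?_⟩
  · rcases hco with ⟨rfl, _⟩ | ⟨rfl, _⟩
    exacts [Or.inl rfl, Or.inr rfl]
  · rcases eq_or_ne s' s with rfl | hs
    · rw [hpar, hrank, hlo, hhi, Function.update_self]
      exact hlink
    · rw [Function.update_of_ne hs, harr (.par s') (by simpa using hs) (by simp) (by simp) (by simp),
        harr (.rank s') (by simp) (by simpa using hs) (by simp) (by simp),
        harr (.lo s') (by simp) (by simp) (by simpa using hs) (by simp),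
        harr (.hi s') (by simp) (by simp) (by simp) (by simpa using hs)]
      exact h s'
  · have hmp := memPot_add_dsuPot (κ := κ) (N := N) (m := m) (m' := m') (s := s) fun s' hs => by
      unfold dsuPot
      rw [harr (.par s') (by simpa using hs) (by simp) (by simp) (by simp),
        harr (.rank s') (by simp) (by simpa using hs) (by simp) (by simp)]
    have : dsuPot κ N m' s ≤ dsuPot κ N m s + κ := by
      unfold dsuPot
      rw [hpar, hrank]
      exact hpot
    omega

/-- Two finds and a link, at 23 `κ` each. The second argument is evaluated after the first find, so
its value is required in every memory that agrees with `m` outside of the registers used by that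
find. -/
theorem runs_unite (hκ : N + 1 ≤ fastGrow κ 1) {s : Dsu} {e f : Expr} {m : Mem} (h : Holds N ρ m)
    {x : ℤ} (he : e.eval m = x)
    (hf : ∀ m' : Mem, (∀ w, w ∉ [Reg.cur, .nxt, .r₁] → m'.reg w = m.reg w) → f.eval m' = x + 1)
    (h1 : 1 ≤ x) (hn : x + 1 ≤ s.size N) (hne : ρ s x ≠ ρ s (x + 1)) :
    Runs P (Prog.unite s e f) m fun m' n => (∃ c, United N ρ s x c m m') ∧
      n + 23 * memPot κ N m' ≤ 23 * memPot κ N m + (69 * κ + 130 + e.steps + f.steps) := by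
  unfold Prog.unite
  simp only [Prog.block]
  refine (runs_find hκ (by simp) (by simp) h he h1 (by omega)).seq ?_
  rintro m1 n1 ⟨c1, v1, k1⟩
  refine (runs_find hκ (by simp) (by simp) c1.holds (hf m1 c1.reg) (by omega) hn).seq ?_
  rintro m2 n2 ⟨c2, v2, k2⟩
  have hr1 : m2.reg .r₁ = ρ s x := by rw [c2.reg _ (by simp), v1]
  have hreg : ∀ w, w ∉ [Reg.cur, .nxt, .r₁, .r₂, .root, .mn, .mx] → m2.reg w = m.reg w := by
    intro w hw
    simp only [List.mem_cons, List.not_mem_nil, or_false, not_or] at hw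
    rw [c2.reg w (by simp [hw]), c1.reg w (by simp [hw])]
  have harr : ∀ a, (∀ s', a ≠ .par s') → m2.arr a = m.arr a := fun a ha => by
    rw [c2.arr a ha, c1.arr a ha]
  rw [runs_seq, runs_assign, runs_seq, runs_ifThen_true (by
    simpa [Prog.ne, Test.Holds, Expr.eval, hr1, v2] using hne)]
  simp only [runs_seq, runs_assign]
  have hxs : ρ s (x + 1) ≠ ρ s x := hne.symm
  have finish : ∀ (m' : Mem) (c : ℤ) (k : ℕ), k ≤ 54 →
      (United N ρ s x c m2 m' ∧ memPot κ N m' ≤ memPot κ N m2 + κ) →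
      (∃ c, United N ρ s x c m m') ∧ n1 + (n2 + k) + 23 * memPot κ N m' ≤
        23 * memPot κ N m + (69 * κ + 130 + e.steps + f.steps) := by
    rintro m' c k hk ⟨hu, hu2⟩
    refine ⟨⟨c, hu.root_or, hu.holds, hu.root, fun w hw => ?_, fun a ha h2 h3 h4 => ?_⟩, by omega⟩
    · rw [hu.reg w hw, hreg w hw]
    · rw [hu.arr a ha h2 h3 h4, harr a ha]
  by_cases hle : m2.arr (.rank s) (ρ s (x + 1)) ≤ m2.arr (.rank s) (ρ s x)
  · rw [runs_ite_true (by simpa [Test.Holds, Expr.eval, hr1, v2] using hle), runs_seq]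
    by_cases heq : m2.arr (.rank s) (ρ s x) = m2.arr (.rank s) (ρ s (x + 1))
    · rw [runs_ifThen_true (by simpa [Test.Holds, Expr.eval, hr1, v2] using heq)]
      simp only [runs_put, runs_seq, runs_skip]
      refine finish _ _ _ ?_ (united_of_link (κ := κ) hκ c2.holds h1 hn hne
        (c := ρ s x) (o := ρ s (x + 1)) (v := m2.arr (.rank s) (ρ s x) + 1)
        (Or.inl ⟨rfl, rfl⟩) (by omega) (by omega) le_rfl (Or.inr heq) ?_ ?_ ?_ ?_ ?_ ?_ ?_)
      · simp [Prog.ne, Expr.steps, Test.steps, Prog.one]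
      any_goals simp [Expr.eval, Prog.one, hr1, v2]
      · intro w _ _ _ _ g1 g2 g3
        simp [g1, g2, g3]
      · intro a g1 g2 g3 g4
        simp [g1, g2, g3, g4]
    · rw [runs_ifThen_false (by simpa [Test.Holds, Expr.eval, hr1, v2] using heq)]
      simp only [runs_put, runs_seq, runs_skip]
      refine finish _ _ _ ?_ (united_of_link (κ := κ) hκ c2.holds h1 hn hne
        (c := ρ s x) (o := ρ s (x + 1)) (v := m2.arr (.rank s) (ρ s x))
        (Or.inl ⟨rfl, rfl⟩) le_rfl (by omega) (by omega) (Or.inl rfl) ?_ ?_ ?_ ?_ ?_ ?_ ?_)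
      · simp [Prog.ne, Expr.steps, Test.steps]
      any_goals simp [Expr.eval, hr1, v2]
      · intro w _ _ _ _ g1 g2 g3
        simp [g1, g2, g3]
      · intro a g1 g2 g3 g4
        simp [g1, g3, g4]
  · rw [runs_ite_false (by simpa [Test.Holds, Expr.eval, hr1, v2] using hle), runs_seq]
    simp only [runs_put, runs_seq, runs_assign, runs_skip]
    refine finish _ _ _ ?_ (united_of_link (κ := κ) hκ c2.holds h1 hn
      hne (c := ρ s (x + 1)) (o := ρ s x) (v := m2.arr (.rank s) (ρ s (x + 1)))
      (Or.inr ⟨rfl, rfl⟩) le_rfl (by omega) (by omega) (Or.inl rfl) ?_ ?_ ?_ ?_ ?_ ?_ ?_)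
    · simp [Prog.ne, Expr.steps, Test.steps]
    any_goals simp [Expr.eval, hr1, v2]
    · intro w _ _ _ _ g1 g2 g3
      simp [g1, g2, g3]
    · intro a g1 g2 g3 g4
      simp [g1, g3, g4]

end

/-! ## Local minima among the classes of an interval partition -/

/-- The function `α` separates the class of `t` from the preceding class. -/
def SepLeft (N : ℤ) (α γ : ℤ → ℤ) (t : ℤ) : Prop :=
  ∀ s, 1 ≤ s → s + 1 ≤ N → γ s ≠ γ (s + 1) → γ (s + 1) = γ t → α s ≠ α (s + 1)

/-- The function `β` separates the class of `t` from the succeeding class. -/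
def SepRight (N : ℤ) (β γ : ℤ → ℤ) (t : ℤ) : Prop :=
  ∀ s, 1 ≤ s → s + 1 ≤ N → γ s ≠ γ (s + 1) → γ s = γ t → β s ≠ β (s + 1)

/-- The classes of `γ` are the intersections of those of `α` and `β`. -/
def IsMeet (N : ℤ) (α β γ : ℤ → ℤ) : Prop :=
  ∀ i, 1 ≤ i → i + 1 ≤ N → (γ i = γ (i + 1) ↔ α i = α (i + 1) ∧ β i = β (i + 1))

open Classical in
/-- The value of `δ` at the root of a class is that of `D` if the class is a local minimum, and
`-1` otherwise. -/
def StoresMin (N : ℤ) (α β γ D δ : ℤ → ℤ) : Prop :=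
  ∀ t, 1 ≤ t → t ≤ N → δ (γ t) = if SepLeft N α γ t ∧ SepRight N β γ t then D t else -1

/-- `α'` arises from `α` by joining the classes of `j` and `j + 1`. -/
def Joins (N : ℤ) (α : ℤ → ℤ) (j : ℤ) (α' : ℤ → ℤ) : Prop :=
  ∀ i, 1 ≤ i → i + 1 ≤ N → (α' i = α' (i + 1) ↔ α i = α (i + 1) ∨ i = j)

theorem mergeRoot_eq_iff {γ : ℤ → ℤ} {a b c t : ℤ} (hc : c = a ∨ c = b) (ha : γ t ≠ a) (hb : γ t ≠ b)
    (y : ℤ) : mergeRoot γ a b c y = mergeRoot γ a b c t ↔ γ y = γ t := by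
  unfold mergeRoot
  rw [if_neg (c := γ t = a ∨ γ t = b) (by tauto)]
  split_ifs with h
  · constructor
    · intro he; rcases hc with rfl | rfl <;> exact absurd he.symm (by assumption)
    · intro he; rw [he] at h; tauto
  · rfl

theorem mergeRoot_of_mem {γ : ℤ → ℤ} {a b c t : ℤ} (h : γ t = a ∨ γ t = b) :
    mergeRoot γ a b c t = c := if_pos h

section

variable {N : ℤ} {α β γ D δ : ℤ → ℤ} {j : ℤ}

theorem SepLeft.congr {α' γ' : ℤ → ℤ} {t : ℤ}
    (h1 : ∀ s, 1 ≤ s → s + 1 ≤ N → (γ (s + 1) = γ t ↔ γ' (s + 1) = γ' t))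
    (h2 : ∀ s, 1 ≤ s → s + 1 ≤ N → γ (s + 1) = γ t → (γ s = γ (s + 1) ↔ γ' s = γ' (s + 1)))
    (h3 : ∀ s, 1 ≤ s → s + 1 ≤ N → γ s ≠ γ (s + 1) → γ (s + 1) = γ t →
      (α s = α (s + 1) ↔ α' s = α' (s + 1))) :
    SepLeft N α γ t ↔ SepLeft N α' γ' t := by
  constructor
  · intro h s a b c d
    have d' := (h1 s a b).2 d
    have c' := fun he => c ((h2 s a b d').1 he)
    exact fun he => h s a b c' d' ((h3 s a b c' d').2 he)
  · intro h s a b c d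
    have d' := (h1 s a b).1 d
    have c' := fun he => c ((h2 s a b d).2 he)
    exact fun he => h s a b c' d' ((h3 s a b c d).1 he)

theorem SepRight.congr {β' γ' : ℤ → ℤ} {t : ℤ}
    (h1 : ∀ s, 1 ≤ s → s + 1 ≤ N → (γ s = γ t ↔ γ' s = γ' t))
    (h2 : ∀ s, 1 ≤ s → s + 1 ≤ N → γ s = γ t → (γ s = γ (s + 1) ↔ γ' s = γ' (s + 1)))
    (h3 : ∀ s, 1 ≤ s → s + 1 ≤ N → γ s ≠ γ (s + 1) → γ s = γ t →
      (β s = β (s + 1) ↔ β' s = β' (s + 1))) :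
    SepRight N β γ t ↔ SepRight N β' γ' t := by
  constructor
  · intro h s a b c d
    have d' := (h1 s a b).2 d
    have c' := fun he => c ((h2 s a b d').1 he)
    exact fun he => h s a b c' d' ((h3 s a b c' d').2 he)
  · intro h s a b c d
    have d' := (h1 s a b).1 d
    have c' := fun he => c ((h2 s a b d).2 he)
    exact fun he => h s a b c' d' ((h3 s a b c d).1 he)

theorem SepLeft.of_eq {t u : ℤ} (h : γ t = γ u) : SepLeft N α γ t ↔ SepLeft N α γ u := by
  unfold SepLeft; rw [h]

theorem SepRight.of_eq {t u : ℤ} (h : γ t = γ u) : SepRight N β γ t ↔ SepRight N β γ u := by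
  unfold SepRight; rw [h]

variable (h1 : 1 ≤ j) (hjN : j + 1 ≤ N) (hδ : StoresMin N α β γ D δ)
include h1 hjN hδ

open Classical in
/-- The effect of joining two classes of `β` if the classes of `γ` next to the border are joined. -/
theorem StoresMin.joinRight_merge {β' γ' : ℤ → ℤ} {c : ℤ}
    (hβ' : Joins N β j β') (hβj : β j ≠ β (j + 1)) (hγj : γ j ≠ γ (j + 1))
    (hγ : γ' = mergeRoot γ (γ j) (γ (j + 1)) c) (hγ' : Joins N γ j γ')
    (hc : c = γ j ∨ c = γ (j + 1)) (hD : ∀ t, 1 ≤ t → t ≤ N → γ' t = γ' (j + 1) → D t = D (j + 1))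
    {d : ℤ} (hd : d = if SepLeft N α γ' (j + 1) ∧ SepRight N β' γ' (j + 1) then δ (γ j) else -1) :
    StoresMin N α β' γ' D (Function.update δ c d) := by
  have hm1 : γ' j = c := by rw [hγ]; exact mergeRoot_of_mem (Or.inl rfl)
  have hm2 : γ' (j + 1) = c := by rw [hγ]; exact mergeRoot_of_mem (Or.inr rfl)
  intro t ht htN
  by_cases ht' : γ t = γ j ∨ γ t = γ (j + 1)
  · have hmt : γ' t = c := by rw [hγ]; exact mergeRoot_of_mem ht'
    have hteq : γ' t = γ' (j + 1) := hmt.trans hm2.symm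
    rw [hmt, Function.update_self, hd, SepLeft.of_eq hteq, SepRight.of_eq hteq]
    split_ifs with hs
    -- If the united class is a local minimum, then the class of `j` was one before: its left border
    -- is unchanged, and at its right border `β` still separated `j` from `j + 1`. So its value is
    -- stored and is the right one.
    · rw [hδ j h1 (by omega), if_pos, hD t ht htN hteq, hD j h1 (by omega) (hm1.trans hm2.symm)]
      refine ⟨fun s s1 sN sne seq => ?_, fun s s1 sN sne seq => ?_⟩
      · have hsj : s ≠ j := by rintro rfl; exact hγj seq.symm
        refine hs.1 s s1 sN (fun he => ?_) ?_
        · exact ((hγ' s s1 sN).1 he).elim sne hsj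
        · rw [hm2, hγ]; exact mergeRoot_of_mem (Or.inl seq)
      · rcases eq_or_ne s j with rfl | hsj
        · exact hβj
        · have := hs.2 s s1 sN (fun he => ((hγ' s s1 sN).1 he).elim sne hsj)
            (by rw [hm2, hγ]; exact mergeRoot_of_mem (Or.inl seq))
          exact fun he => this ((hβ' s s1 sN).2 (Or.inl he))
    · rfl
  · rw [not_or] at ht'
    have hmt : γ' t = γ t := by rw [hγ]; exact if_neg (by tauto)
    have hne : γ' t ≠ c := by
      rw [hmt]; rcases hc with rfl | rfl
      exacts [ht'.1, ht'.2]
    have hiff : ∀ y, γ' y = γ' t ↔ γ y = γ t := by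
      intro y; rw [hγ]; exact mergeRoot_eq_iff hc ht'.1 ht'.2 y
    rw [Function.update_of_ne hne, hmt, hδ t ht htN]
    have hL : SepLeft N α γ t ↔ SepLeft N α γ' t := by
      refine SepLeft.congr (fun s _ _ => (hiff _).symm) (fun s s1 sN seq => ?_) fun _ _ _ _ _ => Iff.rfl
      have : s ≠ j := by rintro rfl; exact ht'.2 seq.symm
      rw [hγ' s s1 sN]; tauto
    -- The border at `j` is the right border of the class of `j` only, and `t` is not in that class.
    have hR : SepRight N β γ t ↔ SepRight N β' γ' t := by
      refine SepRight.congr (fun s _ _ => (hiff _).symm) (fun s s1 sN seq => ?_)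
        fun s s1 sN _ seq => ?_ <;>
      · have : s ≠ j := by rintro rfl; exact ht'.1 seq.symm
        first | rw [hγ' s s1 sN] | rw [hβ' s s1 sN]
        tauto
    rw [hL, hR]

/-- The effect of joining two classes of `β` if the classes of `γ` remain the same. -/
theorem StoresMin.joinRight {β' : ℤ → ℤ} (hβ' : Joins N β j β') (hγj : γ j ≠ γ (j + 1))
    (hαj : α j ≠ α (j + 1)) : StoresMin N α β' γ D (Function.update δ (γ j) (-1)) := by
  intro t ht htN
  by_cases ht' : γ t = γ j
  -- The class of `j` still ends at `j`, but `β` no longer separates it from its successor.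
  · rw [ht', Function.update_self, if_neg]
    exact fun hs => hs.2 j h1 hjN hγj ht'.symm ((hβ' j h1 hjN).2 (Or.inr rfl))
  · rw [Function.update_of_ne ht', hδ t ht htN]
    have hR : SepRight N β γ t ↔ SepRight N β' γ t := by
      refine SepRight.congr (fun _ _ _ => Iff.rfl) (fun _ _ _ _ => Iff.rfl) fun s s1 sN _ seq => ?_
      have : s ≠ j := by rintro rfl; exact ht' seq.symm
      rw [hβ' s s1 sN]; tauto
    rw [hR]

open Classical in
/-- The effect of joining two classes of `α` if the classes of `γ` next to the border are joined. -/
theorem StoresMin.joinLeft_merge {α' γ' : ℤ → ℤ} {c : ℤ}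
    (hα' : Joins N α j α') (hαj : α j ≠ α (j + 1)) (hγj : γ j ≠ γ (j + 1))
    (hγ : γ' = mergeRoot γ (γ j) (γ (j + 1)) c) (hγ' : Joins N γ j γ')
    (hc : c = γ j ∨ c = γ (j + 1)) (hD : ∀ t, 1 ≤ t → t ≤ N → γ' t = γ' (j + 1) → D t = D (j + 1))
    {d : ℤ} (hd : d = if SepLeft N α' γ' (j + 1) ∧ SepRight N β γ' (j + 1) then δ (γ (j + 1)) else -1) :
    StoresMin N α' β γ' D (Function.update δ c d) := by
  have hm2 : γ' (j + 1) = c := by rw [hγ]; exact mergeRoot_of_mem (Or.inr rfl)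
  intro t ht htN
  by_cases ht' : γ t = γ j ∨ γ t = γ (j + 1)
  · have hmt : γ' t = c := by rw [hγ]; exact mergeRoot_of_mem ht'
    have hteq : γ' t = γ' (j + 1) := hmt.trans hm2.symm
    rw [hmt, Function.update_self, hd, SepLeft.of_eq hteq, SepRight.of_eq hteq]
    split_ifs with hs
    -- Mirror image of the join in `β`: the right part was the local minimum, so the value kept is
    -- that of `j + 1`.
    · rw [hδ (j + 1) (by omega) (by omega), if_pos, hD t ht htN hteq]
      refine ⟨fun s s1 sN sne seq => ?_, fun s s1 sN sne seq => ?_⟩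
      · rcases eq_or_ne s j with rfl | hsj
        · exact hαj
        · have := hs.1 s s1 sN (fun he => ((hγ' s s1 sN).1 he).elim sne hsj)
            (by rw [hm2, hγ]; exact mergeRoot_of_mem (Or.inr seq))
          exact fun he => this ((hα' s s1 sN).2 (Or.inl he))
      · have hsj : s ≠ j := by rintro rfl; exact hγj seq
        refine hs.2 s s1 sN (fun he => ?_) ?_
        · exact ((hγ' s s1 sN).1 he).elim sne hsj
        · rw [hm2, hγ]; exact mergeRoot_of_mem (Or.inr seq)
    · rfl
  · rw [not_or] at ht'
    have hmt : γ' t = γ t := by rw [hγ]; exact if_neg (by tauto)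
    have hne : γ' t ≠ c := by
      rw [hmt]; rcases hc with rfl | rfl
      exacts [ht'.1, ht'.2]
    have hiff : ∀ y, γ' y = γ' t ↔ γ y = γ t := by
      intro y; rw [hγ]; exact mergeRoot_eq_iff hc ht'.1 ht'.2 y
    rw [Function.update_of_ne hne, hmt, hδ t ht htN]
    have hL : SepLeft N α γ t ↔ SepLeft N α' γ' t := by
      refine SepLeft.congr (fun s _ _ => (hiff _).symm) (fun s s1 sN seq => ?_)
        fun s s1 sN _ seq => ?_ <;>
      · have : s ≠ j := by rintro rfl; exact ht'.2 seq.symm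
        first | rw [hγ' s s1 sN] | rw [hα' s s1 sN]
        tauto
    have hR : SepRight N β γ t ↔ SepRight N β γ' t := by
      refine SepRight.congr (fun s _ _ => (hiff _).symm) (fun s s1 sN seq => ?_) fun _ _ _ _ _ => Iff.rfl
      have : s ≠ j := by rintro rfl; exact ht'.1 seq.symm
      rw [hγ' s s1 sN]; tauto
    rw [hL, hR]

/-- The effect of joining two classes of `α` if the classes of `γ` remain the same. -/
theorem StoresMin.joinLeft {α' : ℤ → ℤ} (hα' : Joins N α j α') (hγj : γ j ≠ γ (j + 1))
    (hβj : β j ≠ β (j + 1)) : StoresMin N α' β γ D (Function.update δ (γ (j + 1)) (-1)) := by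
  intro t ht htN
  by_cases ht' : γ t = γ (j + 1)
  · rw [ht', Function.update_self, if_neg]
    exact fun hs => hs.1 j h1 hjN hγj ht'.symm ((hα' j h1 hjN).2 (Or.inr rfl))
  · rw [Function.update_of_ne ht', hδ t ht htN]
    have hL : SepLeft N α γ t ↔ SepLeft N α' γ t := by
      refine SepLeft.congr (fun _ _ _ => Iff.rfl) (fun _ _ _ _ => Iff.rfl) fun s s1 sN _ seq => ?_
      have : s ≠ j := by rintro rfl; exact ht' seq.symm
      rw [hα' s s1 sN]; tauto
    rw [hL]

end

/-! ### Ends of the sets and functions constant on them. -/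

namespace Forest

variable {n : ℤ} {par rank lo hi ρ : ℤ → ℤ} (h : Forest n par rank lo hi ρ)
include h

theorem root_lo {t : ℤ} (h1 : 1 ≤ t) (hn : t ≤ n) : ρ (lo (ρ t)) = ρ t := by
  have e1 := h.mem_interval h1 hn
  have e2 := h.ends_mem t h1 hn
  exact (h.interval t h1 hn _ e2.1 (by omega)).2 ⟨le_rfl, by omega⟩

theorem root_hi {t : ℤ} (h1 : 1 ≤ t) (hn : t ≤ n) : ρ (hi (ρ t)) = ρ t := by
  have e1 := h.mem_interval h1 hn
  have e2 := h.ends_mem t h1 hn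
  exact (h.interval t h1 hn _ (by omega) e2.2).2 ⟨by omega, le_rfl⟩

/-- Elements between two elements of a set belong to the set. -/
theorem root_eq_of_between {t u v : ℤ} (h1 : 1 ≤ t) (hn : v ≤ n) (htu : t ≤ u) (huv : u ≤ v)
    (he : ρ t = ρ v) : ρ u = ρ v := by
  have e1 := (h.interval v (by omega) hn t h1 (by omega)).1 he
  have e2 := h.mem_interval (x := v) (by omega) hn
  exact (h.interval v (by omega) hn u (by omega) (by omega)).2 (by omega)

/-- A class that is an interval has at most one left border, at its smallest element. This turns the
quantified condition into the single comparison that the program makes. -/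
theorem sepLeft_iff {α : ℤ → ℤ} {t : ℤ} (h1 : 1 ≤ t) (hn : t ≤ n) :
    SepLeft n α ρ t ↔ (2 ≤ lo (ρ t) → α (lo (ρ t) - 1) ≠ α (lo (ρ t))) := by
  have e1 := h.mem_interval h1 hn
  have e2 := h.ends_mem t h1 hn
  have e3 := h.root_lo h1 hn
  constructor
  · intro hs hl
    have e4 := (h.interval t h1 hn (lo (ρ t) - 1) (by omega) (by omega)).1
    have := hs (lo (ρ t) - 1) (by omega) (by omega)
    rw [sub_add_cancel] at this
    exact this (fun he => by have := e4 (he.trans e3); omega) e3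
  · intro hs s s1 sn sne seq
    have e4 := (h.interval t h1 hn (s + 1) (by omega) sn).1 seq
    have e5 := (h.interval t h1 hn s s1 (by omega)).2
    have hlt : ¬ lo (ρ t) ≤ s := fun hc => sne ((e5 ⟨hc, by omega⟩).trans seq.symm)
    have : lo (ρ t) = s + 1 := by omega
    have := hs (by omega)
    rwa [‹lo (ρ t) = s + 1›, add_sub_cancel_right] at this

theorem sepRight_iff {β : ℤ → ℤ} {t : ℤ} (h1 : 1 ≤ t) (hn : t ≤ n) :
    SepRight n β ρ t ↔ (hi (ρ t) + 1 ≤ n → β (hi (ρ t)) ≠ β (hi (ρ t) + 1)) := by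
  have e1 := h.mem_interval h1 hn
  have e2 := h.ends_mem t h1 hn
  have e3 := h.root_hi h1 hn
  constructor
  · intro hs hl
    have e4 := (h.interval t h1 hn (hi (ρ t) + 1) (by omega) (by omega)).1
    exact hs (hi (ρ t)) (by omega) hl
      (fun he => by have := e4 (he.symm.trans e3); omega) e3
  · intro hs s s1 sn sne seq
    have e4 := (h.interval t h1 hn s s1 (by omega)).1 seq
    have e5 := (h.interval t h1 hn (s + 1) (by omega) sn).2
    have hlt : ¬ s + 1 ≤ hi (ρ t) := fun hc => sne (seq.trans (e5 ⟨by omega, hc⟩).symm)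
    have : hi (ρ t) = s := by omega
    rw [this] at hs
    exact hs sn

/-- A function which is constant along all borders inside of sets is constant on the sets. -/
theorem eq_of_root_eq {β : Type*} {f : ℤ → β}
    (hf : ∀ i, 1 ≤ i → i + 1 ≤ n → ρ i = ρ (i + 1) → f i = f (i + 1)) {t u : ℤ}
    (ht1 : 1 ≤ t) (htn : t ≤ n) (hu1 : 1 ≤ u) (hun : u ≤ n) (he : ρ t = ρ u) : f t = f u := by
  wlog htu : t ≤ u generalizing t u
  · exact (this hu1 hun ht1 htn he.symm (by omega)).symm
  obtain ⟨k, rfl⟩ : ∃ k : ℕ, u = t + k := ⟨(u - t).toNat, by omega⟩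
  induction k with
  | zero => simp
  | succ k ih =>
    push_cast at *
    have e1 := h.root_eq_of_between ht1 hun (u := t + k) (by omega) (by omega) he
    have e2 := ih (by omega) (by omega) (he.trans e1.symm) (by omega)
    rw [e2, hf (t + k) (by omega) (by omega) (by rw [e1, add_assoc]), add_assoc]

end Forest

/-! ## The update of the structures -/

/-- `m'` holds disjoint-set forests with the roots `ρ'` and the differences `δ`. Apart from that,
only the registers in `R` differ from `m`. -/
structure Becomes (N : ℤ) (ρ' : Dsu → ℤ → ℤ) (R : List Reg) (δ : ℤ → ℤ) (m m' : Mem) : Prop where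
  holds : Holds N ρ' m'
  reg : ∀ w, w ∉ R → m'.reg w = m.reg w
  arr : ∀ a, a ∈ [Arr.inA, .inB, .order, .out] → m'.arr a = m.arr a
  diff : m'.arr .diff = δ

theorem Becomes.trans {N : ℤ} {ρ ρ' : Dsu → ℤ → ℤ} {R R' : List Reg} {δ δ' : ℤ → ℤ} {m m' m'' : Mem}
    (h : Becomes N ρ R δ m m') (h' : Becomes N ρ' R' δ' m' m'') :
    Becomes N ρ' (R ++ R') δ' m m'' where
  holds := h'.holds
  reg w hw := by
    rw [List.mem_append, not_or] at hw
    rw [h'.reg w hw.2, h.reg w hw.1]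
  arr a ha := by rw [h'.arr a ha, h.arr a ha]
  diff := h'.diff

theorem Becomes.subset {N : ℤ} {ρ : Dsu → ℤ → ℤ} {R R' : List Reg} {δ : ℤ → ℤ} {m m' : Mem}
    (h : Becomes N ρ R δ m m') (hR : R ⊆ R') : Becomes N ρ R' δ m m' :=
  ⟨h.holds, fun w hw => h.reg w fun hR' => hw (hR hR'), h.arr, h.diff⟩

theorem Compressed.becomes {N : ℤ} {ρ : Dsu → ℤ → ℤ} {R : List Reg} {m m' : Mem}
    (h : Compressed N ρ R m m') : Becomes N ρ R (m.arr .diff) m m' :=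
  ⟨h.holds, h.reg, fun a ha => h.arr a (by rintro s rfl; simp at ha), h.arr _ (by simp)⟩

theorem United.becomes {N : ℤ} {ρ : Dsu → ℤ → ℤ} {s : Dsu} {x c : ℤ} {m m' : Mem}
    (h : United N ρ s x c m m') :
    Becomes N (Function.update ρ s (mergeRoot (ρ s) (ρ s x) (ρ s (x + 1)) c))
      [.cur, .nxt, .r₁, .r₂, .root, .mn, .mx] (m.arr .diff) m m' :=
  ⟨h.holds, h.reg, fun a ha => h.arr a (by rintro s rfl; simp at ha) (by rintro rfl; simp at ha)
    (by rintro rfl; simp at ha) (by rintro rfl; simp at ha),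
    h.arr _ (by simp) (by simp) (by simp) (by simp)⟩

theorem Becomes.putDiff {N : ℤ} {ρ : Dsu → ℤ → ℤ} {m : Mem} (h : Holds N ρ m) (x z : ℤ) :
    Becomes N ρ [] (Function.update (m.arr .diff) x z) m (m.setArr .diff x z) := by
  refine ⟨h.of_arr_eq fun s => by simp, fun _ _ => rfl, fun a ha => ?_, by simp⟩
  have : a ≠ .diff := by rintro rfl; simp at ha
  simp [this]

theorem memPot_putDiff (κ : ℕ) (N : ℤ) (m : Mem) (x z : ℤ) :
    memPot κ N (m.setArr .diff x z) = memPot κ N m := memPot_of_arr_eq fun s => by simp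

theorem Holds.becomes {N : ℤ} {ρ : Dsu → ℤ → ℤ} {m : Mem} (h : Holds N ρ m) (R : List Reg) :
    Becomes N ρ R (m.arr .diff) m m := ⟨h, fun _ _ => rfl, fun _ _ => rfl, rfl⟩

section

variable {P : ℕ → ℝ} {κ : ℕ} {N : ℤ} {ρ : Dsu → ℤ → ℤ}

/-- Common to the two tests at the ends of a B-A-set; `flag` can only be reset, so the two tests
combine to a conjunction. -/
theorem runs_compare (hκ : N + 1 ≤ fastGrow κ 1) {s : Dsu} {e f : Expr} {m : Mem} (h : Holds N ρ m)
    {x y : ℤ} (he : e.eval m = x)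
    (hf : ∀ m' : Mem, (∀ w, w ∉ [Reg.cur, .nxt, .p] → m'.reg w = m.reg w) → f.eval m' = y)
    (hx1 : 1 ≤ x) (hxn : x ≤ s.size N) (hy1 : 1 ≤ y) (hyn : y ≤ s.size N) :
    Runs P (Prog.block [Prog.find s e .p, Prog.find s f .q,
      Prog.ifThen (.eq (.reg .p) (.reg .q)) (.assign .flag (.lit 0))]) m fun m' n =>
      Compressed N ρ [.cur, .nxt, .p, .q, .flag] m m' ∧
      m'.reg .flag = (if ρ s x = ρ s y then 0 else m.reg .flag) ∧
      n + 23 * memPot κ N m' ≤ 23 * memPot κ N m + (46 * κ + 90 + e.steps + f.steps) := by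
  simp only [Prog.block]
  refine (runs_find hκ (by simp) (by simp) h he hx1 hxn).seq ?_
  rintro m1 n1 ⟨c1, v1, k1⟩
  refine (runs_find hκ (by simp) (by simp) c1.holds (hf m1 c1.reg) hy1 hyn).seq ?_
  rintro m2 n2 ⟨c2, v2, k2⟩
  have hp : m2.reg .p = ρ s x := by rw [c2.reg _ (by simp), v1]
  have hflag : m2.reg .flag = m.reg .flag := by rw [c2.reg _ (by simp), c1.reg _ (by simp)]
  have c12 := c1.trans c2
  rw [runs_seq]
  by_cases heq : ρ s x = ρ s y
  · rw [runs_ifThen_true (by simpa [Test.Holds, Expr.eval, hp, v2] using heq), runs_assign, runs_skip]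
    refine ⟨(c12.trans (Compressed.setReg c12.holds _ _)).subset (by simp), by simp [heq, Expr.eval], ?_⟩
    rw [memPot_setReg]
    simp only [Expr.steps, Test.steps]
    omega
  · rw [runs_ifThen_false (by simpa [Test.Holds, Expr.eval, hp, v2] using heq), runs_skip]
    refine ⟨c12.subset (by simp), by simp [heq, hflag], ?_⟩
    simp only [Expr.steps, Test.steps]
    omega

open Classical in
theorem runs_testLocalMin (hκ : N + 1 ≤ fastGrow κ 1) {v : Reg}
    (hv : v ∉ [Reg.cur, .nxt, .p, .q, .mn, .mx, .flag]) {m : Mem} (h : Holds N ρ m)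
    (hT : m.reg .T = N) {t : ℤ} (h1 : 1 ≤ t) (hN : t ≤ N) (hr : m.reg v = ρ .byBA t) :
    Runs P (Prog.testLocalMin v) m fun m' n =>
      Compressed N ρ [.cur, .nxt, .p, .q, .mn, .mx, .flag] m m' ∧
      m'.reg .flag = (if SepLeft N (ρ .byA) (ρ .byBA) t ∧ SepRight N (ρ .byB) (ρ .byBA) t
        then 1 else 0) ∧
      n + 23 * memPot κ N m' ≤ 23 * memPot κ N m + (92 * κ + 230) := by
  simp only [List.mem_cons, List.not_mem_nil, or_false, not_or] at hv
  have e1 := (h .byBA).mem_interval h1 hN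
  have e2 := (h .byBA).ends_mem t h1 hN
  simp only [Dsu.size] at e2
  unfold Prog.testLocalMin
  simp only [Prog.block]
  rw [runs_seq, runs_assign, runs_seq, runs_assign, runs_seq, runs_assign]
  set lo := m.arr (.lo .byBA) (ρ .byBA t) with hlo
  set hi := m.arr (.hi .byBA) (ρ .byBA t) with hhi
  have hL : SepLeft N (ρ .byA) (ρ .byBA) t ↔ _ := (h .byBA).sepLeft_iff (α := ρ .byA) h1 hN
  have hR : SepRight N (ρ .byB) (ρ .byBA) t ↔ _ := (h .byBA).sepRight_iff (β := ρ .byB) h1 hN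
  simp only [Dsu.size] at hR
  rw [← hlo] at hL
  rw [← hhi] at hR
  set m1 : Mem := ((m.setReg .mn lo).setReg .mx hi).setReg .flag 1 with hm1
  have em1 : ((m.setReg .mn (Expr.eval m (.get (.lo .byBA) (.reg v)))).setReg .mx
      (Expr.eval (m.setReg .mn (Expr.eval m (.get (.lo .byBA) (.reg v))))
        (.get (.hi .byBA) (.reg v)))).setReg .flag
      (Expr.eval ((m.setReg .mn (Expr.eval m (.get (.lo .byBA) (.reg v)))).setReg .mx
      (Expr.eval (m.setReg .mn (Expr.eval m (.get (.lo .byBA) (.reg v))))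
        (.get (.hi .byBA) (.reg v)))) Prog.one) = m1 := by
    simp [Expr.eval, hr, hv, hm1, hlo, hhi, Prog.one]
  rw [em1]
  have hc1 : Compressed N ρ [.mn, .mx, .flag] m m1 := by
    refine ⟨h, fun w hw => ?_, fun a _ => rfl⟩
    simp only [List.mem_cons, List.not_mem_nil, or_false, not_or] at hw
    simp [hm1, hw]
  have hmn1 : m1.reg .mn = lo := by simp [hm1]
  have hmx1 : m1.reg .mx = hi := by simp [hm1]
  have hT1 : m1.reg .T = N := by simp [hm1, hT]
  have hf1 : m1.reg .flag = 1 := by simp [hm1]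
  have hpot1 : memPot κ N m1 = memPot κ N m := rfl
  refine Runs.seq (Q' := fun m' n => Compressed N ρ [.cur, .nxt, .p, .q, .flag] m1 m' ∧
    m'.reg .flag = (if SepLeft N (ρ .byA) (ρ .byBA) t then 1 else 0) ∧
    n + 23 * memPot κ N m' ≤ 23 * memPot κ N m1 + (46 * κ + 100)) ?_ ?_
  · by_cases hl : 2 ≤ lo
    · rw [runs_ifThen_true (by simpa [Test.Holds, Expr.eval, hmn1] using hl)]
      refine (runs_compare hκ hc1.holds (x := lo - 1) (y := lo) (by simp [Expr.eval, hmn1, Prog.one])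
        (fun m' hm' => by simp [Expr.eval, hm', hmn1]) (by omega) (by simp only [Dsu.size]; omega)
        (by omega) (by simp only [Dsu.size]; omega)).mono ?_
      rintro m' n ⟨c, hf, k⟩
      refine ⟨c, ?_, ?_⟩
      · rw [hf, hf1]
        by_cases hs : ρ .byA (lo - 1) = ρ .byA lo
        · rw [if_pos hs, if_neg]
          rw [hL]
          exact fun hs' => hs' hl hs
        · rw [if_neg hs, if_pos]
          rw [hL]
          exact fun _ => hs
      · simp only [Expr.steps, Test.steps, Prog.one] at k ⊢
        omega
    · rw [runs_ifThen_false (by simpa [Test.Holds, Expr.eval, hmn1] using hl)]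
      refine ⟨⟨hc1.holds, fun _ _ => rfl, fun _ _ => rfl⟩, ?_, ?_⟩
      · rw [hf1, if_pos]
        rw [hL]
        exact fun hl' => absurd hl' hl
      · simp only [Expr.steps, Test.steps]
        omega
  · rintro m2 n2 ⟨c2, f2, k2⟩
    have hmx2 : m2.reg .mx = hi := by rw [c2.reg _ (by simp), hmx1]
    have hT2 : m2.reg .T = N := by rw [c2.reg _ (by simp), hT1]
    have c12 := hc1.trans c2
    rw [runs_seq]
    by_cases hl : hi + 1 ≤ N
    · rw [runs_ifThen_true (by simpa [Test.Holds, Expr.eval, hmx2, hT2, Prog.one] using hl)]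
      refine (runs_compare hκ c2.holds (x := hi) (y := hi + 1) (by simp [Expr.eval, hmx2])
        (fun m' hm' => by simp [Expr.eval, hm', hmx2, Prog.one]) (by omega) (by simp only [Dsu.size]; omega)
        (by omega) (by simp only [Dsu.size]; omega)).mono ?_
      rintro m' n ⟨c, hf, k⟩
      rw [runs_skip]
      refine ⟨(c12.trans c).subset (by simp), ?_, ?_⟩
      · rw [hf, f2]
        by_cases hs : ρ .byB hi = ρ .byB (hi + 1)
        · rw [if_pos hs, if_neg]
          rintro ⟨_, hs'⟩
          exact hR.1 hs' hl hs
        · rw [if_neg hs]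
          have : SepRight N (ρ .byB) (ρ .byBA) t := hR.2 fun _ => hs
          simp only [this, and_true]
      · simp only [Expr.steps, Test.steps, Prog.one] at k ⊢
        omega
    · rw [runs_ifThen_false (by simpa [Test.Holds, Expr.eval, hmx2, hT2, Prog.one] using hl), runs_skip]
      refine ⟨c12.subset (by simp), ?_, ?_⟩
      · rw [f2]
        have : SepRight N (ρ .byB) (ρ .byBA) t := hR.2 fun hl' => absurd hl' hl
        simp only [this, and_true]
      · simp only [Expr.steps, Test.steps, Prog.one] at k2 ⊢
        omega

open Classical in
theorem runs_storeDiff (hκ : N + 1 ≤ fastGrow κ 1) {v : Reg}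
    (hv : v ∉ [Reg.cur, .nxt, .p, .q, .mn, .mx, .flag]) {m : Mem} (h : Holds N ρ m)
    (hT : m.reg .T = N) {t : ℤ} (h1 : 1 ≤ t) (hN : t ≤ N) (hr : m.reg v = ρ .byBA t) :
    Runs P (Prog.storeDiff v) m fun m' n =>
      Becomes N ρ [.cur, .nxt, .p, .q, .mn, .mx, .flag]
        (Function.update (m.arr .diff) (ρ .byBA t)
          (if SepLeft N (ρ .byA) (ρ .byBA) t ∧ SepRight N (ρ .byB) (ρ .byBA) t then m.reg .d else -1))
        m m' ∧
      n + 23 * memPot κ N m' ≤ 23 * memPot κ N m + (92 * κ + 240) := by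
  unfold Prog.storeDiff
  simp only [Prog.block]
  refine (runs_testLocalMin hκ hv h hT h1 hN hr).seq ?_
  rintro m1 n1 ⟨c1, f1, k1⟩
  have hv1 : m1.reg v = ρ .byBA t := by rw [c1.reg v hv, hr]
  have hd1 : m1.reg .d = m.reg .d := c1.reg _ (by simp)
  rw [runs_seq]
  have hb := fun z => c1.becomes.trans (Becomes.putDiff c1.holds (ρ .byBA t) z)
  rw [c1.arr .diff (by simp)] at hb
  by_cases hs : SepLeft N (ρ .byA) (ρ .byBA) t ∧ SepRight N (ρ .byB) (ρ .byBA) t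
  · rw [if_pos hs] at f1 ⊢
    rw [runs_ite_true (by simp [Test.Holds, Expr.eval, f1, Prog.one]), runs_put, runs_skip]
    have e : m1.setArr .diff (Expr.eval m1 (.reg v)) (Expr.eval m1 (.reg .d)) =
        m1.setArr .diff (ρ .byBA t) (m.reg .d) := by simp [Expr.eval, hv1, hd1]
    rw [e]
    refine ⟨(hb _).subset (by simp), ?_⟩
    rw [memPot_putDiff]
    simp only [Expr.steps, Test.steps, Prog.one]
    omega
  · rw [if_neg hs] at f1 ⊢
    rw [runs_ite_false (by simp [Test.Holds, Expr.eval, f1, Prog.one]), runs_put, runs_skip]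
    have e : m1.setArr .diff (Expr.eval m1 (.reg v)) (Expr.eval m1 (.lit (-1))) =
        m1.setArr .diff (ρ .byBA t) (-1) := by simp [Expr.eval, hv1]
    rw [e]
    refine ⟨(hb _).subset (by simp), ?_⟩
    rw [memPot_putDiff]
    simp only [Expr.steps, Test.steps, Prog.one]
    omega

end

theorem StoresMin.congr_adj {N : ℤ} {α β α' β' γ D δ : ℤ → ℤ} (h : StoresMin N α β γ D δ)
    (hα : ∀ i, 1 ≤ i → i + 1 ≤ N → (α i = α (i + 1) ↔ α' i = α' (i + 1)))
    (hβ : ∀ i, 1 ≤ i → i + 1 ≤ N → (β i = β (i + 1) ↔ β' i = β' (i + 1))) :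
    StoresMin N α' β' γ D δ := by
  intro t h1 hN
  have hL : SepLeft N α γ t ↔ SepLeft N α' γ t :=
    SepLeft.congr (fun _ _ _ => Iff.rfl) (fun _ _ _ _ => Iff.rfl) fun s s1 sN _ _ => hα s s1 sN
  have hR : SepRight N β γ t ↔ SepRight N β' γ t :=
    SepRight.congr (fun _ _ _ => Iff.rfl) (fun _ _ _ _ => Iff.rfl) fun s s1 sN _ _ => hβ s s1 sN
  rw [h t h1 hN, hL, hR]

/-- Covers `t_A = T + 1` and `t_B = 1`, where there is no border to remove. -/
theorem Joins.of_le {N j : ℤ} {α : ℤ → ℤ} (h : j < 1 ∨ N ≤ j) : Joins N α j α := fun i h1 hN => by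
  have : i ≠ j := by omega
  tauto

theorem Joins.mono {N N' j : ℤ} {α α' : ℤ → ℤ} (h : Joins N α j α') (hN : N' ≤ N) :
    Joins N' α j α' := fun i h1 hi => h i h1 (by omega)

theorem Forest.joins {n : ℤ} {par rank lo hi ρ : ℤ → ℤ} (h : Forest n par rank lo hi ρ) {x c : ℤ}
    (h1 : 1 ≤ x) (hn : x + 1 ≤ n) (hne : ρ x ≠ ρ (x + 1)) (hc : c = ρ x ∨ c = ρ (x + 1)) :
    Joins n ρ x (mergeRoot ρ (ρ x) (ρ (x + 1)) c) := fun _ hi1 hin =>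
  h.mergeRoot_succ_eq_iff h1 hn hne hc hi1 hin

/-- The registers that the update of the structures may change. -/
def scratch : List Reg :=
  [.cur, .nxt, .p, .q, .tA, .tB, .set, .r₁, .r₂, .root, .mn, .mx, .d, .flag]

/-- Adapt the sets of `e` and `f` in the third structure after their classes in another partition
have been joined: either the two sets are united, and the difference of the set of `g` is kept, or
the difference of the set of `g` is deleted. -/
def adaptBA (s : Dsu) (e f g : Expr) : Cmd :=
  Prog.block [Prog.find s e .p, Prog.find s f .q, Prog.find .byBA g .set,
    .ite (.eq (.reg .p) (.reg .q))
      (Prog.block [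
        .assign .d (.get .diff (.reg .set)),
        Prog.unite .byBA e f,
        Prog.storeDiff .root])
      (.put .diff (.reg .set) (.lit (-1)))]

/-- The value of `e` depends only on the registers `t_A`, `t_B` and `T`, and is `z`. -/
def Evaluates (m : Mem) (e : Expr) (z : ℤ) : Prop :=
  e.steps ≤ 3 ∧ ∀ m' : Mem, (∀ w, w ∈ [Reg.tA, .tB, .T] → m'.reg w = m.reg w) → e.eval m' = z

section

variable {P : ℕ → ℝ} {κ : ℕ} {N : ℤ} {ρ : Dsu → ℤ → ℤ}

open Classical in
-- Whether the two neighbouring B-A-sets must be united is decided by the partition that was not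
-- joined at this border. The amortized cost consists of three finds, a union and a test for a local
-- minimum: 69 `κ` + 69 `κ` + 92 `κ`.
theorem runs_adaptBA (hκ : N + 1 ≤ fastGrow κ 1) {s : Dsu} (hs : s ≠ .byBA) {e f g : Expr} {m : Mem}
    (h : Holds N ρ m) (hT : m.reg .T = N) {x z : ℤ} (he : Evaluates m e x) (hf : Evaluates m f (x + 1))
    (hg : Evaluates m g z) (h1 : 1 ≤ x) (hN : x + 1 ≤ N) (hz1 : 1 ≤ z) (hzN : z ≤ N)
    (hne : ρ .byBA x ≠ ρ .byBA (x + 1)) :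
    Runs P (adaptBA s e f g) m fun m' n =>
      ((ρ s x = ρ s (x + 1) ∧ ∃ c, (c = ρ .byBA x ∨ c = ρ .byBA (x + 1)) ∧
        ∃ γ', γ' = mergeRoot (ρ .byBA) (ρ .byBA x) (ρ .byBA (x + 1)) c ∧
        Becomes N (Function.update ρ .byBA γ') scratch
          (Function.update (m.arr .diff) c
            (if SepLeft N (ρ .byA) γ' (x + 1) ∧ SepRight N (ρ .byB) γ' (x + 1) then
              m.arr .diff (ρ .byBA z) else -1)) m m') ∨
      (ρ s x ≠ ρ s (x + 1) ∧
        Becomes N ρ scratch (Function.update (m.arr .diff) (ρ .byBA z) (-1)) m m')) ∧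
      n + 23 * memPot κ N m' ≤ 23 * memPot κ N m + (230 * κ + 600) ∧
      ∀ w, w ∈ [Reg.tA, .tB, .T] → m'.reg w = m.reg w := by
  have hsz : N ≤ s.size N := by cases s <;> simp [Dsu.size]
  unfold adaptBA
  simp only [Prog.block]
  have stable : ∀ {R : List Reg} {m' : Mem}, (∀ w, w ∉ R → m'.reg w = m.reg w) →
      Reg.tA ∉ R → Reg.tB ∉ R → Reg.T ∉ R → ∀ w, w ∈ [Reg.tA, .tB, .T] → m'.reg w = m.reg w := by
    intro R m' hm a b c w hw
    simp only [List.mem_cons, List.not_mem_nil, or_false] at hw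
    rcases hw with rfl | rfl | rfl <;> exact hm _ (by assumption)
  refine (runs_find hκ (by simp) (by simp) h (he.2 m fun _ _ => rfl) h1 (by omega)).seq ?_
  rintro m1 n1 ⟨c1, v1, k1⟩
  refine (runs_find hκ (by simp) (by simp) c1.holds
    (hf.2 m1 (stable c1.reg (by simp) (by simp) (by simp))) (by omega) (by omega)).seq ?_
  rintro m2 n2 ⟨c2, v2, k2⟩
  have c12 := c1.trans c2
  refine (runs_find hκ (by simp) (by simp) c2.holds
    (hg.2 m2 (stable c12.reg (by simp) (by simp) (by simp))) hz1 (by simpa [Dsu.size] using hzN)).seq ?_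
  rintro m3 n3 ⟨c3, v3, k3⟩
  have c13 := c12.trans c3
  have hp : m3.reg .p = ρ s x := by rw [c3.reg _ (by simp), c2.reg _ (by simp), v1]
  have hq : m3.reg .q = ρ s (x + 1) := by rw [c3.reg _ (by simp), v2]
  have hdiff3 : m3.arr .diff = m.arr .diff := c13.arr _ (by simp)
  have hst := he.1
  have hst' := hf.1
  have hst'' := hg.1
  rw [runs_seq]
  by_cases heq : ρ s x = ρ s (x + 1)
  · rw [runs_ite_true (by simpa [Test.Holds, Expr.eval, hp, hq] using heq), runs_seq, runs_assign]
    have e3 : Expr.eval m3 (.get .diff (.reg .set)) = m.arr .diff (ρ .byBA z) := by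
      simp [Expr.eval, v3, hdiff3]
    rw [e3]
    have c4 := c13.trans (Compressed.setReg c3.holds .d (m.arr .diff (ρ .byBA z)))
    set m4 := m3.setReg .d (m.arr .diff (ρ .byBA z)) with hm4
    have hd4 : m4.reg .d = m.arr .diff (ρ .byBA z) := by simp [hm4]
    have hp4 : memPot κ N m4 = memPot κ N m3 := rfl
    have st4 := stable c4.reg (by simp) (by simp) (by simp)
    refine (runs_unite hκ c4.holds (he.2 m4 st4) (fun m' hm' => hf.2 m' fun w hw => ?_) h1
      (by simpa [Dsu.size] using hN) hne).seq ?_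
    · rw [← st4 w hw]
      simp only [List.mem_cons, List.not_mem_nil, or_false] at hw
      rcases hw with rfl | rfl | rfl <;> exact hm' _ (by simp)
    rintro m5 n5 ⟨⟨c, hu⟩, k5⟩
    have b5 := c4.becomes.trans hu.becomes
    have hd5 : m5.reg .d = m.arr .diff (ρ .byBA z) := by rw [hu.reg _ (by simp), hd4]
    have hT5 : m5.reg .T = N := by rw [b5.reg _ (by simp), hT]
    rw [runs_seq]
    refine (runs_storeDiff hκ (v := .root) (by simp) hu.holds hT5 (t := x + 1) (by omega) hN ?_).mono ?_
    · rw [hu.root, Function.update_self, mergeRoot_of_mem (Or.inr rfl)]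
    rintro m6 n6 ⟨b6, k6⟩
    rw [runs_skip, runs_skip]
    have b7 := b5.trans b6
    refine ⟨Or.inl ⟨heq, c, hu.root_or, _, rfl, ?_⟩, ?_,
      stable b7.reg (by simp) (by simp) (by simp)⟩
    · have := b7.subset (R' := scratch) (by simp [scratch])
      rw [hd5, b5.diff] at this
      simpa [mergeRoot_of_mem, c4.arr .diff] using this
    · simp only [Expr.steps, Test.steps]
      omega
  · rw [runs_ite_false (by simpa [Test.Holds, Expr.eval, hp, hq] using heq), runs_put, runs_skip]
    have e : m3.setArr .diff (Expr.eval m3 (.reg .set)) (Expr.eval m3 (.lit (-1))) =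
        m3.setArr .diff (ρ .byBA z) (-1) := by simp [Expr.eval, v3]
    rw [e]
    have b4 := c13.becomes.trans (Becomes.putDiff c3.holds (ρ .byBA z) (-1))
    refine ⟨Or.inr ⟨heq, ?_⟩, ?_, stable b4.reg (by simp) (by simp) (by simp)⟩
    · rw [hdiff3] at b4
      exact b4.subset (by simp [scratch])
    · rw [memPot_putDiff]
      simp only [Expr.steps, Test.steps]
      omega

/-- The part of the update which treats the B-A-sets of `t_B - 1` and `t_B`. -/
theorem runs_adapt_tB (hκ : N + 1 ≤ fastGrow κ 1) {m : Mem} (h : Holds N ρ m) (hT : m.reg .T = N)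
    {α β D : ℤ → ℤ} {j : ℤ} (htB : m.reg .tB = j + 1) (hj0 : 0 ≤ j) (hjN : j + 1 ≤ N)
    (hβ' : Joins N β j (ρ .byB)) (hβj : 1 ≤ j → β j ≠ β (j + 1))
    (hα : ∀ i, 1 ≤ i → i ≤ j → (α i = α (i + 1) ↔ ρ .byA i = ρ .byA (i + 1)))
    (hmeet : IsMeet N α β (ρ .byBA)) (hmin : StoresMin N α β (ρ .byBA) D (m.arr .diff))
    (hD : ∀ i, 1 ≤ i → i + 1 ≤ N → α i = α (i + 1) → ρ .byB i = ρ .byB (i + 1) → D i = D (i + 1)) :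
    Runs P (Prog.ifThen (.le (.lit 2) (.reg .tB)) (adaptBA .byA (.minus (.reg .tB) Prog.one) (.reg .tB)
      (.minus (.reg .tB) Prog.one))) m fun m' n =>
      (∃ γ' δ', Becomes N (Function.update ρ .byBA γ') scratch δ' m m' ∧
        IsMeet N α (ρ .byB) γ' ∧ StoresMin N α (ρ .byB) γ' D δ') ∧
      n + 23 * memPot κ N m' ≤ 23 * memPot κ N m + (230 * κ + 610) ∧
      ∀ w, w ∈ [Reg.tA, .tB, .T] → m'.reg w = m.reg w := by
  by_cases hj : 1 ≤ j
  · rw [runs_ifThen_true (by simp only [Test.Holds, Expr.eval, htB]; omega)]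
    have hne : ρ .byBA j ≠ ρ .byBA (j + 1) := fun he => hβj hj ((hmeet j hj hjN).1 he).2
    refine (runs_adaptBA (κ := κ) (x := j) (z := j) hκ (by simp) h hT
      ⟨by simp [Expr.steps, Prog.one], fun m' hm' => by simp [Expr.eval, hm', htB, Prog.one]⟩
      ⟨by simp [Expr.steps], fun m' hm' => by simp [Expr.eval, hm', htB]⟩
      ⟨by simp [Expr.steps, Prog.one], fun m' hm' => by simp [Expr.eval, hm', htB, Prog.one]⟩
      hj hjN hj (by omega) hne).mono ?_
    rintro m' n ⟨hor, hk, hreg⟩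
    refine ⟨?_, ?_, hreg⟩
    · rcases hor with ⟨heq, c, hc, γ', hγ', hb⟩ | ⟨hneq, hb⟩
      · have hjoin : Joins N (ρ .byBA) j γ' := hγ' ▸ (h .byBA).joins hj hjN hne hc
        have hαj := (hα j hj le_rfl).2 heq
        have hm' : IsMeet N α (ρ .byB) γ' := by
          intro i i1 iN
          rw [hjoin i i1 iN, hβ' i i1 iN, hmeet i i1 iN]
          constructor
          · rintro (⟨a, b⟩ | rfl)
            exacts [⟨a, Or.inl b⟩, ⟨hαj, Or.inr rfl⟩]
          · rintro ⟨a, b | b⟩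
            exacts [Or.inl ⟨a, b⟩, Or.inr b]
        refine ⟨γ', _, hb, hm', ?_⟩
        have hF := hb.holds .byBA
        rw [Function.update_self] at hF
        refine hmin.joinRight_merge hj hjN hβ' (hβj hj) hne hγ' hjoin hc (fun t t1 tN ht => ?_) ?_
        · refine hF.eq_of_root_eq (fun i i1 iN hi => ?_) t1 tN (by omega) hjN ht
          have := (hm' i i1 iN).1 hi
          exact hD i i1 iN this.1 this.2
        -- The first structure already reflects the join at `t_A`, whereas the invariant still
        -- refers to `α`. The left border of the united class lies before `j`, where the two agree.
        · have hL : SepLeft N (ρ .byA) γ' (j + 1) ↔ SepLeft N α γ' (j + 1) := by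
            refine SepLeft.congr (fun _ _ _ => Iff.rfl) (fun _ _ _ _ => Iff.rfl)
              fun s s1 sN sne seq => (hα s s1 ?_).symm
            by_contra hlt
            have e1 : γ' (j + 1) = γ' j := ((hjoin j hj hjN).2 (Or.inr rfl)).symm
            exact sne ((hF.root_eq_of_between (t := j) hj sN (by omega : j ≤ s) (by omega)
              (by rw [← e1, seq])))
          rw [hL]
      · refine ⟨ρ .byBA, _, ?_, ?_, hmin.joinRight hj hjN hβ' hne fun he => hneq ((hα j hj le_rfl).1 he)⟩
        · rw [Function.update_eq_self]; exact hb
        · intro i i1 iN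
          rw [hβ' i i1 iN, hmeet i i1 iN]
          constructor
          · exact fun ⟨a, b⟩ => ⟨a, Or.inl b⟩
          · rintro ⟨a, b | rfl⟩
            · exact ⟨a, b⟩
            · exact absurd ((hα i hj le_rfl).1 a) hneq
    · simp only [Test.steps, Expr.steps] at hk ⊢
      omega
  · rw [runs_ifThen_false (by simp only [Test.Holds, Expr.eval, htB]; omega)]
    have hadj : ∀ i, 1 ≤ i → i + 1 ≤ N → (β i = β (i + 1) ↔ ρ .byB i = ρ .byB (i + 1)) := by
      intro i i1 iN
      rw [hβ' i i1 iN]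
      have : i ≠ j := by omega
      tauto
    refine ⟨⟨ρ .byBA, _, ?_, ?_, hmin.congr_adj (fun _ _ _ => Iff.rfl) hadj⟩, ?_, fun _ _ => rfl⟩
    · rw [Function.update_eq_self]; exact h.becomes _
    · intro i i1 iN
      rw [hmeet i i1 iN, hadj i i1 iN]
    · simp only [Test.steps, Expr.steps]
      omega

/-- The part of the update which treats the B-A-sets of `t_A` and `t_A + 1`. -/
theorem runs_adapt_tA (hκ : N + 1 ≤ fastGrow κ 1) {m : Mem} (h : Holds N ρ m) (hT : m.reg .T = N)
    {α D : ℤ → ℤ} {j : ℤ} (htA : m.reg .tA = j) (hj : 1 ≤ j)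
    (hα' : Joins N α j (ρ .byA)) (hαj : j + 1 ≤ N → α j ≠ α (j + 1))
    (hmeet : IsMeet N α (ρ .byB) (ρ .byBA)) (hmin : StoresMin N α (ρ .byB) (ρ .byBA) D (m.arr .diff))
    (hD : ∀ i, 1 ≤ i → i + 1 ≤ N → ρ .byA i = ρ .byA (i + 1) → ρ .byB i = ρ .byB (i + 1) →
      D i = D (i + 1)) :
    Runs P (Prog.ifThen (.le (.plus (.reg .tA) Prog.one) (.reg .T)) (adaptBA .byB (.reg .tA)
      (.plus (.reg .tA) Prog.one) (.plus (.reg .tA) Prog.one))) m fun m' n =>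
      (∃ γ' δ', Becomes N (Function.update ρ .byBA γ') scratch δ' m m' ∧
        IsMeet N (ρ .byA) (ρ .byB) γ' ∧ StoresMin N (ρ .byA) (ρ .byB) γ' D δ') ∧
      n + 23 * memPot κ N m' ≤ 23 * memPot κ N m + (230 * κ + 610) := by
  by_cases hjN : j + 1 ≤ N
  · rw [runs_ifThen_true (by simp only [Test.Holds, Expr.eval, htA, hT, Prog.one]; omega)]
    have hne : ρ .byBA j ≠ ρ .byBA (j + 1) := fun he => hαj hjN ((hmeet j hj hjN).1 he).1
    refine (runs_adaptBA (κ := κ) (x := j) (z := j + 1) hκ (by simp) h hT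
      ⟨by simp [Expr.steps], fun m' hm' => by simp [Expr.eval, hm', htA]⟩
      ⟨by simp [Expr.steps, Prog.one], fun m' hm' => by simp [Expr.eval, hm', htA, Prog.one]⟩
      ⟨by simp [Expr.steps, Prog.one], fun m' hm' => by simp [Expr.eval, hm', htA, Prog.one]⟩
      hj hjN (by omega) hjN hne).mono ?_
    rintro m' n ⟨hor, hk, hreg⟩
    refine ⟨?_, ?_⟩
    · rcases hor with ⟨heq, c, hc, γ', hγ', hb⟩ | ⟨hneq, hb⟩
      · have hjoin : Joins N (ρ .byBA) j γ' := hγ' ▸ (h .byBA).joins hj hjN hne hc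
        have hm' : IsMeet N (ρ .byA) (ρ .byB) γ' := by
          intro i i1 iN
          rw [hjoin i i1 iN, hα' i i1 iN, hmeet i i1 iN]
          constructor
          · rintro (⟨a, b⟩ | rfl)
            exacts [⟨Or.inl a, b⟩, ⟨Or.inr rfl, heq⟩]
          · rintro ⟨a | a, b⟩
            exacts [Or.inl ⟨a, b⟩, Or.inr a]
        refine ⟨γ', _, hb, hm', ?_⟩
        have hF := hb.holds .byBA
        rw [Function.update_self] at hF
        refine hmin.joinLeft_merge hj hjN hα' (hαj hjN) hne hγ' hjoin hc (fun t t1 tN ht => ?_) rfl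
        refine hF.eq_of_root_eq (fun i i1 iN hi => ?_) t1 tN (by omega) hjN ht
        have := (hm' i i1 iN).1 hi
        exact hD i i1 iN this.1 this.2
      · refine ⟨ρ .byBA, _, ?_, ?_, hmin.joinLeft hj hjN hα' hne hneq⟩
        · rw [Function.update_eq_self]; exact hb
        · intro i i1 iN
          rw [hα' i i1 iN, hmeet i i1 iN]
          constructor
          · exact fun ⟨a, b⟩ => ⟨Or.inl a, b⟩
          · rintro ⟨a | rfl, b⟩
            · exact ⟨a, b⟩
            · exact absurd b hneq
    · simp only [Test.steps, Expr.steps, Prog.one] at hk ⊢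
      omega
  · rw [runs_ifThen_false (by simp only [Test.Holds, Expr.eval, htA, hT, Prog.one]; omega)]
    have hadj : ∀ i, 1 ≤ i → i + 1 ≤ N → (α i = α (i + 1) ↔ ρ .byA i = ρ .byA (i + 1)) := by
      intro i i1 iN
      rw [hα' i i1 iN]
      have : i ≠ j := by omega
      tauto
    refine ⟨⟨ρ .byBA, _, ?_, ?_, hmin.congr_adj hadj (fun _ _ _ => Iff.rfl)⟩, ?_⟩
    · rw [Function.update_eq_self]; exact h.becomes _
    · intro i i1 iN
      rw [hmeet i i1 iN, hadj i i1 iN]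
    · simp only [Test.steps, Expr.steps, Prog.one]
      omega

end

open Classical in
/-- If the values of `D` decrease by one from the beginning of the class of `t` with respect to `β`
to the end of its class with respect to `α`, then only the value stored for the class of `t` with
respect to `γ` has to be adapted. -/
theorem StoresMin.decrement {N : ℤ} {α β γ D D' δ : ℤ → ℤ} {pA rA lA hA pB rB lB hB pC rC lC hC : ℤ → ℤ}
    (fA : Forest (N + 1) pA rA lA hA α) (fB : Forest N pB rB lB hB β) (fC : Forest N pC rC lC hC γ)
    (hmeet : IsMeet N α β γ) (hmin : StoresMin N α β γ D δ)
    (hpos : ∀ u, 1 ≤ u → u ≤ N → SepLeft N α γ u → SepRight N β γ u → 0 ≤ D u)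
    {t : ℤ} (h1 : 1 ≤ t) (hN : t ≤ N)
    (hin : ∀ u, 1 ≤ u → u ≤ N → lB (β t) ≤ u → u ≤ hA (α t) → D' u = D u - 1)
    (hout : ∀ u, 1 ≤ u → u ≤ N → (u < lB (β t) ∨ hA (α t) < u) → D' u = D u) :
    StoresMin N α β γ D' (if 0 ≤ δ (γ t) then Function.update δ (γ t) (δ (γ t) - 1) else δ) := by
  have eA := fA.mem_interval h1 (by omega)
  have eB := fB.mem_interval h1 hN
  intro u hu1 huN
  have hval := hmin u hu1 huN
  by_cases hut : γ u = γ t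
  · have hα : α u = α t := fC.eq_of_root_eq (f := α)
      (fun i i1 iN hi => ((hmeet i i1 iN).1 hi).1) hu1 huN h1 hN hut
    have hβ : β u = β t := fC.eq_of_root_eq (f := β)
      (fun i i1 iN hi => ((hmeet i i1 iN).1 hi).2) hu1 huN h1 hN hut
    have e1 := (fA.interval t h1 (by omega) u hu1 (by omega)).1 hα
    have e2 := (fB.interval t h1 hN u hu1 huN).1 hβ
    have e3 := hin u hu1 huN e2.1 e1.2
    rw [hut] at hval ⊢
    by_cases hs : SepLeft N α γ u ∧ SepRight N β γ u
    · rw [if_pos hs] at hval ⊢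
      -- True differences are nonnegative, so the sign tells a stored difference from the marker
      -- `-1`.
      have := hpos u hu1 huN hs.1 hs.2
      rw [if_pos (by omega), Function.update_self]
      omega
    · rw [if_neg hs] at hval ⊢
      rw [if_neg (by omega)]
      exact hval
  · have hval' : (if 0 ≤ δ (γ t) then Function.update δ (γ t) (δ (γ t) - 1) else δ) (γ u) = δ (γ u) := by
      split_ifs
      · rw [Function.update_of_ne hut]
      · rfl
    rw [hval', hval]
    by_cases hs : SepLeft N α γ u ∧ SepRight N β γ u
    · rw [if_pos hs, if_pos hs]
      symm
      apply hout u hu1 huN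
      -- Suppose another local minimum meets the range where the difference falls. If it lies left
      -- of `t`, its right end and the next interval are in the class of `t` by `β`, so `β` does not
      -- separate there; if it lies right of `t`, the same happens with `α` at its left end.
      by_contra hno
      push Not at hno
      have eC := fC.mem_interval hu1 huN
      have nC := (fC.interval u hu1 huN t h1 hN).not.1 (Ne.symm hut)
      have hends := fC.ends_mem u hu1 huN
      rcases lt_or_ge u t with hlt | hge
      · have hβ : β u = β t := (fB.interval t h1 hN u hu1 huN).2 ⟨hno.1, by omega⟩
        have := (fC.sepRight_iff hu1 huN).1 hs.2 (by omega)
        refine this ?_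
        rw [fB.root_eq_of_between hu1 hN eC.2 (by omega) hβ,
          fB.root_eq_of_between hu1 hN (u := hC (γ u) + 1) (by omega) (by omega) hβ]
      · have hα : α t = α u := ((fA.interval t h1 (by omega) u hu1 (by omega)).2 ⟨by omega, hno.2⟩).symm
        have := (fC.sepLeft_iff hu1 huN).1 hs.1 (by omega)
        refine this ?_
        rw [fA.root_eq_of_between h1 (by omega : u ≤ N + 1) (by omega) (by omega) hα,
          fA.root_eq_of_between h1 (by omega : u ≤ N + 1) (by omega) eC.1 hα]
    · rw [if_neg hs, if_neg hs]

theorem Prog.update_eq : Prog.update = Prog.block [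
    Prog.find .byA (.reg .t) .p,
    .assign .tA (.get (.hi .byA) (.reg .p)),
    Prog.find .byB (.reg .t) .q,
    .assign .tB (.get (.lo .byB) (.reg .q)),
    Prog.find .byBA (.reg .t) .set,
    Prog.ifThen (.le (.lit 0) (.get .diff (.reg .set)))
      (.put .diff (.reg .set) (.minus (.get .diff (.reg .set)) Prog.one)),
    Prog.ifThen (.le (.reg .tA) (.reg .T)) (Prog.unite .byA (.reg .tA) (.plus (.reg .tA) Prog.one)),
    Prog.ifThen (.le (.lit 2) (.reg .tB)) (Prog.unite .byB (.minus (.reg .tB) Prog.one) (.reg .tB)),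
    Prog.ifThen (.le (.lit 2) (.reg .tB)) (adaptBA .byA (.minus (.reg .tB) Prog.one) (.reg .tB)
      (.minus (.reg .tB) Prog.one)),
    Prog.ifThen (.le (.plus (.reg .tA) Prog.one) (.reg .T)) (adaptBA .byB (.reg .tA)
      (.plus (.reg .tA) Prog.one) (.plus (.reg .tA) Prog.one))] := rfl

section

variable {P : ℕ → ℝ} {κ : ℕ} {N : ℤ} {ρ : Dsu → ℤ → ℤ}

theorem runs_unite_tA (hκ : N + 1 ≤ fastGrow κ 1) {m : Mem} (h : Holds N ρ m) (hT : m.reg .T = N)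
    {j : ℤ} (htA : m.reg .tA = j) (hj : 1 ≤ j) (hne : j ≤ N → ρ .byA j ≠ ρ .byA (j + 1)) :
    Runs P (Prog.ifThen (.le (.reg .tA) (.reg .T))
      (Prog.unite .byA (.reg .tA) (.plus (.reg .tA) Prog.one))) m fun m' n =>
      (∃ α', Joins (N + 1) (ρ .byA) j α' ∧ Becomes N (Function.update ρ .byA α')
        [.cur, .nxt, .r₁, .r₂, .root, .mn, .mx] (m.arr .diff) m m') ∧
      n + 23 * memPot κ N m' ≤ 23 * memPot κ N m + (69 * κ + 140) := by
  by_cases hjN : j ≤ N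
  · rw [runs_ifThen_true (by simpa [Test.Holds, Expr.eval, htA, hT] using hjN)]
    refine (runs_unite hκ h (x := j) (by simpa [Expr.eval] using htA)
      (fun m' hm' => by simp [Expr.eval, hm', htA, Prog.one]) hj (by simpa [Dsu.size] using hjN)
      (hne hjN)).mono ?_
    rintro m' n ⟨⟨c, hu⟩, hk⟩
    refine ⟨⟨_, (h .byA).joins hj (by simpa [Dsu.size] using hjN) (hne hjN) hu.root_or, hu.becomes⟩, ?_⟩
    simp only [Expr.steps, Test.steps, Prog.one] at hk ⊢
    omega
  · rw [runs_ifThen_false (by simpa [Test.Holds, Expr.eval, htA, hT] using hjN)]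
    refine ⟨⟨ρ .byA, Joins.of_le (by omega), ?_⟩, ?_⟩
    · rw [Function.update_eq_self]; exact h.becomes _
    · simp only [Expr.steps, Test.steps]
      omega

theorem runs_unite_tB (hκ : N + 1 ≤ fastGrow κ 1) {m : Mem} (h : Holds N ρ m)
    {j : ℤ} (htB : m.reg .tB = j + 1) (hjN : j + 1 ≤ N) (hne : 1 ≤ j → ρ .byB j ≠ ρ .byB (j + 1)) :
    Runs P (Prog.ifThen (.le (.lit 2) (.reg .tB))
      (Prog.unite .byB (.minus (.reg .tB) Prog.one) (.reg .tB))) m fun m' n =>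
      (∃ β', Joins N (ρ .byB) j β' ∧ Becomes N (Function.update ρ .byB β')
        [.cur, .nxt, .r₁, .r₂, .root, .mn, .mx] (m.arr .diff) m m') ∧
      n + 23 * memPot κ N m' ≤ 23 * memPot κ N m + (69 * κ + 140) := by
  by_cases hj : 1 ≤ j
  · rw [runs_ifThen_true (by simp only [Test.Holds, Expr.eval, htB]; omega)]
    refine (runs_unite hκ h (x := j) (by simp [Expr.eval, htB, Prog.one])
      (fun m' hm' => by simp [Expr.eval, hm', htB]) hj (by simpa [Dsu.size] using hjN)
      (hne hj)).mono ?_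
    rintro m' n ⟨⟨c, hu⟩, hk⟩
    refine ⟨⟨_, (h .byB).joins hj (by simpa [Dsu.size] using hjN) (hne hj) hu.root_or, hu.becomes⟩, ?_⟩
    simp only [Expr.steps, Test.steps, Prog.one] at hk ⊢
    omega
  · rw [runs_ifThen_false (by simp only [Test.Holds, Expr.eval, htB]; omega)]
    refine ⟨⟨ρ .byB, Joins.of_le (by omega), ?_⟩, ?_⟩
    · rw [Function.update_eq_self]; exact h.becomes _
    · simp only [Expr.steps, Test.steps]
      omega

/-- The bounds enter only through `D`, `D'` and the borders `a` and `b - 1`. The hypothesis `hD`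
says that `D'` does not change across an inner border of the new B-A-sets. Amortized, three finds,
two unions and two adaptations cost 667 `κ`. -/
theorem runs_update (hκ : N + 1 ≤ fastGrow κ 1) {m : Mem} (h : Holds N ρ m) (hT : m.reg .T = N)
    {t : ℤ} (ht : m.reg .t = t) (h1 : 1 ≤ t) (hN : t ≤ N)
    (hmeet : IsMeet N (ρ .byA) (ρ .byB) (ρ .byBA)) {D D' : ℤ → ℤ}
    (hmin : StoresMin N (ρ .byA) (ρ .byB) (ρ .byBA) D (m.arr .diff))
    (hpos : ∀ u, 1 ≤ u → u ≤ N → SepLeft N (ρ .byA) (ρ .byBA) u → SepRight N (ρ .byB) (ρ .byBA) u →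
      0 ≤ D u)
    {a b : ℤ} (ha : m.arr (.hi .byA) (ρ .byA t) = a) (hb : m.arr (.lo .byB) (ρ .byB t) = b)
    (hin : ∀ u, 1 ≤ u → u ≤ N → b ≤ u → u ≤ a → D' u = D u - 1)
    (hout : ∀ u, 1 ≤ u → u ≤ N → (u < b ∨ a < u) → D' u = D u)
    (hD : ∀ i, 1 ≤ i → i + 1 ≤ N → (ρ .byA i = ρ .byA (i + 1) ∨ i = a) →
      (ρ .byB i = ρ .byB (i + 1) ∨ i = b - 1) → D' i = D' (i + 1)) :
    Runs P Prog.update m fun m' n =>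
      (∃ ρ' δ', Becomes N ρ' scratch δ' m m' ∧ Joins (N + 1) (ρ .byA) a (ρ' .byA) ∧
        Joins N (ρ .byB) (b - 1) (ρ' .byB) ∧ IsMeet N (ρ' .byA) (ρ' .byB) (ρ' .byBA) ∧
        StoresMin N (ρ' .byA) (ρ' .byB) (ρ' .byBA) D' δ') ∧
      n + 23 * memPot κ N m' ≤ 23 * memPot κ N m + (700 * κ + 1800) := by
  have fA : Forest (N + 1) _ _ _ _ _ := h .byA
  have fB : Forest N _ _ _ _ _ := h .byB
  have fC : Forest N _ _ _ _ _ := h .byBA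
  have eA := fA.mem_interval h1 (by omega)
  have eB := fB.mem_interval h1 hN
  have eA' := fA.ends_mem t h1 (by omega)
  have eB' := fB.ends_mem t h1 hN
  rw [ha] at eA eA'
  rw [hb] at eB eB'
  rw [Prog.update_eq]
  simp only [Prog.block]
  refine (runs_find hκ (by simp) (by simp) h (by simpa [Expr.eval] using ht) h1
    (by simp only [Dsu.size]; omega)).seq ?_
  rintro m1 n1 ⟨c1, v1, k1⟩
  rw [runs_seq, runs_assign]
  have e1 : Expr.eval m1 (.get (.hi .byA) (.reg .p)) = a := by
    simp [Expr.eval, v1, c1.arr _, ha]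
  rw [e1]
  have c2 := c1.trans (Compressed.setReg c1.holds .tA a)
  have p2 := memPot_setReg κ N m1 .tA a
  have v2 : (m1.setReg .tA a).reg .tA = a := by simp
  generalize m1.setReg .tA a = m2 at c2 p2 v2 ⊢
  refine (runs_find hκ (by simp) (by simp) c2.holds (x := t)
    (by simp [Expr.eval, c2.reg, ht]) h1 (by simpa [Dsu.size] using hN)).seq ?_
  rintro m3 n3 ⟨c3, v3, k3⟩
  have c13 := c2.trans c3
  rw [runs_seq, runs_assign]
  have e3 : Expr.eval m3 (.get (.lo .byB) (.reg .q)) = b := by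
    simp [Expr.eval, v3, c13.arr _, hb]
  rw [e3]
  have c4 := c13.trans (Compressed.setReg c3.holds .tB b)
  have p4 := memPot_setReg κ N m3 .tB b
  have v4 : (m3.setReg .tB b).reg .tB = b := by simp
  have v4' : (m3.setReg .tB b).reg .tA = a := by
    rw [Mem.setReg_reg, Function.update_of_ne (by simp), c3.reg _ (by simp), v2]
  generalize m3.setReg .tB b = m4 at c4 p4 v4 v4' ⊢
  refine (runs_find hκ (by simp) (by simp) c4.holds (x := t)
    (by simp [Expr.eval, c4.reg, ht]) h1 (by simpa [Dsu.size] using hN)).seq ?_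
  rintro m5 n5 ⟨c5, v5, k5⟩
  have c15 := c4.trans c5
  have tA5 : m5.reg .tA = a := by rw [c5.reg _ (by simp), v4']
  have tB5 : m5.reg .tB = b := by rw [c5.reg _ (by simp), v4]
  have d5 : m5.arr .diff = m.arr .diff := c15.arr _ (by simp)
  -- the difference of the set of `t`
  refine Runs.seq (Q' := fun m' n => (∃ δ', Becomes N ρ [] δ' m5 m' ∧
    StoresMin N (ρ .byA) (ρ .byB) (ρ .byBA) D' δ') ∧
    n + 23 * memPot κ N m' ≤ 23 * memPot κ N m5 + 20) ?_ ?_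
  · have hdec := hmin.decrement fA fB fC hmeet hpos h1 hN
      (by rw [ha, hb]; exact hin) (by rw [ha, hb]; exact hout)
    by_cases hd : 0 ≤ m.arr .diff (ρ .byBA t)
    · rw [if_pos hd] at hdec
      rw [runs_ifThen_true (by simpa [Test.Holds, Expr.eval, v5, d5] using hd), runs_put]
      have e : m5.setArr .diff (Expr.eval m5 (.reg .set))
          (Expr.eval m5 (.minus (.get .diff (.reg .set)) Prog.one)) =
          m5.setArr .diff (ρ .byBA t) (m.arr .diff (ρ .byBA t) - 1) := by
        simp [Expr.eval, v5, d5, Prog.one]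
      rw [e]
      refine ⟨⟨_, Becomes.putDiff c5.holds _ _, by rw [d5]; exact hdec⟩, ?_⟩
      rw [memPot_putDiff]
      simp only [Expr.steps, Test.steps, Prog.one]
      omega
    · rw [if_neg hd] at hdec
      rw [runs_ifThen_false (by simpa [Test.Holds, Expr.eval, v5, d5] using hd)]
      refine ⟨⟨_, c5.holds.becomes _, by rw [d5]; exact hdec⟩, ?_⟩
      simp only [Expr.steps, Test.steps]
      omega
  rintro m6 n6 ⟨⟨δ6, b6, min6⟩, k6⟩
  have b16 := c15.becomes.trans b6
  have tA6 : m6.reg .tA = a := by rw [b6.reg _ (by simp), tA5]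
  have tB6 : m6.reg .tB = b := by rw [b6.reg _ (by simp), tB5]
  have T6 : m6.reg .T = N := by rw [b16.reg _ (by simp), hT]
  -- the partitions by `t_A` and `t_B`
  have neA : a ≤ N → ρ .byA a ≠ ρ .byA (a + 1) := by
    intro haN he
    have e1 := fA.root_hi h1 (by omega)
    rw [ha] at e1
    have := (fA.interval t h1 (by omega) (a + 1) (by omega) (by omega)).1 (he.symm.trans e1)
    omega
  have neB : 1 ≤ b - 1 → ρ .byB (b - 1) ≠ ρ .byB (b - 1 + 1) := by
    intro hb1 he
    have e1 := fB.root_lo h1 hN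
    rw [hb] at e1
    rw [sub_add_cancel] at he
    have := (fB.interval t h1 hN (b - 1) (by omega) (by omega)).1 (he.trans e1)
    omega
  refine (runs_unite_tA hκ b6.holds T6 tA6 (by omega) neA).seq ?_
  rintro m7 n7 ⟨⟨α', joinA, b7⟩, k7⟩
  have b17 := b16.trans b7
  have tA7 : m7.reg .tA = a := by rw [b7.reg _ (by simp), tA6]
  have tB7 : m7.reg .tB = b - 1 + 1 := by rw [b7.reg _ (by simp), tB6]; ring
  refine (runs_unite_tB hκ b7.holds tB7 (by omega)
    (fun hb1 => by simpa using neB hb1)).seq ?_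
  rintro m8 n8 ⟨⟨β', joinB, b8⟩, k8⟩
  have b18 := b17.trans b8
  have tA8 : m8.reg .tA = a := by rw [b8.reg _ (by simp), tA7]
  have tB8 : m8.reg .tB = b - 1 + 1 := by rw [b8.reg _ (by simp), tB7]
  have T8 : m8.reg .T = N := by rw [b18.reg _ (by simp), hT]
  have d8 : m8.arr .diff = δ6 := by rw [b8.diff, b7.diff, b6.diff]
  set ρ8 := Function.update (Function.update ρ .byA α') .byB β' with hρ8
  have r8A : ρ8 .byA = α' := by simp [hρ8]
  have r8B : ρ8 .byB = β' := by simp [hρ8]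
  have r8C : ρ8 .byBA = ρ .byBA := by simp [hρ8]
  have joinB' : Joins N (ρ .byB) (b - 1) β' := by simpa using joinB
  have joinA' : Joins N (ρ .byA) a α' := joinA.mono (by omega)
  -- the B-A-sets
  refine (runs_adapt_tB hκ b8.holds T8 (α := ρ .byA) (β := ρ .byB) (D := D') tB8 (by omega) (by omega)
    (by rw [r8B]; exact joinB') neB (fun i i1 iN => ?_) (by rw [r8C]; exact hmeet)
    (by rw [r8C, d8]; exact min6) (fun i i1 iN e1 e2 => ?_)).seq ?_
  · rw [r8A, joinA i i1 (by omega)]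
    have : i ≠ a := by omega
    tauto
  · rw [r8B] at e2
    exact hD i i1 iN (Or.inl e1) ((joinB' i i1 iN).1 e2)
  rintro m9 n9 ⟨⟨γ', δ9, b9, meet9, min9⟩, k9, reg9⟩
  rw [r8B] at meet9 min9
  have b19 := b18.trans b9
  have tA9 : m9.reg .tA = a := by rw [reg9 _ (by simp), tA8]
  have T9 : m9.reg .T = N := by rw [reg9 _ (by simp), T8]
  set ρ9 := Function.update ρ8 .byBA γ' with hρ9
  have r9A : ρ9 .byA = α' := by simp [hρ9, r8A]
  have r9B : ρ9 .byB = β' := by simp [hρ9, r8B]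
  have r9C : ρ9 .byBA = γ' := by simp [hρ9]
  rw [runs_seq]
  refine (runs_adapt_tA hκ b9.holds T9 (α := ρ .byA) (D := D') tA9 (by omega)
    (by rw [r9A]; exact joinA') (fun haN => neA (by omega)) (by rw [r9B, r9C]; exact meet9)
    (by rw [r9B, r9C, b9.diff]; exact min9) (fun i i1 iN e1 e2 => ?_)).mono ?_
  · rw [r9A] at e1
    rw [r9B] at e2
    exact hD i i1 iN ((joinA' i i1 iN).1 e1) ((joinB' i i1 iN).1 e2)
  rintro m10 n10 ⟨⟨γ'', δ10, b10, meet10, min10⟩, k10⟩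
  rw [runs_skip]
  rw [r9A, r9B] at meet10 min10
  refine ⟨⟨Function.update ρ9 .byBA γ'', δ10, ?_, ?_, ?_, ?_, ?_⟩, ?_⟩
  · refine ⟨b10.holds, fun w hw => ?_, fun z hz => ?_, b10.diff⟩
    · rw [b10.reg w hw]
      by_cases hw' : w ∈ [Reg.tA, .tB, .T]
      · rw [reg9 w hw']
        simp only [scratch, List.mem_cons, List.not_mem_nil, or_false, not_or] at hw
        exact b18.reg w (by simp [hw])
      · rw [b9.reg w hw]
        simp only [scratch, List.mem_cons, List.not_mem_nil, or_false, not_or] at hw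
        exact b18.reg w (by simp [hw])
    · rw [b10.arr z hz, b19.arr z hz]
  · simpa [r9A] using joinA
  · simpa [r9B] using joinB'
  · simpa [r9A, r9B] using meet10
  · simpa [r9A, r9B] using min10
  · simp only [Expr.steps] at *
    omega

end

/-! ## What the structures hold for given bounds -/

/-- If the borders of an interval partition are the increases of a monotone function, then its
sets are the level sets of this function. -/
theorem Forest.root_eq_iff {n : ℤ} {par rank lo hi ρ f : ℤ → ℤ} (h : Forest n par rank lo hi ρ)
    (hf : ∀ i, 1 ≤ i → i + 1 ≤ n → f i ≤ f (i + 1))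
    (hadj : ∀ i, 1 ≤ i → i + 1 ≤ n → (ρ i = ρ (i + 1) ↔ f i = f (i + 1))) {t u : ℤ}
    (ht1 : 1 ≤ t) (htn : t ≤ n) (hu1 : 1 ≤ u) (hun : u ≤ n) : ρ t = ρ u ↔ f t = f u := by
  refine ⟨h.eq_of_root_eq (fun i i1 iN => (hadj i i1 iN).1) ht1 htn hu1 hun, fun he => ?_⟩
  wlog htu : t ≤ u generalizing t u
  · exact (this hu1 hun ht1 htn he.symm (by omega)).symm
  obtain ⟨k, rfl⟩ : ∃ k : ℕ, u = t + k := ⟨(u - t).toNat, by omega⟩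
  clear hu1 htu
  have mono : ∀ k : ℕ, t + k ≤ n → f t ≤ f (t + k) := by
    intro k
    induction k with
    | zero => simp
    | succ k ih =>
      push_cast
      intro hk
      have := hf (t + k) (by omega) (by omega)
      rw [add_assoc] at this
      exact (ih (by omega)).trans this
  induction k with
  | zero => simp
  | succ k ih =>
    push_cast at hun he ⊢
    have e1 := mono k (by omega)
    have e2 := hf (t + k) (by omega) (by omega)
    rw [add_assoc] at e2
    rw [ih (by omega) (by omega), (hadj (t + k) (by omega) (by omega)).2 (by rw [add_assoc]; omega),
      add_assoc]

/-- Parent pointers preserve `ρ`, and a fixed point is its own root. This ties the roots visible in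
the memory to the function `ρ` used in the proof. -/
theorem Forest.isRootOf_iff {n : ℤ} {m : Mem} {s : Dsu} {rank lo hi ρ : ℤ → ℤ}
    (h : Forest n (m.arr (.par s)) rank lo hi ρ) {t r : ℤ} (h1 : 1 ≤ t) (hn : t ≤ n) :
    IsRootOf m s t r ↔ r = ρ t := by
  constructor
  · rintro ⟨hr, j, rfl⟩
    have := h.iterate_mem h1 hn j
    rw [← this.2.2]
    exact (h.root_of_fixed _ this.1 this.2.1 hr).symm
  · rintro rfl
    exact ⟨h.par_root t h1 hn, h.exists_iterate_eq h1 hn⟩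

theorem Forest.sameSet_iff {n : ℤ} {m : Mem} {s : Dsu} {rank lo hi ρ : ℤ → ℤ}
    (h : Forest n (m.arr (.par s)) rank lo hi ρ) {t u : ℤ} (ht1 : 1 ≤ t) (htn : t ≤ n)
    (hu1 : 1 ≤ u) (hun : u ≤ n) : SameSet m s t u ↔ ρ t = ρ u := by
  unfold SameSet
  simp only [h.isRootOf_iff ht1 htn, h.isRootOf_iff hu1 hun]
  constructor
  · rintro ⟨r, rfl, hr⟩; exact hr
  · exact fun he => ⟨_, rfl, he⟩

/-- The value of `A` before the interval `z`. -/
def valA (A : ℕ → ℤ) (z : ℤ) : ℤ := A (z.toNat - 1)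

/-- The value of `B` after the interval `z`. -/
def valB (B : ℕ → ℤ) (z : ℤ) : ℤ := B z.toNat

/-- The difference of the bounds at the interval `z`. -/
def gap (A B : ℕ → ℤ) (z : ℤ) : ℤ := valB B z - valA A z

/-- The memory holds disjoint-set forests with the roots `ρ` which represent the bounds. -/
structure Represents (T : ℕ) (A B : ℕ → ℤ) (ρ : Dsu → ℤ → ℤ) (m : Mem) : Prop where
  holds : Holds T ρ m
  adjA : ∀ i, 1 ≤ i → i + 1 ≤ (T : ℤ) + 1 →
    (ρ .byA i = ρ .byA (i + 1) ↔ valA A i = valA A (i + 1))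
  adjB : ∀ i, 1 ≤ i → i + 1 ≤ (T : ℤ) → (ρ .byB i = ρ .byB (i + 1) ↔ valB B i = valB B (i + 1))
  meet : IsMeet T (ρ .byA) (ρ .byB) (ρ .byBA)
  min : StoresMin T (ρ .byA) (ρ .byB) (ρ .byBA) (gap A B) (m.arr .diff)

section

variable {T : ℕ} {A B : ℕ → ℤ}

theorem IsStepSeq.valA_le (hA : IsStepSeq T A) {i j : ℤ} (hij : i ≤ j) (hj : j ≤ (T : ℤ) + 1) :
    valA A i ≤ valA A j := hA.le_of_le (by omega) (by omega)

theorem IsStepSeq.valB_le (hB : IsStepSeq T B) {i j : ℤ} (hij : i ≤ j) (hj : j ≤ (T : ℤ)) :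
    valB B i ≤ valB B j := hB.le_of_le (by omega) (by omega)

theorem GoodBounds.valA_le_valB (h : GoodBounds T A B) {i : ℤ} (h1 : 1 ≤ i) (hT : i ≤ T) :
    valA A i ≤ valB B i := h.le _ (by omega) (by omega)

theorem GoodBounds.gap_nonneg (h : GoodBounds T A B) {i : ℤ} (h1 : 1 ≤ i) (hT : i ≤ T) :
    0 ≤ gap A B i := by
  have := h.valA_le_valB h1 hT
  unfold gap
  omega

end

/-! ### Reading the bounds off the structures. -/

namespace Represents

variable {T : ℕ} {A B : ℕ → ℤ} {ρ : Dsu → ℤ → ℤ} {m : Mem} (h : Represents T A B ρ m)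
  (hg : GoodBounds T A B)
include h hg

theorem rootA_iff {t u : ℤ} (ht1 : 1 ≤ t) (htT : t ≤ T + 1) (hu1 : 1 ≤ u) (huT : u ≤ T + 1) :
    ρ .byA t = ρ .byA u ↔ valA A t = valA A u :=
  (h.holds .byA).root_eq_iff (fun i i1 iT => hg.stepA.valA_le (by omega) iT) h.adjA ht1 htT hu1 huT

theorem rootB_iff {t u : ℤ} (ht1 : 1 ≤ t) (htT : t ≤ T) (hu1 : 1 ≤ u) (huT : u ≤ T) :
    ρ .byB t = ρ .byB u ↔ valB B t = valB B u :=
  (h.holds .byB).root_eq_iff (fun i i1 iT => hg.stepB.valB_le (by omega) iT) h.adjB ht1 htT hu1 huT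

omit hg in
theorem adjBA {i : ℤ} (h1 : 1 ≤ i) (hT : i + 1 ≤ T) :
    ρ .byBA i = ρ .byBA (i + 1) ↔ valA A i = valA A (i + 1) ∧ valB B i = valB B (i + 1) := by
  rw [h.meet i h1 hT, h.adjA i h1 (by omega), h.adjB i h1 hT]

/-- For monotone sequences, both values agree if and only if their sum does. So the B-A-sets are the
level sets of one monotone function, and `Forest.root_eq_iff` applies. -/
theorem rootBA_iff {t u : ℤ} (ht1 : 1 ≤ t) (htT : t ≤ T) (hu1 : 1 ≤ u) (huT : u ≤ T) :
    ρ .byBA t = ρ .byBA u ↔ valA A t = valA A u ∧ valB B t = valB B u := by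
  have key : ∀ {i j : ℤ}, i ≤ j → j ≤ T → ((valA A i = valA A j ∧ valB B i = valB B j) ↔
      valA A i + valB B i = valA A j + valB B j) := by
    intro i j hij hj
    have e1 := hg.stepA.valA_le hij (by omega)
    have e2 := hg.stepB.valB_le hij hj
    omega
  have h2 : Forest T _ _ _ _ _ := h.holds .byBA
  rw [h2.root_eq_iff (f := fun i => valA A i + valB B i)
    (fun i i1 iT => ?_) (fun i i1 iT => ?_) ht1 htT hu1 huT]
  · rcases le_total t u with htu | htu
    · exact (key htu huT).symm
    · rw [eq_comm, ← key htu htT, eq_comm (a := valA A u), eq_comm (a := valB B u)]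
  · have e1 := hg.stepA.valA_le (i := i) (j := i + 1) (by omega) (by omega)
    have e2 := hg.stepB.valB_le (i := i) (j := i + 1) (by omega) iT
    exact add_le_add e1 e2
  · rw [h.adjBA i1 iT]
    exact key (by omega) iT

theorem hi_eq_lastA {t : ℕ} (h1 : 1 ≤ t) (hT : t ≤ T + 1) :
    m.arr (.hi .byA) (ρ .byA t) = lastA T A t := by
  have hF : Forest ((T : ℤ) + 1) _ _ _ _ _ := h.holds .byA
  have e1 := hF.mem_interval (x := t) (by omega) (by omega)
  have e2 := hF.ends_mem t (by omega) (by omega)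
  have e3 := hF.root_hi (t := t) (by omega) (by omega)
  set c := m.arr (.hi .byA) (ρ .byA t) with hc
  have := (h.rootA_iff hg (t := c) (u := t) (by omega) (by omega) (by omega) (by omega)).1 e3
  simp only [valA, Int.toNat_natCast] at this
  -- Element `c` of the first structure carries the value `A (c - 1)`; this shift is the `+ 1` in
  -- the definition of `t_A`, so the largest element is `t_A` itself.
  rw [lastA_unique (c := c.toNat) h1 hT (by omega) (by omega) this fun s hs hsT he => ?_]
  · omega
  · have := (h.rootA_iff hg (t := ((s + 1 : ℕ) : ℤ)) (u := t) (by omega) (by omega) (by omega)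
      (by omega)).2 (by simp only [valA, Int.toNat_natCast, Nat.add_sub_cancel]; exact he)
    have := (hF.interval t (by omega) (by omega) _ (by omega) (by omega)).1 this
    omega

theorem lo_eq_firstB {t : ℕ} (h1 : 1 ≤ t) (hT : t ≤ T) :
    m.arr (.lo .byB) (ρ .byB t) = firstB T B t := by
  have hF : Forest (T : ℤ) _ _ _ _ _ := h.holds .byB
  have e1 := hF.mem_interval (x := t) (by omega) (by omega)
  have e2 := hF.ends_mem t (by omega) (by omega)
  have e3 := hF.root_lo (t := t) (by omega) (by omega)
  set c := m.arr (.lo .byB) (ρ .byB t) with hc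
  have := (h.rootB_iff hg (t := c) (u := t) (by omega) (by omega) (by omega) (by omega)).1 e3
  simp only [valB, Int.toNat_natCast] at this
  rw [firstB_unique (c := c.toNat) h1 hT (by omega) this fun s hs hsT he => ?_]
  · omega
  · have := (h.rootB_iff hg (t := (s : ℤ)) (u := t) (by omega) (by omega) (by omega)
      (by omega)).2 (by simp only [valB, Int.toNat_natCast]; exact he)
    have := (hF.interval t (by omega) (by omega) _ (by omega) (by omega)).1 this
    omega

theorem sameBA_iff {t u : ℕ} (ht1 : 1 ≤ t) (htT : t ≤ T) (hu1 : 1 ≤ u) (huT : u ≤ T) :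
    SameBA A B t u ↔ ρ .byBA t = ρ .byBA u := by
  rw [h.rootBA_iff hg (by omega) (by omega) (by omega) (by omega)]
  simp [SameBA, valA, valB]

/-- For monotone bounds the strict inequalities of the definition amount to the values being
different, which is all that the partitions can show. -/
theorem isMinBA_iff {t : ℕ} (h1 : 1 ≤ t) (hT : t ≤ T) :
    IsMinBA T A B t ↔ SepLeft T (ρ .byA) (ρ .byBA) t ∧ SepRight T (ρ .byB) (ρ .byBA) t := by
  unfold IsMinBA SepLeft SepRight
  refine and_congr ⟨fun hs s s1 sT sne seq => ?_, fun hs s s1 sT seq sne => ?_⟩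
    ⟨fun hs s s1 sT sne seq => ?_, fun hs s s1 sT seq sne => ?_⟩
  · lift s to ℕ using by omega
    have := hs s (by omega) (by omega)
      ((h.sameBA_iff hg (by omega) (by omega) h1 hT).2 (by push_cast; exact seq))
      ((h.sameBA_iff hg (by omega) (by omega) (by omega) (by omega)).not.2 (by push_cast; exact sne))
    rw [Ne, h.adjA _ s1 (by omega)]
    simp only [valA]
    rw [show ((s : ℤ) + 1).toNat = s + 1 by omega, Int.toNat_natCast]
    exact this.ne
  · rw [h.sameBA_iff hg (by omega) (by omega) h1 hT] at seq
    rw [h.sameBA_iff hg (by omega) (by omega) (by omega) (by omega)] at sne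
    push_cast at seq sne
    have := hs s (by omega) (by omega) sne seq
    rw [Ne, h.adjA _ (by omega) (by omega)] at this
    simp only [valA] at this
    rw [show ((s : ℤ) + 1).toNat = s + 1 by omega, Int.toNat_natCast] at this
    exact lt_of_le_of_ne (hg.stepA.le_of_le (by omega) (by omega)) this
  · lift s to ℕ using by omega
    have := hs s (by omega) (by omega)
      ((h.sameBA_iff hg (by omega) (by omega) h1 hT).2 seq)
      ((h.sameBA_iff hg (by omega) (by omega) (by omega) (by omega)).not.2 (by push_cast; exact sne))
    rw [Ne, h.adjB _ s1 (by omega)]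
    simp only [valB]
    rw [show ((s : ℤ) + 1).toNat = s + 1 by omega, Int.toNat_natCast]
    exact this.ne
  · rw [h.sameBA_iff hg (by omega) (by omega) h1 hT] at seq
    rw [h.sameBA_iff hg (by omega) (by omega) (by omega) (by omega)] at sne
    push_cast at sne
    have := hs s (by omega) (by omega) sne seq
    rw [Ne, h.adjB _ (by omega) (by omega)] at this
    simp only [valB] at this
    rw [show ((s : ℤ) + 1).toNat = s + 1 by omega, Int.toNat_natCast] at this
    exact lt_of_le_of_ne (hg.stepB.le_of_le (by omega) (by omega)) this

theorem tracks : Tracks T A B m where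
  partA t ht u hu := by
    rw [Finset.mem_Icc] at ht hu
    have hF : Forest ((T : ℤ) + 1) _ _ _ _ _ := h.holds .byA
    rw [hF.sameSet_iff (by omega) (by omega) (by omega) (by omega),
      h.rootA_iff hg (by omega) (by omega) (by omega) (by omega)]
    simp [valA]
  valueA t ht := by
    rw [Finset.mem_Icc] at ht
    have hF : Forest ((T : ℤ) + 1) _ _ _ _ _ := h.holds .byA
    exact ⟨_, (hF.isRootOf_iff (by omega) (by omega)).2 rfl, h.hi_eq_lastA hg ht.1 ht.2⟩
  partB t ht u hu := by
    rw [Finset.mem_Icc] at ht hu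
    have hF : Forest (T : ℤ) _ _ _ _ _ := h.holds .byB
    rw [hF.sameSet_iff (by omega) (by omega) (by omega) (by omega),
      h.rootB_iff hg (by omega) (by omega) (by omega) (by omega)]
    simp [valB]
  valueB t ht := by
    rw [Finset.mem_Icc] at ht
    have hF : Forest (T : ℤ) _ _ _ _ _ := h.holds .byB
    exact ⟨_, (hF.isRootOf_iff (by omega) (by omega)).2 rfl, h.lo_eq_firstB hg ht.1 ht.2⟩
  partBA t ht u hu := by
    rw [Finset.mem_Icc] at ht hu
    have hF : Forest (T : ℤ) _ _ _ _ _ := h.holds .byBA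
    rw [hF.sameSet_iff (by omega) (by omega) (by omega) (by omega),
      h.sameBA_iff hg ht.1 ht.2 hu.1 hu.2]
  valueBA t ht := by
    rw [Finset.mem_Icc] at ht
    have hF : Forest (T : ℤ) _ _ _ _ _ := h.holds .byBA
    refine ⟨_, (hF.isRootOf_iff (by omega) (by omega)).2 rfl, fun hm => ?_, fun hm => ?_⟩
    · rw [h.isMinBA_iff hg ht.1 ht.2] at hm
      rw [h.min t (by omega) (by omega), if_pos hm]
      simp [gap, valA, valB]
    · rw [h.isMinBA_iff hg ht.1 ht.2] at hm
      rw [h.min t (by omega) (by omega), if_neg hm]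

/-- The stored difference is `0` if and only if the bounds are equal. -/
theorem diff_eq_zero_iff {t : ℤ} (h1 : 1 ≤ t) (hT : t ≤ T) :
    m.arr .diff (ρ .byBA t) = 0 ↔ valA A t = valB B t := by
  have hval := h.min t h1 hT
  constructor
  · intro h0
    by_cases hs : SepLeft T (ρ .byA) (ρ .byBA) t ∧ SepRight T (ρ .byB) (ρ .byBA) t
    · rw [if_pos hs] at hval
      unfold gap at hval
      omega
    · rw [if_neg hs] at hval
      omega
  · intro he
    rw [hval, if_pos]
    · unfold gap; omega
    -- If the bounds meet on the class of `t` and `A` did not change at its left border, then `B`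
    -- would, and `B` would be below `A` just before the border. The right border is symmetric.
    refine ⟨fun s s1 sT sne seq => ?_, fun s s1 sT sne seq => ?_⟩
    · rw [Ne, h.adjBA s1 sT] at sne
      rw [h.rootBA_iff hg (by omega) sT h1 hT] at seq
      rw [Ne, h.adjA s s1 (by omega)]
      intro hA
      have e1 := hg.stepB.valB_le (i := s) (j := s + 1) (by omega) sT
      have e2 := hg.valA_le_valB s1 (by omega)
      have e3 : valB B s ≠ valB B (s + 1) := fun hB => sne ⟨hA, hB⟩
      omega
    · rw [Ne, h.adjBA s1 sT] at sne
      rw [h.rootBA_iff hg (by omega) (by omega) h1 hT] at seq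
      rw [Ne, h.adjB s s1 sT]
      intro hB
      have e1 := hg.stepA.valA_le (i := s) (j := s + 1) (by omega) (by omega)
      have e2 := hg.valA_le_valB (i := s + 1) (by omega) sT
      have e3 : valA A s ≠ valA A (s + 1) := fun hA => sne ⟨hA, hB⟩
      omega

end Represents

/-! ## One round -/

theorem valA_dropFrom {c : ℕ} {A : ℕ → ℤ} {i : ℤ} (hi : 1 ≤ i) :
    valA (dropFrom c A) i = if i ≤ c then valA A i else valA A i - 1 := by
  unfold valA dropFrom
  exact if_congr (by omega) rfl rfl

theorem valB_dropFrom {c : ℕ} {B : ℕ → ℤ} {i : ℤ} (hi : 0 ≤ i) :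
    valB (dropFrom c B) i = if i < c then valB B i else valB B i - 1 := by
  unfold valB dropFrom
  exact if_congr (by omega) rfl rfl

section

variable {T : ℕ} {A B : ℕ → ℤ}

/-- The element `t_A + 1` carries the value `A t_A`, which exceeds its predecessor by exactly one;
lowering it removes this border and no other. -/
theorem valA_drop_lastA_iff (hg : GoodBounds T A B) {t : ℕ} (h1 : 1 ≤ t) (ht : t ≤ T) {i : ℤ}
    (hi : 1 ≤ i) (hiT : i + 1 ≤ (T : ℤ) + 1) :
    valA (dropFrom (lastA T A t) A) i = valA (dropFrom (lastA T A t) A) (i + 1) ↔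
      valA A i = valA A (i + 1) ∨ i = lastA T A t := by
  rw [valA_dropFrom hi, valA_dropFrom (by omega)]
  rcases lt_trichotomy i (lastA T A t) with h | h | h
  · rw [if_pos (by omega), if_pos (by omega)]; omega
  · have := hg.A_lastA h1 ht (by omega)
    rw [if_pos (by omega), if_neg (by omega)]
    unfold valA
    rw [show i.toNat - 1 = lastA T A t - 1 by omega, show (i + 1).toNat - 1 = lastA T A t by omega]
    exact ⟨fun _ => Or.inr h, fun _ => by omega⟩
  · rw [if_neg (by omega), if_neg (by omega)]; omega

theorem valB_drop_firstB_iff (hg : GoodBounds T A B) {t : ℕ} (h1 : 1 ≤ t) (ht : t ≤ T)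
    (hlt : A (t - 1) < B t) {i : ℤ} (hi : 1 ≤ i) :
    valB (dropFrom (firstB T B t) B) i = valB (dropFrom (firstB T B t) B) (i + 1) ↔
      valB B i = valB B (i + 1) ∨ i = (firstB T B t : ℤ) - 1 := by
  rw [valB_dropFrom (by omega), valB_dropFrom (by omega)]
  rcases lt_trichotomy i ((firstB T B t : ℤ) - 1) with h | h | h
  · rw [if_pos (by omega), if_pos (by omega)]; omega
  · have := hg.B_firstB h1 ht hlt
    rw [if_pos (by omega), if_neg (by omega)]
    unfold valB
    rw [show i.toNat = firstB T B t - 1 by omega, show (i + 1).toNat = firstB T B t by omega]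
    exact ⟨fun _ => Or.inr h, fun _ => by omega⟩
  · rw [if_neg (by omega), if_neg (by omega)]; omega

theorem Represents.of_arr_eq {ρ : Dsu → ℤ → ℤ} {m m' : Mem} (h : Represents T A B ρ m)
    (hm : Holds T ρ m') (hd : m'.arr .diff = m.arr .diff) : Represents T A B ρ m' :=
  ⟨hm, h.adjA, h.adjB, h.meet, by rw [hd]; exact h.min⟩

variable {P : ℕ → ℝ} {κ : ℕ} {ρ : Dsu → ℤ → ℤ} {m : Mem}

/-- At interval `u` the upper bound falls if `t_B ≤ u` and the lower bound `A (u - 1)` falls if `t_A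
< u`. So the difference falls by one between `t_B` and `t_A` inclusive, and elsewhere it stays. -/
theorem Represents.runs_update (hκ : (T : ℤ) + 1 ≤ fastGrow κ 1) (h : Represents T A B ρ m)
    (hg : GoodBounds T A B) (hT : m.reg .T = T) {t : ℕ} (hr : m.reg .t = t) (h1 : 1 ≤ t) (ht : t ≤ T)
    (hlt : A (t - 1) < B t) :
    Runs P Prog.update m fun m' n =>
      (∃ ρ', Represents T (dropFrom (lastA T A t) A) (dropFrom (firstB T B t) B) ρ' m' ∧
        (∀ w, w ∉ scratch → m'.reg w = m.reg w) ∧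
        ∀ a, a ∈ [Arr.inA, .inB, .order, .out] → m'.arr a = m.arr a) ∧
      n + 23 * memPot κ T m' ≤ 23 * memPot κ T m + (700 * κ + 1800) := by
  have eA := lastA_spec (A := A) h1 (by omega : t ≤ T + 1)
  have eB := firstB_spec (B := B) h1 ht
  have iffA := fun {i : ℤ} => valA_drop_lastA_iff hg h1 ht (i := i)
  have iffB := fun {i : ℤ} => valB_drop_firstB_iff hg h1 ht hlt (i := i)
  refine (_root_.runs_update hκ h.holds hT hr (by omega) (by omega) h.meet h.min
    (D' := gap (dropFrom (lastA T A t) A) (dropFrom (firstB T B t) B))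
    (fun u u1 uT _ _ => hg.gap_nonneg u1 uT) (h.hi_eq_lastA hg h1 (by omega))
    (h.lo_eq_firstB hg h1 ht) (fun u u1 uT hb ha => ?_) (fun u u1 uT hu => ?_)
    fun i i1 iT hA hB => ?_).mono ?_
  · unfold gap
    rw [valA_dropFrom u1, valB_dropFrom (by omega), if_neg (by omega), if_pos ha]
    ring
  · unfold gap
    rw [valA_dropFrom u1, valB_dropFrom (by omega)]
    rcases hu with hu | hu
    · rw [if_pos hu, if_pos (by omega)]
    · rw [if_neg (by omega), if_neg (by omega)]
      ring
  · rw [h.adjA i i1 (by omega), ← iffA i1 (by omega)] at hA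
    rw [h.adjB i i1 iT, ← iffB i1] at hB
    unfold gap
    rw [hA, hB]
  · rintro m' n ⟨⟨ρ', δ', hb, jA, jB, meet, min⟩, hk⟩
    refine ⟨⟨ρ', ⟨hb.holds, fun i i1 iT => ?_, fun i i1 iT => ?_, meet, by rw [hb.diff]; exact min⟩,
      hb.reg, hb.arr⟩, hk⟩
    · rw [jA i i1 iT, h.adjA i i1 iT, iffA i1 iT]
    · rw [jB i i1 iT, h.adjB i i1 iT, iffB i1]

end

/-- The memory represents the state of the greedy algorithm after `k` rounds. -/
structure HoldsState (T : ℕ) (ord : ℕ → ℕ) (g : GreedyState) (k : ℕ) (ρ : Dsu → ℤ → ℤ) (m : Mem) :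
    Prop where
  represents : Represents T g.A g.B ρ m
  regT : m.reg .T = T
  regk : m.reg .k = k + 1
  order : ∀ j ∈ Finset.Icc 1 T, m.arr .order j = ord j
  out : ∀ t ∈ Finset.Icc 1 T, output m t = g.x t

/-- The two tests of the program are those of the greedy step: the stored value is `0` exactly if
the bounds meet at `t`, and `A (t - 1)` differs from `A T` exactly if `t` and `T + 1` have different
roots. -/
theorem runs_round {T : ℕ} {P : ℕ → ℝ} {κ k : ℕ} {ρ : Dsu → ℤ → ℤ} {m : Mem} {ord : ℕ → ℕ}
    {g : GreedyState} (hκ : (T : ℤ) + 1 ≤ fastGrow κ 1) (h : HoldsState T ord g k ρ m)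
    (hg : GoodBounds T g.A g.B) (hk : k < T) (ho : ord (k + 1) ∈ Finset.Icc 1 T) :
    Runs P Prog.round m fun m' n =>
      (∃ ρ', HoldsState T ord (greedyStep T P (ord (k + 1)) g) (k + 1) ρ' m') ∧
      n + 23 * memPot κ T m' ≤ 23 * memPot κ T m + (769 * κ + 2000) := by
  obtain ⟨t, ht⟩ : ∃ t, t = ord (k + 1) := ⟨_, rfl⟩
  rw [← ht] at ho ⊢
  obtain ⟨h1, hT⟩ := Finset.mem_Icc.1 ho
  unfold Prog.round
  simp only [Prog.block]
  rw [runs_seq, runs_assign]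
  have e1 : Expr.eval m (.get .order (.reg .k)) = t := by
    have := h.order (k + 1) (Finset.mem_Icc.2 ⟨by omega, hk⟩)
    push_cast at this
    simp [Expr.eval, h.regk, this, ht]
  rw [e1]
  have c1 := Compressed.setReg h.represents.holds .t t
  have p1 := memPot_setReg κ T m .t t
  have v1 : (m.setReg .t t).reg .t = t := by simp
  generalize m.setReg .t t = m1 at c1 p1 v1 ⊢
  refine (runs_find hκ (by simp) (by simp) c1.holds (x := t) (by simp [Expr.eval, v1]) (by omega)
    (by simpa [Dsu.size] using hT)).seq ?_
  rintro m2 n2 ⟨c2, v2, k2⟩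
  have t2 : m2.reg .t = t := by rw [c2.reg _ (by simp), v1]
  have c02 := c1.trans c2
  have d2 : m2.arr .diff = m.arr .diff := c02.arr _ (by simp)
  have T2 : m2.reg .T = T := by rw [c02.reg _ (by simp), h.regT]
  have hzero := h.represents.diff_eq_zero_iff hg (t := t) (by omega) (by omega)
  simp only [valA, valB, Int.toNat_natCast] at hzero
  have hle := hg.le t h1 hT
  -- a memory which still represents `g`
  have keep : ∀ {R : List Reg} {m' : Mem}, Compressed T ρ R m m' → Reg.T ∉ R → Reg.k ∉ R →
      HoldsState T ord g k ρ m' := fun {R m'} c hR hR' =>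
    ⟨h.represents.of_arr_eq c.holds (c.arr _ (by simp)), by rw [c.reg _ hR, h.regT],
      by rw [c.reg _ hR', h.regk], fun j hj => by rw [c.arr _ (by simp), h.order j hj],
      fun j hj => by unfold output; rw [c.arr _ (by simp)]; exact h.out j hj⟩
  refine Runs.seq (Q' := fun m' n => (∃ ρ', HoldsState T ord (greedyStep T P t g) k ρ' m') ∧
    n + 23 * memPot κ T m' ≤ 23 * memPot κ T m2 + (746 * κ + 1900)) ?_ ?_
  · by_cases hd : m.arr .diff (ρ .byBA t) = 0
    · have hcond : ¬ g.A (t - 1) < g.B t := by rw [hzero] at hd; omega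
      rw [runs_ifThen_false (by simpa [Prog.ne, Test.Holds, Expr.eval, v2, d2] using hd)]
      refine ⟨⟨ρ, ?_⟩, ?_⟩
      · unfold greedyStep
        rw [if_neg fun hc => hcond hc.1]
        exact keep c02 (by simp) (by simp)
      · simp only [Prog.ne, Expr.steps, Test.steps]
        omega
    · have hcond : g.A (t - 1) < g.B t := by rw [hzero] at hd; omega
      rw [runs_ifThen_true (by simpa [Prog.ne, Test.Holds, Expr.eval, v2, d2] using hd)]
      refine (runs_find hκ (by simp) (by simp) c2.holds (x := t) (by simp [Expr.eval, t2]) (by omega)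
        (by simp only [Dsu.size]; omega)).seq ?_
      rintro m3 n3 ⟨c3, v3, k3⟩
      refine (runs_find hκ (by simp) (by simp) c3.holds (x := T + 1)
        (by simp [Expr.eval, c3.reg, T2, Prog.one]) (by omega) (by simp only [Dsu.size]; omega)).seq ?_
      rintro m4 n4 ⟨c4, v4, k4⟩
      have p4 : m4.reg .p = ρ .byA t := by rw [c4.reg _ (by simp), v3]
      have t4 : m4.reg .t = t := by rw [c4.reg _ (by simp), c3.reg _ (by simp), t2]
      have c04 := (c02.trans c3).trans c4
      have hroot := h.represents.rootA_iff hg (t := t) (u := T + 1) (by omega) (by omega) (by omega)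
        (by omega)
      simp only [valA, Int.toNat_natCast] at hroot
      rw [show ((T : ℤ) + 1).toNat - 1 = T by omega] at hroot
      have hAT := hg.stepA.le_of_le (s := t - 1) (t := T) (by omega) le_rfl
      have hlt : ρ .byA t ≠ ρ .byA (T + 1) ↔ g.A (t - 1) < g.A T := by
        rw [Ne, hroot]; omega
      rw [runs_seq]
      by_cases hc : g.A (t - 1) < g.A T ∨ P t < 0
      · rw [runs_ifThen_true (by
          simpa [Prog.ne, Test.Holds, Expr.eval, p4, v4, t4, ← hlt] using hc), runs_seq, runs_put]
        have e4 : m4.setArr .out (Expr.eval m4 (.reg .t)) (Expr.eval m4 Prog.one) =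
            m4.setArr .out t 1 := by simp [Expr.eval, t4, Prog.one]
        rw [e4]
        have h4 := keep c04 (by simp) (by simp)
        have p5 : memPot κ T (m4.setArr .out t 1) = memPot κ T m4 := memPot_of_arr_eq fun s => by simp
        have rep5 : Represents T g.A g.B ρ (m4.setArr .out t 1) :=
          h4.represents.of_arr_eq (h4.represents.holds.of_arr_eq fun s => by simp) (by simp)
        rw [runs_seq]
        refine (rep5.runs_update hκ hg (by simpa using h4.regT) (t := t) (by simpa using t4) h1 hT
          hcond).mono ?_
        rintro m6 n6 ⟨⟨ρ', rep6, reg6, arr6⟩, k6⟩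
        rw [runs_skip, runs_skip]
        refine ⟨⟨ρ', ?_⟩, ?_⟩
        · unfold greedyStep
          rw [if_pos ⟨hcond, hc⟩]
          refine ⟨rep6, ?_, ?_, fun j hj => ?_, fun j hj => ?_⟩
          · rw [reg6 _ (by simp [scratch])]; simpa using h4.regT
          · rw [reg6 _ (by simp [scratch])]; simpa using h4.regk
          · rw [arr6 _ (by simp)]; simpa using h4.order j hj
          · unfold output
            rw [arr6 _ (by simp)]
            rcases eq_or_ne j t with rfl | hne
            · simp
            · have : (j : ℤ) ≠ t := by exact_mod_cast hne
              simpa [output, hne, this] using h4.out j hj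
        · simp only [Prog.ne, Prog.one, Expr.steps, Test.steps] at *
          omega
      · rw [runs_ifThen_false (by
          simpa [Prog.ne, Test.Holds, Expr.eval, p4, v4, t4, ← hlt] using hc), runs_skip]
        refine ⟨⟨ρ, ?_⟩, ?_⟩
        · unfold greedyStep
          rw [if_neg fun hc' => hc hc'.2]
          exact keep c04 (by simp) (by simp)
        · simp only [Prog.ne, Prog.one, Expr.steps, Test.steps] at *
          omega
  · rintro m6 n6 ⟨⟨ρ', h6⟩, k6⟩
    rw [runs_seq, runs_assign, runs_skip]
    have e6 : Expr.eval m6 (.plus (.reg .k) Prog.one) = (k + 1 : ℕ) + 1 := by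
      simp [Expr.eval, h6.regk, Prog.one]
    rw [e6, memPot_setReg]
    refine ⟨⟨ρ', ⟨h6.represents.of_arr_eq h6.represents.holds rfl, by simpa using h6.regT, by simp,
      h6.order, h6.out⟩⟩, ?_⟩
    simp only [Prog.one, Expr.steps] at *
    omega

/-! ## The initialization -/

section

variable {P : ℕ → ℝ}

/-- An invariant rule for loops with amortized cost. The final index is only known to exceed `z`,
because the range may be empty. The upper limit is evaluated in every pass, so its value must follow
from the invariant. -/
theorem runs_forTo {v : Reg} {a b : Expr} {c : Cmd} {m : Mem} {y z : ℤ} (I : ℤ → Mem → Prop)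
    (pot : Mem → ℕ) {K : ℕ} (ha : a.eval m = y) (ha' : a.steps ≤ 1) (hb' : b.steps ≤ 3)
    (hpot : ∀ m' w, pot (Mem.setReg m' v w) = pot m')
    (hI : ∀ i m' w, I i m' → I i (Mem.setReg m' v w)) (h : I y m)
    (hb : ∀ i m', I i m' → b.eval m' = z)
    (hc : ∀ i m', y ≤ i → i ≤ z → m'.reg v = i → I i m' →
      Runs P c m' fun m'' n => (m''.reg v = i ∧ I (i + 1) m'') ∧ n + pot m'' ≤ pot m' + K) :
    Runs P (Prog.forTo v a b c) m fun m' n =>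
      (∃ i, z < i ∧ I i m') ∧ n + pot m' ≤ pot m + (z + 1 - y).toNat * (K + 12) + 12 := by
  have loop : ∀ (k : ℕ) (i : ℤ) (m' : Mem), y ≤ i → (z + 1 - i).toNat = k → m'.reg v = i → I i m' →
      Runs P (.while (.le (.reg v) b) (Prog.block [c, .assign v (.plus (.reg v) Prog.one)])) m'
        fun m'' n => (∃ i, z < i ∧ I i m'') ∧ n + pot m'' ≤ pot m' + k * (K + 12) + 6 := by
    intro k
    induction k with
    | zero =>
      intro i m' hi hk hv hm
      refine runs_while_false (by simp only [Test.Holds, Expr.eval, hv, hb i m' hm]; omega)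
        ⟨⟨i, by omega, hm⟩, ?_⟩
      simp only [Test.steps, Expr.steps]
      omega
    | succ k ih =>
      intro i m' hi hk hv hm
      refine runs_while_true (by simp only [Test.Holds, Expr.eval, hv, hb i m' hm]; omega) ?_
      simp only [Prog.block]
      refine (hc i m' hi (by omega) hv hm).seq ?_
      rintro m1 n1 ⟨⟨v1, I1⟩, k1⟩
      rw [runs_seq, runs_assign, runs_skip]
      have e1 : Expr.eval m1 (.plus (.reg v) Prog.one) = i + 1 := by simp [Expr.eval, v1, Prog.one]
      rw [e1]
      refine (ih (i + 1) (m1.setReg v (i + 1)) (by omega) (by omega) (by simp) (hI _ _ _ I1)).mono ?_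
      rintro m2 n2 ⟨I2, k2⟩
      refine ⟨I2, ?_⟩
      rw [hpot] at k2
      simp only [Test.steps, Expr.steps, Prog.one]
      rw [Nat.succ_mul]
      omega
  unfold Prog.forTo
  simp only [Prog.block]
  rw [runs_seq, runs_assign, ha, runs_seq]
  refine (loop _ y (m.setReg v y) le_rfl rfl (by simp) (hI _ _ _ h)).mono ?_
  rintro m1 n1 ⟨I1, k1⟩
  rw [runs_skip]
  rw [hpot] at k1
  exact ⟨I1, by omega⟩

/-- The element `x` is a set of its own, with rank `0`. -/
def IsSingle (m : Mem) (s : Dsu) (x : ℤ) : Prop :=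
  m.arr (.par s) x = x ∧ m.arr (.rank s) x = 0 ∧ m.arr (.lo s) x = x ∧ m.arr (.hi s) x = x

theorem runs_makeSet {s : Dsu} {v : Reg} {m : Mem} :
    Runs P (Prog.makeSet s (.reg v)) m fun m' n => m'.reg = m.reg ∧ IsSingle m' s (m.reg v) ∧
      (∀ s' x, IsSingle m s' x → IsSingle m' s' x) ∧
      (∀ a, a ∈ [Arr.inA, .inB, .order, .out] → m'.arr a = m.arr a) ∧ n = 13 := by
  simp only [Prog.makeSet, Prog.block, runs_seq, runs_put, runs_skip]
  refine ⟨rfl, ?_, fun s' x h => ?_, fun a ha => ?_, rfl⟩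
  · simp [IsSingle, Expr.eval]
  · obtain ⟨h1, h2, h3, h4⟩ := h
    rcases eq_or_ne s' s with rfl | hs
    · rcases eq_or_ne x (m.reg v) with rfl | hx
      · simp [IsSingle, Expr.eval]
      · simp [IsSingle, Expr.eval, hx, h1, h2, h3, h4]
    · simp [IsSingle, hs, h1, h2, h3, h4]
  · simp only [List.mem_cons, List.not_mem_nil, or_false] at ha
    rcases ha with rfl | rfl | rfl | rfl <;> simp

theorem Forest.of_single {n : ℤ} {m : Mem} {s : Dsu} (h : ∀ x, 1 ≤ x → x ≤ n → IsSingle m s x) :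
    Forest n (m.arr (.par s)) (m.arr (.rank s)) (m.arr (.lo s)) (m.arr (.hi s)) id where
  root_mem x h1 hn := ⟨h1, hn⟩
  par_mem x h1 hn := by rw [(h x h1 hn).1]; exact ⟨h1, hn⟩
  rank_nonneg x h1 hn := (h x h1 hn).2.1.ge
  rank_lt x h1 hn hne := absurd (h x h1 hn).1 hne
  rank_le_root x h1 hn := le_rfl
  root_par x h1 hn := (h x h1 hn).1
  root_of_fixed x h1 hn _ := rfl
  par_root x h1 hn := (h x h1 hn).1
  rank_root_le x h1 hn := by
    obtain ⟨_, e2, e3, e4⟩ := h x h1 hn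
    simp only [id, e2, e3, e4, sub_self, le_refl]
  interval x h1 hn y _ _ := by
    obtain ⟨_, _, e3, e4⟩ := h x h1 hn
    simp only [id, e3, e4]
    omega
  ends_mem x h1 hn := by
    obtain ⟨_, _, e3, e4⟩ := h x h1 hn
    simp only [id, e3, e4]
    exact ⟨h1, hn⟩

theorem dsuPot_eq_zero {κ : ℕ} {N : ℤ} {m : Mem} {s : Dsu}
    (h : ∀ x, 1 ≤ x → x ≤ s.size N → IsSingle m s x) : dsuPot κ N m s = 0 := by
  unfold dsuPot forestPot
  refine Finset.sum_eq_zero fun x hx => ?_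
  rw [Finset.mem_Icc] at hx
  obtain ⟨e1, e2, -⟩ := h x hx.1 hx.2
  simp [nodePot, e1, e2]

variable {T : ℕ} {A B : ℕ → ℤ} {ord : ℕ → ℕ}

theorem Loaded.of_eq {m m' : Mem} (h : Loaded T A B ord m) (hT : m'.reg .T = m.reg .T)
    (ha : ∀ a, a ∈ [Arr.inA, .inB, .order, .out] → m'.arr a = m.arr a) : Loaded T A B ord m' := by
  unfold Loaded
  rw [hT, ha .inA (by simp), ha .inB (by simp), ha .order (by simp)]
  exact h

theorem Loaded.inA_eq {m : Mem} (h : Loaded T A B ord m) {z : ℤ} (h0 : 0 ≤ z) (hT : z ≤ T) :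
    m.arr .inA z = A z.toNat := by
  have := h.2.1 z.toNat (by omega)
  rwa [Int.toNat_of_nonneg h0] at this

theorem Loaded.inB_eq {m : Mem} (h : Loaded T A B ord m) {z : ℤ} (h0 : 0 ≤ z) (hT : z ≤ T) :
    m.arr .inB z = B z.toNat := by
  have := h.2.2.1 z.toNat (by omega)
  rwa [Int.toNat_of_nonneg h0] at this

/-- The structures hold the partitions as far as they are determined by the bounds at the intervals
below `y` (first structure) and below `z` (second and third structure). -/
structure Initialized (T : ℕ) (A B : ℕ → ℤ) (ord : ℕ → ℕ) (ρ : Dsu → ℤ → ℤ) (y z : ℤ) (m : Mem) :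
    Prop where
  loaded : Loaded T A B ord m
  out : ∀ t, 1 ≤ t → t ≤ (T : ℤ) → m.arr .out t = 0
  holds : Holds T ρ m
  adjA : ∀ i, 1 ≤ i → i + 1 ≤ (T : ℤ) + 1 →
    (ρ .byA i = ρ .byA (i + 1) ↔ i + 1 < y ∧ valA A i = valA A (i + 1))
  adjB : ∀ i, 1 ≤ i → i + 1 ≤ (T : ℤ) →
    (ρ .byB i = ρ .byB (i + 1) ↔ i + 1 < z ∧ valB B i = valB B (i + 1))
  adjBA : ∀ i, 1 ≤ i → i + 1 ≤ (T : ℤ) → (ρ .byBA i = ρ .byBA (i + 1) ↔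
    i + 1 < z ∧ valA A i = valA A (i + 1) ∧ valB B i = valB B (i + 1))

/-- The initial memory is arbitrary, so its potential has no bound; the amortized analysis starts
here, with potential `0`. The indices `2 2` say that no border has been removed yet. -/
theorem runs_makeSets {m : Mem} (κ : ℕ) (h : Loaded T A B ord m) :
    Runs P (.seq (Prog.forTo .i Prog.one (.plus (.reg .T) Prog.one) (Prog.makeSet .byA (.reg .i)))
      (Prog.forTo .i Prog.one (.reg .T) (Prog.block [
        Prog.makeSet .byB (.reg .i),
        Prog.makeSet .byBA (.reg .i),
        .put .out (.reg .i) (.lit 0)]))) m fun m' n =>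
      (∃ ρ, Initialized T A B ord ρ 2 2 m') ∧ memPot κ T m' = 0 ∧ n ≤ 75 * T + 60 := by
  refine Runs.seq (Q' := fun m' n => (Loaded T A B ord m' ∧
    ∀ x, 1 ≤ x → x ≤ (T : ℤ) + 1 → IsSingle m' .byA x) ∧ n ≤ 30 * T + 45) ?_ ?_
  · refine (runs_forTo (z := T + 1) (K := 13) (fun i m' => Loaded T A B ord m' ∧
      ∀ x, 1 ≤ x → x < i → IsSingle m' .byA x) (fun _ => 0) rfl le_rfl (by simp [Expr.steps, Prog.one])
      (fun _ _ => rfl) (fun i m' w hm => ⟨hm.1.of_eq (by simp) fun _ _ => rfl, hm.2⟩)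
      ⟨h, fun x h1 h2 => ?_⟩
      (fun i m' hm => by simp [Expr.eval, hm.1.1, Prog.one]) fun i m' h1 h2 hi hm => ?_).mono ?_
    · simp only [Expr.eval, Prog.one] at h2
      omega
    · refine runs_makeSet.mono ?_
      rintro m1 n1 ⟨r1, s1, k1, a1, rfl⟩
      refine ⟨⟨by rw [r1, hi], hm.1.of_eq (by rw [r1]) a1, fun x g1 g2 => ?_⟩, by omega⟩
      rcases eq_or_ne x i with rfl | hx
      · rwa [hi] at s1
      · exact k1 _ _ (hm.2 x g1 (by omega))
    · rintro m1 n1 ⟨⟨i, hi, hm⟩, k1⟩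
      refine ⟨⟨hm.1, fun x g1 g2 => hm.2 x g1 (by omega)⟩, ?_⟩
      simp only [Prog.one, Expr.eval] at k1
      omega
  · rintro m1 n1 ⟨⟨l1, s1⟩, k1⟩
    refine (runs_forTo (z := T) (K := 30) (fun i m' => Loaded T A B ord m' ∧
      (∀ x, 1 ≤ x → x ≤ (T : ℤ) + 1 → IsSingle m' .byA x) ∧ ∀ x, 1 ≤ x → x < i →
        IsSingle m' .byB x ∧ IsSingle m' .byBA x ∧ m'.arr .out x = 0) (fun _ => 0) rfl le_rfl
      (by simp [Expr.steps]) (fun _ _ => rfl)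
      (fun i m' w hm => ⟨hm.1.of_eq (by simp) fun _ _ => rfl, hm.2⟩) ⟨l1, s1, fun x h1 h2 => ?_⟩
      (fun i m' hm => by simp [Expr.eval, hm.1.1]) fun i m' h1 h2 hi hm => ?_).mono ?_
    · simp only [Expr.eval, Prog.one] at h2
      omega
    · simp only [Prog.block]
      refine runs_makeSet.seq ?_
      rintro m2 n2 ⟨r2, s2, k2, a2, rfl⟩
      refine runs_makeSet.seq ?_
      rintro m3 n3 ⟨r3, s3, k3, a3, rfl⟩
      rw [runs_seq, runs_put, runs_skip]
      have r3i : m3.reg .i = i := by rw [r3, r2, hi]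
      have e3 : m3.setArr .out (Expr.eval m3 (.reg .i)) (Expr.eval m3 (.lit 0)) =
          m3.setArr .out i 0 := by simp [Expr.eval, r3i]
      rw [e3]
      rw [hi] at s2
      rw [r2, hi] at s3
      have keep : ∀ s x, IsSingle m3 s x → IsSingle (m3.setArr .out i 0) s x := fun s x hx => by
        simpa [IsSingle] using hx
      refine ⟨⟨by simpa using r3i, ?_, fun x g1 g2 => keep _ _ (k3 _ _ (k2 _ _ (hm.2.1 x g1 g2))),
        fun x g1 g2 => ?_⟩, by simp only [Expr.steps]; omega⟩
      · have l2 := hm.1.of_eq (by rw [r2]) a2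
        have l3 := l2.of_eq (by rw [r3]) a3
        simpa [Loaded] using l3
      · rcases eq_or_ne x i with rfl | hx
        · exact ⟨keep _ _ (k3 _ _ s2), keep _ _ s3, by simp⟩
        · obtain ⟨f1, f2, f3⟩ := hm.2.2 x g1 (by omega)
          exact ⟨keep _ _ (k3 _ _ (k2 _ _ f1)), keep _ _ (k3 _ _ (k2 _ _ f2)), by
            simp [hx, a3 .out (by simp), a2 .out (by simp), f3]⟩
    · rintro m2 n2 ⟨⟨i, hi, l2, sA, hm⟩, k2⟩
      have sB : ∀ x, 1 ≤ x → x ≤ (T : ℤ) → IsSingle m2 .byB x := fun x g1 g2 =>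
        (hm x g1 (by omega)).1
      have sC : ∀ x, 1 ≤ x → x ≤ (T : ℤ) → IsSingle m2 .byBA x := fun x g1 g2 =>
        (hm x g1 (by omega)).2.1
      refine ⟨⟨fun _ => id, l2, fun x g1 g2 => (hm x g1 (by omega)).2.2, ?_, ?_, ?_, ?_⟩, ?_, ?_⟩
      · rintro (_ | _ | _)
        exacts [Forest.of_single sA, Forest.of_single sB, Forest.of_single sC]
      · intro i i1 iT
        simp only [id]
        omega
      · intro i i1 iT
        simp only [id]
        omega
      · intro i i1 iT
        simp only [id]
        omega
      · unfold memPot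
        rw [dsuPot_eq_zero (s := .byA) sA, dsuPot_eq_zero (s := .byB) sB, dsuPot_eq_zero (s := .byBA) sC]
      · simp only [Prog.one, Expr.eval] at k2
        omega

variable {κ : ℕ} {N : ℤ} {ρ : Dsu → ℤ → ℤ}

theorem runs_uniteIf (hκ : N + 1 ≤ fastGrow κ 1) {s : Dsu} {b : Test} {m : Mem} (h : Holds N ρ m)
    {x : ℤ} (hi : m.reg .i = x + 1) (h1 : 1 ≤ x) (hx : x + 1 ≤ s.size N)
    (hne : ρ s x ≠ ρ s (x + 1)) :
    Runs P (Prog.ifThen b (Prog.unite s (.minus (.reg .i) Prog.one) (.reg .i))) m fun m' n =>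
      (∃ α', (∀ j, 1 ≤ j → j + 1 ≤ s.size N →
          (α' j = α' (j + 1) ↔ ρ s j = ρ s (j + 1) ∨ (j = x ∧ b.Holds P m))) ∧
        Becomes N (Function.update ρ s α') [.cur, .nxt, .r₁, .r₂, .root, .mn, .mx] (m.arr .diff)
          m m') ∧
      n + 23 * memPot κ N m' ≤ 23 * memPot κ N m + (69 * κ + 140 + b.steps) := by
  by_cases hb : b.Holds P m
  · rw [runs_ifThen_true hb]
    refine (runs_unite hκ h (x := x) (by simp [Expr.eval, hi, Prog.one])
      (fun m' hm' => by simp [Expr.eval, hm', hi]) h1 hx hne).mono ?_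
    rintro m' n ⟨⟨c, hu⟩, hk⟩
    refine ⟨⟨_, fun j j1 jn => ?_, hu.becomes⟩, ?_⟩
    · rw [(h s).joins h1 hx hne hu.root_or j j1 jn]
      tauto
    · simp only [Expr.steps, Prog.one] at hk ⊢
      omega
  · rw [runs_ifThen_false hb]
    refine ⟨⟨ρ s, fun j _ _ => by tauto, ?_⟩, by omega⟩
    rw [Function.update_eq_self]
    exact h.becomes _

theorem Initialized.setReg {y z : ℤ} {m : Mem} (h : Initialized T A B ord ρ y z m) {v : Reg}
    (hv : v ≠ .T) (w : ℤ) : Initialized T A B ord ρ y z (m.setReg v w) :=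
  ⟨h.loaded.of_eq (by simp [hv.symm]) fun _ _ => rfl, h.out, h.holds, h.adjA, h.adjB, h.adjBA⟩

/-- Pass `i` decides about the border between `i - 1` and `i`, which is still present at that time.
The first structure has one element more than the others, hence the final indices `T + 2` and `T +
1`. -/
theorem runs_uniteAll (hκ : (T : ℤ) + 1 ≤ fastGrow κ 1) {m : Mem}
    (h : Initialized T A B ord ρ 2 2 m) :
    Runs P (.seq (Prog.forTo .i (.lit 2) (.plus (.reg .T) Prog.one)
        (Prog.ifThen (.eq (.get .inA (.minus (.reg .i) (.lit 2))) (.get .inA (.minus (.reg .i) Prog.one)))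
          (Prog.unite .byA (.minus (.reg .i) Prog.one) (.reg .i))))
      (Prog.forTo .i (.lit 2) (.reg .T) (Prog.block [
        Prog.ifThen (.eq (.get .inB (.minus (.reg .i) Prog.one)) (.get .inB (.reg .i)))
          (Prog.unite .byB (.minus (.reg .i) Prog.one) (.reg .i)),
        Prog.ifThen (Test.and
            (.eq (.get .inA (.minus (.reg .i) (.lit 2))) (.get .inA (.minus (.reg .i) Prog.one)))
            (.eq (.get .inB (.minus (.reg .i) Prog.one)) (.get .inB (.reg .i))))
          (Prog.unite .byBA (.minus (.reg .i) Prog.one) (.reg .i))]))) m fun m' n =>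
      (∃ ρ', Initialized T A B ord ρ' (T + 2) (T + 1) m') ∧
      n + 23 * memPot κ T m' ≤ 23 * memPot κ T m + T * (207 * κ + 520) + 24 := by
  have eA : ∀ {ρ y z} {m : Mem} {i : ℤ}, Initialized T A B ord ρ y z m → m.reg .i = i → 2 ≤ i →
      i ≤ (T : ℤ) + 1 → (Test.Holds P m (.eq (.get .inA (.minus (.reg .i) (.lit 2)))
        (.get .inA (.minus (.reg .i) Prog.one))) ↔ valA A (i - 1) = valA A (i - 1 + 1)) := by
    intro ρ y z m i hm hi h1 h2
    simp only [Test.Holds, Expr.eval, hi, Prog.one]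
    rw [hm.loaded.inA_eq (by omega) (by omega), hm.loaded.inA_eq (by omega) (by omega)]
    unfold valA
    rw [show (i - 1).toNat - 1 = (i - 2).toNat by omega,
      show (i - 1 + 1).toNat - 1 = (i - 1).toNat by omega]
  have eB : ∀ {ρ y z} {m : Mem} {i : ℤ}, Initialized T A B ord ρ y z m → m.reg .i = i → 2 ≤ i →
      i ≤ (T : ℤ) → (Test.Holds P m (.eq (.get .inB (.minus (.reg .i) Prog.one))
        (.get .inB (.reg .i))) ↔ valB B (i - 1) = valB B (i - 1 + 1)) := by
    intro ρ y z m i hm hi h1 h2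
    simp only [Test.Holds, Expr.eval, hi, Prog.one]
    rw [hm.loaded.inB_eq (by omega) (by omega), hm.loaded.inB_eq (by omega) (by omega)]
    unfold valB
    rw [sub_add_cancel]
  refine Runs.seq (Q' := fun m' n => (∃ ρ, Initialized T A B ord ρ (T + 2) 2 m') ∧
    n + 23 * memPot κ T m' ≤ 23 * memPot κ T m + T * (69 * κ + 170) + 12) ?_ ?_
  · refine (runs_forTo (y := 2) (z := T + 1) (K := 69 * κ + 155)
      (fun i m' => ∃ ρ, Initialized T A B ord ρ i 2 m')
      (fun m' => 23 * memPot κ T m') rfl le_rfl (by simp [Expr.steps, Prog.one]) (fun _ _ => rfl)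
      (fun i m' w ⟨ρ, hm⟩ => ⟨ρ, hm.setReg (by simp) w⟩) ⟨ρ, h⟩
      (fun i m' ⟨ρ, hm⟩ => by simp [Expr.eval, hm.loaded.1, Prog.one])
      fun i m' h1 h2 hi ⟨ρ, hm⟩ => ?_).mono ?_
    · refine (runs_uniteIf hκ hm.holds (x := i - 1) (by rw [hi]; ring) (by omega)
        (by simp only [Dsu.size]; omega) ?_).mono ?_
      · rw [Ne, hm.adjA _ (by omega) (by omega)]
        omega
      · rintro m1 n1 ⟨⟨α', hα, hb⟩, k1⟩
        refine ⟨⟨by rw [hb.reg _ (by simp), hi], Function.update ρ .byA α', ?_⟩, ?_⟩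
        · refine ⟨hm.loaded.of_eq (hb.reg _ (by simp)) hb.arr, fun t t1 tT => ?_, hb.holds,
            fun j j1 jT => ?_, by simpa using hm.adjB, by simpa using hm.adjBA⟩
          · rw [hb.arr _ (by simp), hm.out t t1 tT]
          · rw [Function.update_self, hα j j1 (by simpa [Dsu.size] using jT), hm.adjA j j1 jT,
              eA hm hi h1 h2]
            constructor
            · rintro (⟨g1, g2⟩ | ⟨rfl, g⟩)
              · exact ⟨by omega, g2⟩
              · exact ⟨by omega, g⟩
            · rintro ⟨g1, g2⟩
              rcases lt_or_eq_of_le (show j ≤ i - 1 by omega) with g | rfl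
              · exact Or.inl ⟨by omega, g2⟩
              · exact Or.inr ⟨rfl, g2⟩
        · simp only [Test.steps, Expr.steps, Prog.one] at k1
          omega
    · rintro m1 n1 ⟨⟨i, hi, ρ, hm⟩, k1⟩
      refine ⟨⟨ρ, hm.loaded, hm.out, hm.holds, fun j j1 jT => ?_, hm.adjB, hm.adjBA⟩, ?_⟩
      · rw [hm.adjA j j1 jT]
        exact and_congr_left' (by omega)
      · rw [show ((T : ℤ) + 1 + 1 - 2).toNat = T by omega] at k1
        have : T * (69 * κ + 155 + 12) ≤ T * (69 * κ + 170) := Nat.mul_le_mul_left _ (by omega)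
        omega
  · rintro m1 n1 ⟨⟨ρ1, h1⟩, k1⟩
    refine (runs_forTo (y := 2) (z := T) (K := 138 * κ + 330)
      (fun i m' => ∃ ρ, Initialized T A B ord ρ (T + 2) i m')
      (fun m' => 23 * memPot κ T m') rfl le_rfl (by simp [Expr.steps]) (fun _ _ => rfl)
      (fun i m' w ⟨ρ, hm⟩ => ⟨ρ, hm.setReg (by simp) w⟩) ⟨ρ1, h1⟩
      (fun i m' ⟨ρ, hm⟩ => by simp [Expr.eval, hm.loaded.1])
      fun i m' i1 i2 hi ⟨ρ, hm⟩ => ?_).mono ?_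
    · simp only [Prog.block]
      refine (runs_uniteIf hκ hm.holds (x := i - 1) (by rw [hi]; ring) (by omega)
        (by simp only [Dsu.size]; omega) ?_).seq ?_
      · rw [Ne, hm.adjB _ (by omega) (by omega)]
        omega
      rintro m2 n2 ⟨⟨β', hβ, b2⟩, k2⟩
      have hi2 : m2.reg .i = i := by rw [b2.reg _ (by simp), hi]
      have l2 := hm.loaded.of_eq (b2.reg _ (by simp)) b2.arr
      refine (runs_uniteIf hκ b2.holds (s := .byBA) (x := i - 1) (by rw [hi2]; ring) (by omega)
        (by simp only [Dsu.size]; omega) ?_).seq ?_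
      · rw [Function.update_of_ne (by simp), Ne, hm.adjBA _ (by omega) (by omega)]
        omega
      rintro m3 n3 ⟨⟨γ', hγ, b3⟩, k3⟩
      rw [runs_skip]
      have eA2 : Test.Holds P m2 (.eq (.get .inA (.minus (.reg .i) (.lit 2)))
          (.get .inA (.minus (.reg .i) Prog.one))) ↔ valA A (i - 1) = valA A (i - 1 + 1) := by
        rw [← eA hm hi i1 (by omega)]
        simp only [Test.Holds, Expr.eval, Prog.one, hi, hi2, b2.arr .inA (by simp)]
      have eB2 : Test.Holds P m2 (.eq (.get .inB (.minus (.reg .i) Prog.one))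
          (.get .inB (.reg .i))) ↔ valB B (i - 1) = valB B (i - 1 + 1) := by
        rw [← eB hm hi i1 i2]
        simp only [Test.Holds, Expr.eval, Prog.one, hi, hi2, b2.arr .inB (by simp)]
      refine ⟨⟨by rw [b3.reg _ (by simp), hi2], _, l2.of_eq (b3.reg _ (by simp)) b3.arr,
        fun t t1 tT => ?_, b3.holds, by simpa using hm.adjA, fun j j1 jT => ?_, fun j j1 jT => ?_⟩, ?_⟩
      · rw [b3.arr _ (by simp), b2.arr _ (by simp), hm.out t t1 tT]
      · rw [Function.update_of_ne (by simp), Function.update_self, hβ j j1 jT, hm.adjB j j1 jT,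
          eB hm hi i1 i2]
        constructor
        · rintro (⟨g1, g2⟩ | ⟨rfl, g⟩)
          · exact ⟨by omega, g2⟩
          · exact ⟨by omega, g⟩
        · rintro ⟨g1, g2⟩
          rcases lt_or_eq_of_le (show j ≤ i - 1 by omega) with g | rfl
          · exact Or.inl ⟨by omega, g2⟩
          · exact Or.inr ⟨rfl, g2⟩
      · rw [Function.update_self, hγ j j1 jT, Function.update_of_ne (by simp), hm.adjBA j j1 jT,
          Test.Holds, eA2, eB2]
        constructor
        · rintro (⟨g1, g2⟩ | ⟨rfl, g⟩)
          · exact ⟨by omega, g2⟩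
          · exact ⟨by omega, g⟩
        · rintro ⟨g1, g2⟩
          rcases lt_or_eq_of_le (show j ≤ i - 1 by omega) with g | rfl
          · exact Or.inl ⟨by omega, g2⟩
          · exact Or.inr ⟨rfl, g2⟩
      · simp only [Test.steps, Expr.steps, Prog.one] at k2 k3
        omega
    · rintro m2 n2 ⟨⟨i, hi, ρ, hm⟩, k2⟩
      refine ⟨⟨ρ, hm.loaded, hm.out, hm.holds, hm.adjA, fun j j1 jT => ?_, fun j j1 jT => ?_⟩, ?_⟩
      · rw [hm.adjB j j1 jT]
        exact and_congr_left' (by omega)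
      · rw [hm.adjBA j j1 jT]
        exact and_congr_left' (by omega)
      · have : ((T : ℤ) + 1 - 2).toNat * (138 * κ + 330 + 12) ≤ T * (138 * κ + 350) :=
          Nat.mul_le_mul (by omega) (by omega)
        have e : T * (207 * κ + 520) = T * (69 * κ + 170) + T * (138 * κ + 350) := by ring
        omega

end

section

variable {P : ℕ → ℝ} {T : ℕ} {A B : ℕ → ℤ} {ord : ℕ → ℕ} {κ : ℕ} {ρ : Dsu → ℤ → ℤ}

theorem Runs.seq_assoc {c d e : Cmd} {m : Mem} {Q : Mem → ℕ → Prop}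
    (h : Runs P (.seq (.seq c d) e) m Q) : Runs P (.seq c (.seq d e)) m Q := by
  simp only [runs_seq] at h ⊢
  simpa only [add_assoc] using h

/-- The loop which stores the differences. -/
theorem runs_storeDiffs (hκ : (T : ℤ) + 1 ≤ fastGrow κ 1) {m : Mem}
    (h : Initialized T A B ord ρ (T + 2) (T + 1) m) :
    Runs P (Prog.forTo .i Prog.one (.reg .T) (Prog.block [
        Prog.find .byBA (.reg .i) .set,
        .assign .d (.minus (.get .inB (.reg .i)) (.get .inA (.minus (.reg .i) Prog.one))),
        Prog.storeDiff .set])) m fun m' n =>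
      (Represents T A B ρ m' ∧ Loaded T A B ord m' ∧
        ∀ t, 1 ≤ t → t ≤ (T : ℤ) → m'.arr .out t = 0) ∧
      n + 23 * memPot κ T m' ≤ 23 * memPot κ T m + T * (115 * κ + 320) + 12 := by
  classical
  refine (runs_forTo (z := T) (K := 115 * κ + 308) (fun i m' =>
      Initialized T A B ord ρ (T + 2) (T + 1) m' ∧ ∀ t, 1 ≤ t → t < i → t ≤ T →
        m'.arr .diff (ρ .byBA t) = if SepLeft T (ρ .byA) (ρ .byBA) t ∧
          SepRight T (ρ .byB) (ρ .byBA) t then gap A B t else -1)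
    (fun m' => 23 * memPot κ T m') rfl le_rfl (by simp [Expr.steps]) (fun _ _ => rfl)
    (fun i m' w hm => ⟨hm.1.setReg (by simp) w, hm.2⟩) ⟨h, fun t t1 t2 => ?_⟩
    (fun i m' hm => by simp [Expr.eval, hm.1.loaded.1]) fun i m' i1 iT hi hm => ?_).mono ?_
  · simp only [Expr.eval, Prog.one] at t2
    omega
  · obtain ⟨hm, hd⟩ := hm
    simp only [Expr.eval, Prog.one] at i1
    simp only [Prog.block]
    refine (runs_find hκ (by simp) (by simp) hm.holds (x := i) (by simp [Expr.eval, hi]) i1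
      (by simpa [Dsu.size] using iT)).seq ?_
    rintro m1 n1 ⟨c1, v1, k1⟩
    rw [runs_seq, runs_assign]
    have e1 : Expr.eval m1 (.minus (.get .inB (.reg .i)) (.get .inA (.minus (.reg .i) Prog.one))) =
        gap A B i := by
      simp only [Expr.eval, Prog.one, c1.reg .i (by simp), hi, c1.arr .inB (by simp),
        c1.arr .inA (by simp)]
      rw [hm.loaded.inB_eq (by omega) iT, hm.loaded.inA_eq (by omega) (by omega)]
      unfold gap valA valB
      rw [show (i - 1).toNat = i.toNat - 1 by omega]
    rw [e1]
    have c2 := c1.trans (Compressed.setReg c1.holds .d (gap A B i))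
    have p2 := memPot_setReg κ T m1 .d (gap A B i)
    have v2 : (m1.setReg .d (gap A B i)).reg .d = gap A B i := by simp
    have s2 : (m1.setReg .d (gap A B i)).reg .set = ρ .byBA i := by simp [v1]
    generalize m1.setReg .d (gap A B i) = m2 at c2 p2 v2 s2 ⊢
    refine (runs_storeDiff hκ (by simp) c2.holds (by rw [c2.reg _ (by simp), hm.loaded.1]) i1 iT
      s2).seq ?_
    rintro m3 n3 ⟨b3, k3⟩
    rw [runs_skip]
    have b := c2.becomes.trans b3
    refine ⟨⟨by rw [b.reg _ (by simp), hi], ⟨hm.loaded.of_eq (b.reg _ (by simp)) b.arr,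
      fun t t1 tT => ?_, b.holds, hm.adjA, hm.adjB, hm.adjBA⟩, fun t t1 ti tT => ?_⟩, ?_⟩
    · rw [b.arr _ (by simp), hm.out t t1 tT]
    · rw [b3.diff, v2]
      -- The entry of a B-A-set is written once for each of its members; the difference is constant
      -- on the set, so rewriting does no harm.
      by_cases he : ρ .byBA t = ρ .byBA i
      · rw [he, Function.update_self]
        have hgap : gap A B t = gap A B i := by
          refine (hm.holds .byBA).eq_of_root_eq (fun j j1 jT hj => ?_) t1 tT i1 iT he
          obtain ⟨-, g1, g2⟩ := (hm.adjBA j j1 jT).1 hj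
          unfold gap
          rw [g1, g2]
        unfold SepLeft SepRight
        rw [he, hgap]
      · rw [Function.update_of_ne he, c2.arr _ (by simp)]
        refine hd t t1 (lt_of_le_of_ne (by omega) ?_) tT
        rintro rfl
        exact he rfl
    · simp only [Expr.steps, Prog.one] at k1 ⊢
      omega
  · rintro m1 n1 ⟨⟨i, hi, hm, hd⟩, k1⟩
    refine ⟨⟨⟨hm.holds, fun j j1 jT => ?_, fun j j1 jT => ?_, fun j j1 jT => ?_,
      fun t t1 tT => ?_⟩, hm.loaded, hm.out⟩, ?_⟩
    · rw [hm.adjA j j1 jT]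
      exact and_iff_right (by omega)
    · rw [hm.adjB j j1 jT]
      exact and_iff_right (by omega)
    · rw [hm.adjBA j j1 jT, hm.adjA j j1 (by omega), hm.adjB j j1 jT]
      have e1 : j + 1 < (T : ℤ) + 2 := by omega
      have e2 : j + 1 < (T : ℤ) + 1 := by omega
      simp only [e1, e2, true_and]
    · rw [hd t t1 (by omega) tT]
    · simp only [Prog.one, Expr.eval] at k1
      rw [show ((T : ℤ) + 1 - 1).toNat = T by omega] at k1
      have : T * (115 * κ + 308 + 12) = T * (115 * κ + 320) := rfl
      omega

theorem runs_init (hκ : (T : ℤ) + 1 ≤ fastGrow κ 1) {m : Mem} (h : Loaded T A B ord m) :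
    Runs P Prog.init m fun m' n => (∃ ρ, HoldsState T ord (greedy T P A B ord 0) 0 ρ m') ∧
      n + 23 * memPot κ T m' ≤ T * (322 * κ + 915) + 100 := by
  unfold Prog.init
  simp only [Prog.block]
  refine Runs.seq_assoc ((runs_makeSets κ h).seq ?_)
  rintro m1 n1 ⟨⟨ρ1, h1⟩, p1, k1⟩
  refine Runs.seq_assoc ((runs_uniteAll hκ h1).seq ?_)
  rintro m2 n2 ⟨⟨ρ2, h2⟩, k2⟩
  refine (runs_storeDiffs hκ h2).seq ?_
  rintro m3 n3 ⟨⟨h3, l3, o3⟩, k3⟩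
  rw [runs_seq, runs_assign, runs_skip]
  have e3 : Expr.eval m3 Prog.one = 1 := rfl
  rw [e3]
  refine ⟨⟨ρ2, h3.of_arr_eq h3.holds rfl, by simpa using l3.1, by simp, l3.2.2.2, fun t ht => ?_⟩, ?_⟩
  · rw [Finset.mem_Icc] at ht
    exact o3 t (by omega) (by omega)
  · rw [memPot_setReg]
    simp only [Prog.one, Expr.steps]
    have : T * (322 * κ + 915) = T * 75 + T * (207 * κ + 520) + T * (115 * κ + 320) := by ring
    omega

/-! ## The whole program -/

variable (hA : IsStepSeq T A) (hB : IsStepSeq T B) (hAB : ∀ t ∈ Finset.Icc 1 T, A t ≤ B t)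
  (ho : IsPriceOrder T P ord)
include hA hB hAB ho

theorem HoldsState.runs_round {k : ℕ} {m : Mem} (hκ : (T : ℤ) + 1 ≤ fastGrow κ 1)
    (h : HoldsState T ord (greedy T P A B ord k) k ρ m) (hk : k < T) :
    Runs P Prog.round m fun m' n =>
      (∃ ρ', HoldsState T ord (greedy T P A B ord (k + 1)) (k + 1) ρ' m') ∧
      n + 23 * memPot κ T m' ≤ 23 * memPot κ T m + (769 * κ + 2000) :=
  _root_.runs_round hκ h (greedyInv_greedy hA hB hAB ho hk.le).good hk
    (Finset.mem_Icc.2 (ho.1.mapsTo ⟨by omega, hk⟩))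

theorem runs_rounds {m : Mem} (h : Loaded T A B ord m) {j : ℕ} (hj : j ≤ T) :
    Runs P (Prog.rounds j) m fun m' _ => ∃ ρ, HoldsState T ord (greedy T P A B ord j) j ρ m' := by
  have hκ : (T : ℤ) + 1 ≤ fastGrow (invAck T + 1) 1 := by exact_mod_cast lt_fastGrow_invAck T
  induction j with
  | zero => exact (runs_init hκ h).mono fun m' n h => h.1
  | succ j ih =>
    refine (ih (by omega)).seq ?_
    rintro m' n ⟨ρ, hm⟩
    exact (hm.runs_round hA hB hAB ho hκ hj).mono fun m'' n' h => h.1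

/-- The amortized costs of the initialization and of the `T` rounds add up, and the potential that
is left at the end is dropped. -/
theorem runs_main (hκ : (T : ℤ) + 1 ≤ fastGrow κ 1) {m : Mem} (h : Loaded T A B ord m) :
    Runs P Prog.main m fun m' n => (∃ ρ, HoldsState T ord (greedy T P A B ord T) T ρ m') ∧
      n ≤ T * (1091 * κ + 2919) + 104 := by
  have loop : ∀ (d k : ℕ) (ρ : Dsu → ℤ → ℤ) (m : Mem), k + d = T →
      HoldsState T ord (greedy T P A B ord k) k ρ m →
      Runs P (.while (.le (.reg .k) (.reg .T)) Prog.round) m fun m' n =>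
        (∃ ρ, HoldsState T ord (greedy T P A B ord T) T ρ m') ∧
        n + 23 * memPot κ T m' ≤ 23 * memPot κ T m + d * (769 * κ + 2004) + 4 := by
    intro d
    induction d with
    | zero =>
      intro k ρ m hk hm
      obtain rfl : k = T := hk
      refine runs_while_false (by simp [Test.Holds, Expr.eval, hm.regk, hm.regT]) ⟨⟨ρ, hm⟩, ?_⟩
      simp only [Test.steps, Expr.steps]
      omega
    | succ d ih =>
      intro k ρ m hk hm
      refine runs_while_true (by simp only [Test.Holds, Expr.eval, hm.regk, hm.regT]; omega) ?_
      refine (hm.runs_round hA hB hAB ho hκ (by omega)).mono ?_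
      rintro m1 n1 ⟨⟨ρ1, h1⟩, k1⟩
      refine (ih (k + 1) ρ1 m1 (by omega) h1).mono ?_
      rintro m2 n2 ⟨h2, k2⟩
      refine ⟨h2, ?_⟩
      simp only [Test.steps, Expr.steps]
      rw [add_one_mul]
      omega
  refine (runs_init hκ h).seq ?_
  rintro m1 n1 ⟨⟨ρ1, h1⟩, k1⟩
  refine (loop T 0 ρ1 m1 (by omega) h1).mono ?_
  rintro m2 n2 ⟨h2, k2⟩
  refine ⟨h2, ?_⟩
  have : T * (1091 * κ + 2919) = T * (322 * κ + 915) + T * (769 * κ + 2004) := by ring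
  omega

omit hA hB hAB ho in
theorem IsOptimal.congr {x x' : ℕ → ℤ} (h : IsOptimal T P (BoundsFeasible T A B) x)
    (he : ∀ t ∈ Finset.Icc 1 T, x' t = x t) : IsOptimal T P (BoundsFeasible T A B) x' := by
  have hc : cost T P x' = cost T P x := Finset.sum_congr rfl fun t ht => by rw [he t ht]
  refine ⟨⟨fun t ht => by rw [he t ht]; exact h.1.1 t ht, fun t ht => ?_⟩, fun y hy => hc ▸ h.2 y hy⟩
  rw [Finset.sum_congr rfl fun i hi => he i (Finset.Icc_subset_Icc_right (Finset.mem_Icc.1 ht).2 hi)]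
  exact h.1.2 t ht

theorem main_isOptimal {m : Mem} (h : Loaded T A B ord m) :
    ∃ (m' : Mem) (n : ℕ), Exec P Prog.main m m' n ∧
      IsOptimal T P (BoundsFeasible T A B) (output m') ∧
      (∀ t ∈ Finset.Icc 1 T, output m' t = (greedy T P A B ord T).x t) ∧
      (2 ≤ T → n ≤ 6000 * (T * invAck T)) := by
  have hκ : (T : ℤ) + 1 ≤ fastGrow (invAck T + 1) 1 := by exact_mod_cast lt_fastGrow_invAck T
  obtain ⟨m', n, he, ⟨ρ, hm⟩, hn⟩ := runs_main hA hB hAB ho hκ h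
  refine ⟨m', n, he, (greedy_isOptimal hA hB hAB ho).congr hm.out, hm.out, fun h2 => hn.trans ?_⟩
  have h1 := one_le_invAck h2
  have h3 : T ≤ T * invAck T := Nat.le_mul_of_pos_right T h1
  -- For `T ≥ 2` one has `α(T) ≥ 1`, so the terms linear in `T` and the constant 104 are absorbed by
  -- `T * α(T)`: 1091 + 4010 + 52 is below 6000.
  have e : T * (1091 * (invAck T + 1) + 2919) = 1091 * (T * invAck T) + 4010 * T := by ring
  omega

end

theorem theorem2 :
    ∃ C : ℕ,
      -- bounds `A`, `B` on the partial sums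
      (∀ (T : ℕ) (A B : ℕ → ℤ) (P : ℕ → ℝ) (ord : ℕ → ℕ) (m : Mem),
        IsStepSeq T A → IsStepSeq T B → (∀ t ∈ Finset.Icc 1 T, A t ≤ B t) →
        IsPriceOrder T P ord → Loaded T A B ord m →
          (∃ (m' : Mem) (n : ℕ), Exec P Prog.main m m' n ∧
            IsOptimal T P (BoundsFeasible T A B) (output m') ∧
            (∀ t ∈ Finset.Icc 1 T, output m' t = (greedy T P A B ord T).x t) ∧
            (2 ≤ T → n ≤ C * (T * invAck T))) ∧
          (∀ j ≤ T, ∃ (m' : Mem) (n : ℕ), Exec P (Prog.rounds j) m m' n ∧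
            Tracks T (greedy T P A B ord j).A (greedy T P A B ord j).B m' ∧
            (∀ t ∈ Finset.Icc 1 T, output m' t = (greedy T P A B ord j).x t))) ∧
      -- the local heating problem
      (∀ (T : ℕ) (H : ℝ) (L U D P : ℕ → ℝ) (ord : ℕ → ℕ) (m : Mem),
        0 < H → L 1 = U 1 → (∃ x, HeatingFeasible T H L U D x) →
        IsPriceOrder T P ord →
        Loaded T (heatLower T H L D) (heatUpper T H L U D) ord m →
          IsStepSeq T (heatLower T H L D) ∧ IsStepSeq T (heatUpper T H L U D) ∧
          (∀ x, HeatingFeasible T H L U D x ↔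
            BoundsFeasible T (heatLower T H L D) (heatUpper T H L U D) x) ∧
          ∃ (m' : Mem) (n : ℕ), Exec P Prog.main m m' n ∧
            IsOptimal T P (HeatingFeasible T H L U D) (output m') ∧
            (2 ≤ T → n ≤ C * (T * invAck T))) := by
  refine ⟨6000, fun T A B P ord m hA hB hAB ho hm => ⟨main_isOptimal hA hB hAB ho hm, fun j hj => ?_⟩,
    fun T H L U D P ord m hH hLU hx ho hm => ?_⟩
  · obtain ⟨m', n, he, ρ, h⟩ := runs_rounds hA hB hAB ho hm hj
    exact ⟨m', n, he, h.represents.tracks (greedyInv_greedy hA hB hAB ho hj).good, h.out⟩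
  · obtain ⟨hA, hB, hAB, hiff⟩ := heat_bounds hH hLU hx
    obtain ⟨m', n, he, hopt, -, hn⟩ := main_isOptimal hA hB hAB ho hm
    rw [← funext fun x => propext (hiff x)] at hopt
    exact ⟨hA, hB, hiff, m', n, he, hopt, hn⟩
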